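/- A generalized semi-Markov process (GSMP) consists of a finite set $S$ of states, a finite set $\mathcal E$ of events, a map $\mathbf E$ assigning to each state $s$ a non-empty set $\mathbf E(s)\subseteq\mathcal E$ of scheduled events, a successor function $\mathrm{Succ}$ assigning a probability distribution on $S$ to each $s\in S$ and $E\subseteq\mathcal E$, and an initial distribution $\alpha_0$ on $S$. Each event $e$ has bounds $\ell_e\in\mathbb N_0$ and $u_e\in\mathbb N\cup\{\infty\}$ (with $u_e>0$), $\ell_e\le u_e$. If $\ell_e=u_e$, then $e$ is a fixed-delay event: its delay is $\ell_e$. If $\ell_e<u_e$, then $e$ is a variable-delay event: its delay has a density $f_e$ that is positive and continuous on $[\ell_e,u_e]$ (on $[\ell_e,\infty)$ if $u_e=\infty$), zero elsewhere, and has finite mean. A configuration is a pair $(s,\nu)$, where $\nu$ gives the time $\nu(e)\ge 0$ elapsed since each $e\in\mathbf E(s)$ was scheduled (with $\nu(e)<u_e$), and the time $\nu(\vartriangle)$ spent in the previous configuration. The process starts in a state drawn from $\alpha_0$ with $\nu=0$. In $(s,\nu)$ the remaining delays of the scheduled events are independent, each conditioned on the elapsed time $\nu(e)$; the set $E$ of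 events whose remaining delay $t$ is minimal occurs after time $t$ (two variable-delay events, or a variable-delay and a fixed-delay event, almost surely do not occur simultaneously), and the process moves to a state $s'$ drawn from $\mathrm{Succ}(s,E)$. Events of $\mathbf E(s)\setminus\mathbf E(s')$ are discarded, those of $(\mathbf E(s')\cap\mathbf E(s))\setminus E$ are inherited (their elapsed time grows by $t$), and those of $(\mathbf E(s')\setminus\mathbf E(s))\cup(\mathbf E(s')\cap E)$ are newly scheduled with elapsed time $0$. This is a Markov chain on configurations with transition kernel $P$; a run is an infinite sequence of configurations, and "almost every run" refers to the law of this chain. Let $B$ be the largest finite number among the bounds $\ell_e,u_e$. Two configurations $(s_1,\nu_1)$, $(s_2,\nu_2)$ lie in the same region iff $s_1=s_2$; for every $e\in\mathbf E(s_1)$ either $\nu_1(e),\nu_2(e)$ have the same integral part and both or neither are integers, or both exceed $B$; and for all $e,f\in\mathbf E(s_1)$ with $\nu_1(e),\nu_1(f)\le B$, the fractional part of $\nu_1(e)$ is at most that of $\nu_1(f)$ iff the same holds for $\nu_2$. The region graph has the regions as vertices and an edge from $R$ to $R'$ iff $P(z,R')>0$ for some $z\in R$. A bottom strongly connected component (BSCC)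 is a strongly connected component that no edge leaves. A fixed-delay event $f$ can schedule a fixed-delay event $g$ if there are states $s,s'$ and a set $E$ of fixed-delay events scheduled in $s$ with $f\in E$, $\mathrm{Succ}(s,E)(s')>0$, $g\in\mathbf E(s')$, and $g\notin\mathbf E(s)$ or $g\in E$. A fixed-delay event is ticking if it can schedule itself, directly or through a chain of fixed-delay events each of which can schedule the next. The GSMP is single-ticking if at most one fixed-delay event is ticking. **Proposition.** In a single-ticking GSMP, almost every run reaches a BSCC of the region graph, i.e. it visits a configuration whose region belongs to a bottom strongly connected component of the region graph. -/

import Mathlib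

open MeasureTheory ProbabilityTheory Set Filter

/-- The closed interval `[l, u]` (or `[l, ∞)` when `u = ⊤`) of possible delays. -/
def delayInterval (l : ℕ) (u : ℕ∞) : Set ℝ :=
  {x | (l : ℝ) ≤ x ∧ ∀ n : ℕ, u = n → x ≤ n}

/-- A generalized semi-Markov process with finite state set `S` and finite event set `Ev`, together
with the delay bounds and the densities of its events.  An event `e` is fixed-delay if
`lower e = upper e` and variable-delay if `lower e < upper e`. -/
structure GSMP (S Ev : Type*) where
  /-- lower bound of the delay, a non-negative integer -/
  lower : Ev → ℕ
  /-- upper bound of the delay, a positive integer or `⊤` -/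
  upper : Ev → ℕ∞
  upper_ne_zero : ∀ e, upper e ≠ 0
  lower_le_upper : ∀ e, (lower e : ℕ∞) ≤ upper e
  /-- density of the delay; only the values at variable-delay events matter -/
  dens : Ev → ℝ → ℝ
  dens_pos : ∀ e, (lower e : ℕ∞) < upper e → ∀ x ∈ delayInterval (lower e) (upper e), 0 < dens e x
  dens_cont : ∀ e, (lower e : ℕ∞) < upper e →
    ContinuousOn (dens e) (delayInterval (lower e) (upper e))
  dens_zero : ∀ e, (lower e : ℕ∞) < upper e → ∀ x ∉ delayInterval (lower e) (upper e), dens e x = 0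
  dens_integral : ∀ e, (lower e : ℕ∞) < upper e →
    ∫ x in delayInterval (lower e) (upper e), dens e x = 1
  /-- the delay has finite expected value -/
  dens_mean : ∀ e, (lower e : ℕ∞) < upper e →
    IntegrableOn (fun x => x * dens e x) (delayInterval (lower e) (upper e))
  /-- the set of events scheduled in a state -/
  sched : S → Finset Ev
  sched_nonempty : ∀ s, (sched s).Nonempty
  /-- the successor distribution for a state and a set of events occurring simultaneously in it -/
  succ : S → Finset Ev → PMF S
  /-- the initial distribution -/
  init : PMF S

namespace GSMP

section Race

/-! Auxiliary facts about a race between independent delays with densities `g i`. -/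

variable {ι : Type*}

theorem race_hasDerivAt {g : ℝ → ℝ} (hint : IntegrableOn g (Ioi 0)) (hm : Measurable g)
    {x : ℝ} (hx : 0 < x) (hc : ContinuousAt g x) :
    HasDerivAt (fun t => ∫ y in Ioi t, g y) (-g x) x := by
  have hii : IntervalIntegrable g volume 0 x :=
    (intervalIntegrable_iff_integrableOn_Ioc_of_le hx.le).2 (hint.mono_set Ioc_subset_Ioi_self)
  have h1 : HasDerivAt (fun u => ∫ y in (0:ℝ)..u, g y) (g x) x :=
    intervalIntegral.integral_hasDerivAt_right hii
      (hm.stronglyMeasurable.stronglyMeasurableAtFilter) hc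
  have h2 := h1.const_sub (∫ y in Ioi 0, g y)
  refine h2.congr_of_eventuallyEq ?_
  filter_upwards [lt_mem_nhds hx] with t ht
  have := intervalIntegral.integral_Ioi_sub_Ioi (f := g) (μ := volume) hint ht.le
  linarith

theorem race_continuousOn {g : ℝ → ℝ} (hint : IntegrableOn g (Ioi 0)) (T : ℝ) :
    ContinuousOn (fun t => ∫ y in Ioi t, g y) (Icc 0 T) := by
  have h1 : ContinuousOn (fun u => ∫ y in (0:ℝ)..u, g y) (Icc 0 T) := by
    refine (intervalIntegral.continuousOn_primitive (a := 0) (b := T) (f := g) (μ := volume)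
      ?_).congr ?_
    · rw [integrableOn_Icc_iff_integrableOn_Ioc]
      exact hint.mono_set Ioc_subset_Ioi_self
    · intro x hx
      exact intervalIntegral.integral_of_le hx.1
  refine ((continuousOn_const (c := ∫ y in Ioi 0, g y)).sub h1).congr ?_
  intro t ht
  have := intervalIntegral.integral_Ioi_sub_Ioi (f := g) (μ := volume) hint ht.1
  simp only [Pi.sub_apply]
  linarith

theorem race_mass [DecidableEq ι] (V : Finset ι) (g : ι → ℝ → ℝ) (D : Set ℝ) (hD : D.Countable)
    (hnn : ∀ i ∈ V, ∀ x, 0 ≤ g i x) (hm : ∀ i ∈ V, Measurable (g i))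
    (hint : ∀ i ∈ V, IntegrableOn (g i) (Ioi 0)) (h1 : ∀ i ∈ V, ∫ y in Ioi 0, g i y = 1)
    (hc : ∀ i ∈ V, ∀ x > 0, x ∉ D → ContinuousAt (g i) x) (T : ℝ) (hT : 0 ≤ T) :
    ∑ i ∈ V, ∫⁻ t in Ico 0 T, ENNReal.ofReal (g i t * ∏ c ∈ V.erase i, ∫ y in Ioi t, g c y)
      = ENNReal.ofReal (1 - ∏ c ∈ V, ∫ y in Ioi T, g c y) := by
  have hSnn : ∀ c ∈ V, ∀ t, 0 ≤ ∫ y in Ioi t, g c y := fun c hcV t =>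
    integral_nonneg fun x => hnn c hcV x
  have hprodcont : ∀ W ⊆ V, ContinuousOn (fun t => ∏ c ∈ W, ∫ y in Ioi t, g c y) (Icc 0 T) := by
    intro W hW
    exact continuousOn_finsetProd _ fun c hcW => race_continuousOn (hint c (hW hcW)) T
  have hterm : ∀ i ∈ V, IntervalIntegrable
      (fun t => g i t * ∏ c ∈ V.erase i, ∫ y in Ioi t, g c y) volume 0 T := by
    intro i hi
    apply IntervalIntegrable.mul_continuousOn
    · exact (intervalIntegrable_iff_integrableOn_Ioc_of_le hT).2
        ((hint i hi).mono_set Ioc_subset_Ioi_self)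
    · rw [uIcc_of_le hT]
      exact hprodcont _ (Finset.erase_subset _ _)
  have hftc : ∫ t in (0:ℝ)..T, (∑ i ∈ V, -(g i t * ∏ c ∈ V.erase i, ∫ y in Ioi t, g c y))
      = (∏ c ∈ V, ∫ y in Ioi T, g c y) - ∏ c ∈ V, ∫ y in Ioi 0, g c y := by
    refine integral_eq_of_hasDerivAt_off_countable
      (fun t => ∏ c ∈ V, ∫ y in Ioi t, g c y) _ hD ?_ ?_ ?_
    · rw [uIcc_of_le hT]
      exact hprodcont _ subset_rfl
    · intro x hx
      rw [min_eq_left hT, max_eq_right hT] at hx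
      have := HasDerivAt.fun_finsetProd (u := V) (f := fun c t => ∫ y in Ioi t, g c y)
        (f' := fun c => -g c x) (x := x)
        (fun i hi => race_hasDerivAt (hint i hi) (hm i hi) hx.1.1 (hc i hi x hx.1.1 hx.2))
      refine this.congr_deriv (Finset.sum_congr rfl fun i _ => ?_)
      rw [smul_eq_mul]; ring
    · have h2 : IntervalIntegrable
          (∑ i ∈ V, -(fun t => g i t * ∏ c ∈ V.erase i, ∫ y in Ioi t, g c y)) volume 0 T :=
        IntervalIntegrable.sum V (fun i hi => (hterm i hi).neg)
      have h3 : (fun t => ∑ i ∈ V, -(g i t * ∏ c ∈ V.erase i, ∫ y in Ioi t, g c y)) =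
          ∑ i ∈ V, -(fun t => g i t * ∏ c ∈ V.erase i, ∫ y in Ioi t, g c y) := by
        funext t
        simp
      rw [h3]
      exact h2
  rw [Finset.prod_eq_one h1] at hftc
  have e1 : ∀ i ∈ V, ∫⁻ t in Ico 0 T,
      ENNReal.ofReal (g i t * ∏ c ∈ V.erase i, ∫ y in Ioi t, g c y)
      = ENNReal.ofReal (∫ t in (0:ℝ)..T, g i t * ∏ c ∈ V.erase i, ∫ y in Ioi t, g c y) := by
    intro i hi
    rw [intervalIntegral.integral_of_le hT, ofReal_integral_eq_lintegral_ofReal]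
    · rw [restrict_Ico_eq_restrict_Ioc]
    · exact (intervalIntegrable_iff_integrableOn_Ioc_of_le hT).1 (hterm i hi)
    · exact ae_of_all _ fun t => mul_nonneg (hnn i hi t)
        (Finset.prod_nonneg fun c hcV => hSnn c (Finset.mem_of_mem_erase hcV) t)
  rw [Finset.sum_congr rfl e1, ← ENNReal.ofReal_sum_of_nonneg]
  · congr 1
    rw [← intervalIntegral.integral_finsetSum (fun i hi => hterm i hi)]
    simp only [Finset.sum_neg_distrib, intervalIntegral.integral_neg] at hftc
    linarith
  · intro i hi
    exact intervalIntegral.integral_nonneg hT fun t _ => mul_nonneg (hnn i hi t)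
      (Finset.prod_nonneg fun c hcV => hSnn c (Finset.mem_of_mem_erase hcV) t)

theorem race_mass_top [DecidableEq ι] (V : Finset ι) (hV : V.Nonempty) (g : ι → ℝ → ℝ) (D : Set ℝ)
    (hD : D.Countable)
    (hnn : ∀ i ∈ V, ∀ x, 0 ≤ g i x) (hm : ∀ i ∈ V, Measurable (g i))
    (hint : ∀ i ∈ V, IntegrableOn (g i) (Ioi 0)) (h1 : ∀ i ∈ V, ∫ y in Ioi 0, g i y = 1)
    (hc : ∀ i ∈ V, ∀ x > 0, x ∉ D → ContinuousAt (g i) x) :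
    ∑ i ∈ V, ∫⁻ t in Ici 0, ENNReal.ofReal (g i t * ∏ c ∈ V.erase i, ∫ y in Ioi t, g c y)
      = 1 := by
  have hlim : Tendsto (fun n : ℕ => ∑ i ∈ V, ∫⁻ t in Ico (0:ℝ) n,
      ENNReal.ofReal (g i t * ∏ c ∈ V.erase i, ∫ y in Ioi t, g c y)) atTop
      (nhds (∑ i ∈ V, ∫⁻ t in Ici 0,
        ENNReal.ofReal (g i t * ∏ c ∈ V.erase i, ∫ y in Ioi t, g c y))) := by
    refine tendsto_finsetSum _ fun i _ => ?_
    have hU : Ici (0:ℝ) = ⋃ n : ℕ, Ico (0:ℝ) n := by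
      ext x
      simp only [mem_Ici, mem_iUnion, mem_Ico]
      exact ⟨fun h => (exists_nat_gt x).imp fun n hn => ⟨h, hn⟩, fun ⟨_, h, _⟩ => h⟩
    have hmono : Monotone fun n : ℕ => Ico (0:ℝ) n := fun a b hab =>
      Ico_subset_Ico_right (by exact_mod_cast hab)
    have := tendsto_measure_iUnion_atTop (μ := volume.withDensity (fun t =>
      ENNReal.ofReal (g i t * ∏ c ∈ V.erase i, ∫ y in Ioi t, g c y))) hmono
    rw [← hU, withDensity_apply _ measurableSet_Ici] at this
    refine this.congr fun n => ?_
    simp only [Function.comp]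
    rw [withDensity_apply _ measurableSet_Ico]
  have hS : ∀ c ∈ V, Tendsto (fun n : ℕ => ∫ y in Ioi (n:ℝ), g c y) atTop (nhds 0) := by
    intro c hcV
    have h2 := intervalIntegral_tendsto_integral_Ioi (μ := volume) 0 (hint c hcV)
      (tendsto_natCast_atTop_atTop (R := ℝ))
    have h3 := h2.const_sub (∫ y in Ioi 0, g c y)
    rw [sub_self] at h3
    refine h3.congr fun n => ?_
    have := intervalIntegral.integral_Ioi_sub_Ioi (f := g c) (μ := volume) (hint c hcV)
      (Nat.cast_nonneg n)
    linarith
  have hlim2 : Tendsto (fun n : ℕ => ENNReal.ofReal (1 - ∏ c ∈ V, ∫ y in Ioi (n:ℝ), g c y)) atTop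
      (nhds 1) := by
    have h4 : Tendsto (fun n : ℕ => ∏ c ∈ V, ∫ y in Ioi (n:ℝ), g c y) atTop (nhds 0) := by
      have := tendsto_finsetProd (M := ℝ) V hS
      rwa [Finset.prod_const, zero_pow (Finset.card_ne_zero.2 hV)] at this
    have h5 := ENNReal.tendsto_ofReal (h4.const_sub 1)
    simpa using h5
  refine tendsto_nhds_unique hlim (hlim2.congr fun n => ?_)
  exact (race_mass V g D hD hnn hm hint h1 hc n (Nat.cast_nonneg n)).symm

end Race

section Dynamics

set_option linter.unusedSectionVars false

variable {S Ev : Type*} [Fintype S] [Fintype Ev] [DecidableEq Ev] (G : GSMP S Ev)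

/-- A configuration consists of a state `s`, a valuation (time elapsed since each scheduled event
was scheduled) and the time spent in the previous configuration.  The symbol `⊥` for events that
are not scheduled in `s` is encoded by the value `0`.  The elapsed time of a scheduled event is
always below the upper bound of its delay. -/
def IsConfig (z : S × (Ev → ℝ) × ℝ) : Prop :=
  0 ≤ z.2.2 ∧
  (∀ e ∈ G.sched z.1, 0 ≤ z.2.1 e ∧ ∀ n : ℕ, G.upper e = n → z.2.1 e < n) ∧
  ∀ e ∉ G.sched z.1, z.2.1 e = 0

/-- The configurations, with the σ-algebra induced by the discrete one on states and the Borel one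
on valuations. -/
abbrev Config : Type _ := {z : S × (Ev → ℝ) × ℝ // G.IsConfig z}

/-- the variable-delay events scheduled in `s` -/
noncomputable def varSched (s : S) : Finset Ev := (G.sched s).filter fun e => (G.lower e : ℕ∞) < G.upper e

/-- the fixed-delay events scheduled in `s` -/
noncomputable def fixSched (s : S) : Finset Ev := (G.sched s).filter fun e => (G.lower e : ℕ∞) = G.upper e

/-- the scheduled fixed-delay events whose remaining time is minimal -/
noncomputable def firstFixed (s : S) (ν : Ev → ℝ) : Finset Ev :=
  (G.fixSched s).filter fun e => ∀ f ∈ G.fixSched s, (G.lower e : ℝ) - ν e ≤ (G.lower f : ℝ) - ν f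

/-- the minimal remaining time among the scheduled fixed-delay events -/
noncomputable def firstFixedTime (s : S) (ν : Ev → ℝ) (h : (G.fixSched s).Nonempty) : ℝ :=
  (G.fixSched s).inf' h fun e => (G.lower e : ℝ) - ν e

/-- the times `t ≥ 0` that are smaller than the remaining time of every scheduled fixed-delay
event -/
def raceWindow (s : S) (ν : Ev → ℝ) : Set ℝ :=
  {t | 0 ≤ t ∧ ∀ f ∈ G.fixSched s, t < (G.lower f : ℝ) - ν f}

/-- The valuation after the set of events `E` occurs in `(s, ν)` at time `t` and the process moves
to `s'`: inherited events are increased by `t`, new events are set to `0`, and events that are not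
scheduled in `s'` are discarded. -/
noncomputable def nextVal (s : S) (ν : Ev → ℝ) (E : Finset Ev) (t : ℝ) (s' : S) : Ev → ℝ :=
  fun e => if e ∈ G.sched s' ∧ e ∈ G.sched s ∧ e ∉ E then ν e + t else 0

/-- the density of the remaining delay of `e` after the time `a` has elapsed -/
noncomputable def condDens (e : Ev) (a x : ℝ) : ℝ :=
  if 0 ≤ x then G.dens e (x + a) / ∫ y in Ioi a, G.dens e y else 0

/-- the density at time `t` of the variable-delay event `e` winning the race in `(s, ν)` -/
noncomputable def winVar (s : S) (ν : Ev → ℝ) (e : Ev) (t : ℝ) : ℝ :=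
  G.condDens e (ν e) t * ∏ c ∈ (G.varSched s).erase e, ∫ y in Ioi t, G.condDens c (ν c) y

/-- the probability that no scheduled variable-delay event occurs until time `t` -/
noncomputable def winFix (s : S) (ν : Ev → ℝ) (t : ℝ) : ℝ :=
  ∏ c ∈ G.varSched s, ∫ y in Ioi t, G.condDens c (ν c) y

/-- the probability of hitting `A` under the condition that `E` occurs in `(s, ν)` at time `t` -/
noncomputable def hit (s : S) (ν : Ev → ℝ) (E : Finset Ev) (t : ℝ)
    (A : Set (S × (Ev → ℝ) × ℝ)) : ENNReal :=
  ∑ s' : S, G.succ s E s' * A.indicator (fun _ => 1) (s', G.nextVal s ν E t s', t)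

/-- the probability of moving in one step from `z` to a configuration in `A` -/
noncomputable def stepProb (z : G.Config) (A : Set G.Config) : ENNReal :=
  (∑ e ∈ G.varSched z.1.1, ∫⁻ t in G.raceWindow z.1.1 z.1.2.1,
      G.hit z.1.1 z.1.2.1 {e} t (Subtype.val '' A) * ENNReal.ofReal (G.winVar z.1.1 z.1.2.1 e t)) +
    if h : (G.fixSched z.1.1).Nonempty then
      G.hit z.1.1 z.1.2.1 (G.firstFixed z.1.1 z.1.2.1) (G.firstFixedTime z.1.1 z.1.2.1 h)
          (Subtype.val '' A) *
        ENNReal.ofReal (G.winFix z.1.1 z.1.2.1 (G.firstFixedTime z.1.1 z.1.2.1 h))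
    else 0

/-! Auxiliary facts: the one-step probabilities form a Markov kernel. -/

theorem measurableSet_delayInterval (l : ℕ) (u : ℕ∞) : MeasurableSet (delayInterval l u) := by
  unfold delayInterval
  measurability

theorem dens_measurable {e : Ev} (he : (G.lower e : ℕ∞) < G.upper e) : Measurable (G.dens e) := by
  classical
  have h := ContinuousOn.measurable_piecewise (G.dens_cont e he)
    (continuousOn_const (c := (0:ℝ)) (s := (delayInterval (G.lower e) (G.upper e))ᶜ))
    (measurableSet_delayInterval _ _)
  convert h using 1
  funext x
  by_cases hx : x ∈ delayInterval (G.lower e) (G.upper e)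
  · rw [piecewise_eq_of_mem _ _ _ hx]
  · rw [piecewise_eq_of_notMem _ _ _ hx, G.dens_zero e he x hx]

theorem dens_nonneg {e : Ev} (he : (G.lower e : ℕ∞) < G.upper e) (x : ℝ) : 0 ≤ G.dens e x := by
  by_cases hx : x ∈ delayInterval (G.lower e) (G.upper e)
  · exact (G.dens_pos e he x hx).le
  · rw [G.dens_zero e he x hx]

theorem dens_integrable {e : Ev} (he : (G.lower e : ℕ∞) < G.upper e) : Integrable (G.dens e) := by
  have h1 : IntegrableOn (G.dens e) (delayInterval (G.lower e) (G.upper e)) := by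
    by_contra hn
    have := G.dens_integral e he
    rw [integral_undef hn] at this
    exact zero_ne_one this
  exact h1.integrable_of_forall_notMem_eq_zero fun x hx => G.dens_zero e he x hx

theorem dens_tail_pos {e : Ev} (he : (G.lower e : ℕ∞) < G.upper e) {a : ℝ}
    (ha : ∀ n : ℕ, G.upper e = n → a < n) : 0 < ∫ y in Ioi a, G.dens e y := by
  rw [setIntegral_pos_iff_support_of_nonneg_ae (ae_of_all _ (G.dens_nonneg he))
    (G.dens_integrable he).integrableOn]
  obtain ⟨b, hb, hbu⟩ : ∃ b : ℝ, max a (G.lower e) < b ∧ ∀ n : ℕ, G.upper e = n → b ≤ n := by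
    cases h : G.upper e with
    | top => exact ⟨max a (G.lower e) + 1, by linarith, fun n hn => absurd hn (by simp)⟩
    | coe n =>
      refine ⟨n, max_lt (ha n h) ?_, fun m hm => ?_⟩
      · rw [h] at he
        have : G.lower e < n := by exact_mod_cast he
        exact_mod_cast this
      · have : n = m := by exact_mod_cast hm
        rw [this]
  have hsub : Ioo (max a (G.lower e)) b ⊆ Function.support (G.dens e) ∩ Ioi a := by
    intro x hx
    refine ⟨(G.dens_pos e he x ⟨?_, fun n hn => ?_⟩).ne', ?_⟩
    · exact (le_max_right _ _).trans hx.1.le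
    · exact hx.2.le.trans (hbu n hn)
    · exact lt_of_le_of_lt (le_max_left _ _) hx.1
  refine lt_of_lt_of_le ?_ (measure_mono hsub)
  rw [Real.volume_Ioo]
  simpa using hb

theorem condDens_measurable {e : Ev} (he : (G.lower e : ℕ∞) < G.upper e) :
    Measurable fun p : ℝ × ℝ => G.condDens e p.1 p.2 := by
  have hd := G.dens_measurable he
  have hanti : Antitone fun a : ℝ => ∫ y in Ioi a, G.dens e y := by
    intro a b hab
    exact setIntegral_mono_set (G.dens_integrable he).integrableOn
      (ae_of_all _ (G.dens_nonneg he)) (LE.le.eventuallyLE (Ioi_subset_Ioi hab))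
  unfold condDens
  refine Measurable.ite (measurableSet_le measurable_const measurable_snd) ?_ measurable_const
  exact (hd.comp (measurable_snd.add measurable_fst)).div (hanti.measurable.comp measurable_fst)

theorem condDens_nonneg {e : Ev} (he : (G.lower e : ℕ∞) < G.upper e) (a x : ℝ) :
    0 ≤ G.condDens e a x := by
  unfold condDens
  split_ifs
  · exact div_nonneg (G.dens_nonneg he _) (integral_nonneg (G.dens_nonneg he))
  · exact le_rfl

theorem surv_measurable {e : Ev} (he : (G.lower e : ℕ∞) < G.upper e) :
    Measurable fun p : ℝ × ℝ => ∫ y in Ioi p.2, G.condDens e p.1 y := by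
  have h : Measurable fun q : (ℝ × ℝ) × ℝ =>
      ({r : (ℝ × ℝ) × ℝ | r.1.2 < r.2}).indicator (fun r => G.condDens e r.1.1 r.2) q := by
    refine Measurable.indicator ?_ (measurableSet_lt measurable_fst.snd measurable_snd)
    exact (G.condDens_measurable he).comp (measurable_fst.fst.prodMk measurable_snd)
  have h2 := h.stronglyMeasurable.integral_prod_right' (ν := volume)
  convert h2.measurable using 1
  funext p
  rw [← integral_indicator measurableSet_Ioi]
  rfl

theorem condDens_integrableOn {e : Ev} (he : (G.lower e : ℕ∞) < G.upper e) (a : ℝ) :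
    IntegrableOn (G.condDens e a) (Ioi 0) := by
  have h : Integrable fun x => G.dens e (x + a) / ∫ y in Ioi a, G.dens e y :=
    ((G.dens_integrable he).comp_add_right a).div_const _
  refine h.integrableOn.congr_fun (fun x hx => ?_) measurableSet_Ioi
  simp [condDens, (mem_Ioi.1 hx).le]

theorem condDens_integral {e : Ev} (he : (G.lower e : ℕ∞) < G.upper e) {a : ℝ}
    (ha : ∀ n : ℕ, G.upper e = n → a < n) : ∫ y in Ioi 0, G.condDens e a y = 1 := by
  have h1 : ∫ y in Ioi 0, G.condDens e a y =
      ∫ x in Ioi 0, G.dens e (x + a) / ∫ y in Ioi a, G.dens e y :=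
    setIntegral_congr_fun measurableSet_Ioi fun x hx => by simp [condDens, (mem_Ioi.1 hx).le]
  have h2 : ∫ x in Ioi 0, G.dens e (x + a) = ∫ y in Ioi a, G.dens e y := by
    have := (measurePreserving_add_right volume a).setIntegral_preimage_emb
      (measurableEmbedding_addRight a) (G.dens e) (Ioi a)
    simpa using this
  rw [h1, integral_div, h2, div_self (G.dens_tail_pos he ha).ne']

theorem condDens_continuousAt {e : Ev} (he : (G.lower e : ℕ∞) < G.upper e) (a : ℝ) {x : ℝ}
    (hx : 0 < x) (h1 : x + a ≠ G.lower e) (h2 : x + a ≠ ((G.upper e).toNat : ℝ)) :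
    ContinuousAt (G.condDens e a) x := by
  have hd : ContinuousAt (G.dens e) (x + a) := by
    by_cases hin : x + a ∈ delayInterval (G.lower e) (G.upper e)
    · refine (G.dens_cont e he).continuousAt ?_
      have hl : (G.lower e : ℝ) < x + a := lt_of_le_of_ne hin.1 (Ne.symm h1)
      cases h : G.upper e with
      | top =>
        filter_upwards [lt_mem_nhds hl] with y hy
        exact ⟨hy.le, fun n hn => absurd hn (by simp)⟩
      | coe n =>
        have hu : x + a < n := by
          refine lt_of_le_of_ne (hin.2 n h) ?_
          rw [h] at h2
          exact h2
        filter_upwards [lt_mem_nhds hl, gt_mem_nhds hu] with y hy hy2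
        refine ⟨hy.le, fun m hm => ?_⟩
        have : n = m := by exact_mod_cast hm
        rw [← this]
        exact hy2.le
    · have hev : G.dens e =ᶠ[nhds (x + a)] fun _ => 0 := by
        have hcl : IsClosed (delayInterval (G.lower e) (G.upper e)) := by
          have : delayInterval (G.lower e) (G.upper e) =
              Ici (G.lower e : ℝ) ∩ ⋂ n : ℕ, ⋂ _ : G.upper e = n, Iic (n : ℝ) := by
            ext y; simp [delayInterval]
          rw [this]
          exact isClosed_Ici.inter (isClosed_iInter fun n => isClosed_iInter fun _ => isClosed_Iic)
        filter_upwards [hcl.isOpen_compl.mem_nhds hin] with y hy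
        exact G.dens_zero e he y hy
      exact continuousAt_const.congr hev.symm
  have h3 : ContinuousAt (fun x => G.dens e (x + a) / ∫ y in Ioi a, G.dens e y) x :=
    (ContinuousAt.comp (f := fun x => x + a) hd (by fun_prop)).div_const _
  refine h3.congr ?_
  filter_upwards [lt_mem_nhds hx] with y hy
  simp [condDens, hy.le]

theorem surv_eq_zero {e : Ev} (he : (G.lower e : ℕ∞) < G.upper e) {a t : ℝ} {n : ℕ}
    (hn : G.upper e = n) (h : (n : ℝ) ≤ a + t) : ∫ y in Ioi t, G.condDens e a y = 0 := by
  refine setIntegral_eq_zero_of_forall_eq_zero fun y hy => ?_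
  unfold condDens
  split_ifs
  · rw [G.dens_zero e he, zero_div]
    intro hmem
    have := hmem.2 n hn
    have := mem_Ioi.1 hy
    linarith
  · rfl

variable {G} in
theorem mem_varSched {s : S} {e : Ev} :
    e ∈ G.varSched s ↔ e ∈ G.sched s ∧ (G.lower e : ℕ∞) < G.upper e := by
  simp [varSched]

variable {G} in
theorem mem_fixSched {s : S} {e : Ev} :
    e ∈ G.fixSched s ↔ e ∈ G.sched s ∧ (G.lower e : ℕ∞) = G.upper e := by
  simp [fixSched]

theorem raceWindow_of_empty {s : S} (ν : Ev → ℝ) (h : ¬ (G.fixSched s).Nonempty) :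
    G.raceWindow s ν = Ici 0 := by
  rw [Finset.not_nonempty_iff_eq_empty] at h
  ext t
  simp [raceWindow, h]

theorem raceWindow_of_nonempty {s : S} (ν : Ev → ℝ) (h : (G.fixSched s).Nonempty) :
    G.raceWindow s ν = Ico 0 (G.firstFixedTime s ν h) := by
  ext t
  simp [raceWindow, firstFixedTime, Finset.lt_inf'_iff]

theorem firstFixedTime_nonneg (z : G.Config) (h : (G.fixSched z.1.1).Nonempty) :
    0 ≤ G.firstFixedTime z.1.1 z.1.2.1 h := by
  unfold firstFixedTime
  rw [Finset.le_inf'_iff]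
  intro e he
  rw [mem_fixSched] at he
  have := (z.2.2.1 e he.1).2 _ he.2.symm
  linarith

theorem race_total (z : G.Config) :
    (∑ e ∈ G.varSched z.1.1, ∫⁻ t in G.raceWindow z.1.1 z.1.2.1,
        ENNReal.ofReal (G.winVar z.1.1 z.1.2.1 e t)) +
      (if h : (G.fixSched z.1.1).Nonempty then
        ENNReal.ofReal (G.winFix z.1.1 z.1.2.1 (G.firstFixedTime z.1.1 z.1.2.1 h)) else 0) = 1 := by
  obtain ⟨⟨s, ν, τ⟩, hz⟩ := z
  have hz' := hz.2.1
  simp only at hz' ⊢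
  let D : Set ℝ := ⋃ c : Ev, {(G.lower c : ℝ) - ν c, ((G.upper c).toNat : ℝ) - ν c}
  have hD : D.Countable := countable_iUnion fun c => (by simp : Set.Countable _)
  have hvar : ∀ i ∈ G.varSched s, (G.lower i : ℕ∞) < G.upper i := fun i hi => (mem_varSched.1 hi).2
  have hnn : ∀ i ∈ G.varSched s, ∀ x, 0 ≤ G.condDens i (ν i) x := fun i hi x =>
    G.condDens_nonneg (hvar i hi) _ _
  have hm : ∀ i ∈ G.varSched s, Measurable (G.condDens i (ν i)) := fun i hi =>
    (G.condDens_measurable (hvar i hi)).comp measurable_prodMk_left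
  have hint : ∀ i ∈ G.varSched s, IntegrableOn (G.condDens i (ν i)) (Ioi 0) := fun i hi =>
    G.condDens_integrableOn (hvar i hi) _
  have h1 : ∀ i ∈ G.varSched s, ∫ y in Ioi 0, G.condDens i (ν i) y = 1 := fun i hi =>
    G.condDens_integral (hvar i hi) (hz' i (mem_varSched.1 hi).1).2
  have hc : ∀ i ∈ G.varSched s, ∀ x > 0, x ∉ D → ContinuousAt (G.condDens i (ν i)) x := by
    intro i hi x hx hxD
    refine G.condDens_continuousAt (hvar i hi) _ hx ?_ ?_
    · intro h
      exact hxD (mem_iUnion.2 ⟨i, Or.inl (by linarith)⟩)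
    · intro h
      exact hxD (mem_iUnion.2 ⟨i, Or.inr (by rw [mem_singleton_iff]; linarith)⟩)
  by_cases h : (G.fixSched s).Nonempty
  · have hu := G.firstFixedTime_nonneg ⟨⟨s, ν, τ⟩, hz⟩ h
    have hr := race_mass (G.varSched s) (fun c => G.condDens c (ν c)) D hD hnn hm hint h1 hc _ hu
    simp only at hu hr
    rw [dif_pos h, raceWindow_of_nonempty G ν h]
    unfold winVar winFix
    rw [hr, ← ENNReal.ofReal_add]
    · simp
    · rw [sub_nonneg]
      refine Finset.prod_le_one (fun c hcV => integral_nonneg (hnn c hcV)) fun c hcV => ?_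
      rw [← h1 c hcV]
      exact setIntegral_mono_set (hint c hcV) (ae_of_all _ (hnn c hcV))
        (LE.le.eventuallyLE (Ioi_subset_Ioi hu))
    · exact Finset.prod_nonneg fun c hcV => integral_nonneg (hnn c hcV)
  · have hV : (G.varSched s).Nonempty := by
      obtain ⟨e, he⟩ := G.sched_nonempty s
      refine ⟨e, mem_varSched.2 ⟨he, lt_of_le_of_ne (G.lower_le_upper e) fun heq => ?_⟩⟩
      exact h ⟨e, mem_fixSched.2 ⟨he, heq⟩⟩
    rw [dif_neg h, raceWindow_of_empty G ν h, add_zero]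
    exact race_mass_top (G.varSched s) hV (fun c => G.condDens c (ν c)) D hD hnn hm hint h1 hc

theorem hit_eq_one (s : S) (ν : Ev → ℝ) (E : Finset Ev) (t : ℝ) (A : Set (S × (Ev → ℝ) × ℝ))
    (h : ∀ s', (s', G.nextVal s ν E t s', t) ∈ A) : G.hit s ν E t A = 1 := by
  unfold hit
  have : ∀ s' : S, G.succ s E s' * A.indicator (fun _ => (1 : ENNReal))
      (s', G.nextVal s ν E t s', t) = G.succ s E s' := by
    intro s'
    rw [indicator_of_mem (h s'), mul_one]
  rw [Finset.sum_congr rfl fun s' _ => this s', ← tsum_fintype (L := SummationFilter.unconditional S)]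
  exact (G.succ s E).tsum_coe

theorem next_isConfig {s : S} {ν : Ev → ℝ} {τ : ℝ} (hz : G.IsConfig (s, ν, τ)) {E : Finset Ev}
    {t : ℝ} (ht : 0 ≤ t)
    (h : ∀ c ∈ G.sched s, c ∉ E → ∀ n : ℕ, G.upper c = n → ν c + t < n) (s' : S) :
    G.IsConfig (s', G.nextVal s ν E t s', t) := by
  refine ⟨ht, fun e he => ?_, fun e he => ?_⟩
  · simp only [nextVal] at he ⊢
    split_ifs with hcond
    · exact ⟨add_nonneg (hz.2.1 e hcond.2.1).1 ht, h e hcond.2.1 hcond.2.2⟩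
    · refine ⟨le_rfl, fun n hn => ?_⟩
      have : n ≠ 0 := by
        rintro rfl
        exact G.upper_ne_zero e hn
      exact_mod_cast Nat.pos_of_ne_zero this
  · simp only [nextVal] at he ⊢
    rw [if_neg fun hcond => he hcond.1]

theorem hit_mul_winVar (z : G.Config) {e : Ev} (t : ℝ)
    (ht : t ∈ G.raceWindow z.1.1 z.1.2.1) :
    G.hit z.1.1 z.1.2.1 {e} t {z | G.IsConfig z} * ENNReal.ofReal (G.winVar z.1.1 z.1.2.1 e t) =
      ENNReal.ofReal (G.winVar z.1.1 z.1.2.1 e t) := by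
  by_cases hw : G.winVar z.1.1 z.1.2.1 e t = 0
  · simp [hw]
  rw [hit_eq_one, one_mul]
  refine G.next_isConfig (τ := z.1.2.2) z.2 ht.1 fun c hc hce n hn => ?_
  rw [Finset.mem_singleton] at hce
  rcases (G.lower_le_upper c).eq_or_lt with hl | hl
  · have := ht.2 c (mem_fixSched.2 ⟨hc, hl⟩)
    have hln : G.lower c = n := by
      rw [hn] at hl
      exact_mod_cast hl
    rw [hln] at this
    linarith
  · by_contra hcon
    apply hw
    unfold winVar
    rw [Finset.prod_eq_zero (Finset.mem_erase.2 ⟨hce, mem_varSched.2 ⟨hc, hl⟩⟩)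
      (G.surv_eq_zero hl hn (not_lt.1 hcon)), mul_zero]

theorem hit_mul_winFix (z : G.Config) (h : (G.fixSched z.1.1).Nonempty) :
    G.hit z.1.1 z.1.2.1 (G.firstFixed z.1.1 z.1.2.1) (G.firstFixedTime z.1.1 z.1.2.1 h)
        {z | G.IsConfig z} *
        ENNReal.ofReal (G.winFix z.1.1 z.1.2.1 (G.firstFixedTime z.1.1 z.1.2.1 h)) =
      ENNReal.ofReal (G.winFix z.1.1 z.1.2.1 (G.firstFixedTime z.1.1 z.1.2.1 h)) := by
  by_cases hw : G.winFix z.1.1 z.1.2.1 (G.firstFixedTime z.1.1 z.1.2.1 h) = 0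
  · simp [hw]
  rw [hit_eq_one, one_mul]
  refine G.next_isConfig (τ := z.1.2.2) z.2 (G.firstFixedTime_nonneg z h) fun c hc hce n hn => ?_
  rcases (G.lower_le_upper c).eq_or_lt with hl | hl
  · have hcf := mem_fixSched.2 ⟨hc, hl⟩
    have hln : G.lower c = n := by
      rw [hn] at hl
      exact_mod_cast hl
    simp only [firstFixed, Finset.mem_filter, not_and, not_forall, not_le] at hce
    obtain ⟨f, hf, hlt⟩ := hce hcf
    have : G.firstFixedTime z.1.1 z.1.2.1 h ≤ (G.lower f : ℝ) - z.1.2.1 f :=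
      Finset.inf'_le (fun e => (G.lower e : ℝ) - z.1.2.1 e) hf
    rw [hln] at hlt
    linarith
  · by_contra hcon
    apply hw
    unfold winFix
    exact Finset.prod_eq_zero (mem_varSched.2 ⟨hc, hl⟩) (G.surv_eq_zero hl hn (not_lt.1 hcon))

theorem measurableSet_raceWindow_prod (s : S) :
    MeasurableSet {p : (Ev → ℝ) × ℝ | p.2 ∈ G.raceWindow s p.1} := by
  have : {p : (Ev → ℝ) × ℝ | p.2 ∈ G.raceWindow s p.1} =
      {p | 0 ≤ p.2} ∩ ⋂ f ∈ G.fixSched s, {p | p.2 < (G.lower f : ℝ) - p.1 f} := by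
    ext p
    simp [raceWindow]
  rw [this]
  refine (measurableSet_le measurable_const measurable_snd).inter
    (Finset.measurableSet_biInter _ fun f _ => measurableSet_lt measurable_snd ?_)
  exact measurable_const.sub ((measurable_pi_apply f).comp measurable_fst)

theorem measurableSet_raceWindow (s : S) (ν : Ev → ℝ) : MeasurableSet (G.raceWindow s ν) :=
  measurable_prodMk_left (G.measurableSet_raceWindow_prod s)

theorem winVar_measurable (s : S) {e : Ev} (he : e ∈ G.varSched s) :
    Measurable fun p : (Ev → ℝ) × ℝ => G.winVar s p.1 e p.2 := by
  unfold winVar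
  have hp : ∀ c : Ev, Measurable fun p : (Ev → ℝ) × ℝ => (p.1 c, p.2) := fun c =>
    ((measurable_pi_apply c).comp measurable_fst).prodMk measurable_snd
  refine ((G.condDens_measurable (mem_varSched.1 he).2).comp (hp e)).mul ?_
  refine Finset.measurable_fun_prod _ fun c hc => ?_
  exact (G.surv_measurable (mem_varSched.1 (Finset.mem_of_mem_erase hc)).2).comp (hp c)

theorem winFix_measurable (s : S) : Measurable fun p : (Ev → ℝ) × ℝ => G.winFix s p.1 p.2 := by
  unfold winFix
  refine Finset.measurable_fun_prod _ fun c hc => ?_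
  have hp : Measurable fun p : (Ev → ℝ) × ℝ => (p.1 c, p.2) :=
    ((measurable_pi_apply c).comp measurable_fst).prodMk measurable_snd
  exact (G.surv_measurable (mem_varSched.1 hc).2).comp hp

theorem firstFixedTime_measurable (s : S) (h : (G.fixSched s).Nonempty) :
    Measurable fun ν : Ev → ℝ => G.firstFixedTime s ν h := by
  unfold firstFixedTime
  have := Finset.inf'_induction (p := fun g : (Ev → ℝ) → ℝ => Measurable g) h
    (fun e (ν : Ev → ℝ) => (G.lower e : ℝ) - ν e) (fun _ h1 _ h2 => h1.inf h2)
    fun e _ => measurable_const.sub (measurable_pi_apply e)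
  convert this using 1
  funext ν
  rw [Finset.inf'_apply]

variable [MeasurableSpace S] [DiscreteMeasurableSpace S]

theorem hit_measurable (s : S) (E : Finset Ev) {A : Set (S × (Ev → ℝ) × ℝ)}
    (hA : MeasurableSet A) : Measurable fun p : (Ev → ℝ) × ℝ => G.hit s p.1 E p.2 A := by
  unfold hit
  refine Finset.measurable_fun_sum _ fun s' _ => Measurable.const_mul ?_ _
  refine (measurable_const.indicator hA).comp ?_
  refine measurable_const.prodMk (Measurable.prodMk ?_ measurable_snd)
  refine measurable_pi_lambda _ fun e => ?_
  unfold nextVal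
  split_ifs
  · exact ((measurable_pi_apply e).comp measurable_fst).add measurable_snd
  · exact measurable_const

theorem hit_iUnion (s : S) (ν : Ev → ℝ) (E : Finset Ev) (t : ℝ)
    {A : ℕ → Set (S × (Ev → ℝ) × ℝ)} (hA : ∀ i, MeasurableSet (A i))
    (hd : Pairwise (Function.onFun Disjoint A)) :
    G.hit s ν E t (⋃ i, A i) = ∑' i, G.hit s ν E t (A i) := by
  unfold hit
  rw [Summable.tsum_finsetSum fun _ _ => ENNReal.summable]
  refine Finset.sum_congr rfl fun s' _ => ?_
  rw [ENNReal.tsum_mul_left]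
  congr 1
  have h := measure_iUnion (μ := Measure.dirac (s', G.nextVal s ν E t s', t)) hd hA
  simp only [Measure.dirac_apply' _ (MeasurableSet.iUnion hA)] at h
  rw [show (fun _ => (1 : ENNReal)) = (1 : S × (Ev → ℝ) × ℝ → ENNReal) from rfl, h]
  exact tsum_congr fun i => Measure.dirac_apply' _ (hA i)

theorem measurableSet_isConfig : MeasurableSet {z : S × (Ev → ℝ) × ℝ | G.IsConfig z} := by
  have hsnd : Measurable fun z : S × (Ev → ℝ) × ℝ => z.2.2 := measurable_snd.snd
  refine measurable_from_prod_countable_right (f := fun z : S × (Ev → ℝ) × ℝ => G.IsConfig z)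
    (fun s => ?_) |>.setOf
  have hc : ∀ e : Ev, Measurable fun y : (Ev → ℝ) × ℝ => y.1 e := fun e =>
    (measurable_pi_apply e).comp measurable_fst
  refine measurableSet_setOfPred.1 ?_
  have : {y : (Ev → ℝ) × ℝ | G.IsConfig (s, y)} = {y | 0 ≤ y.2} ∩
      ((⋂ e ∈ G.sched s, ({y | 0 ≤ y.1 e} ∩ ⋂ n : ℕ, ⋂ _ : G.upper e = n, {y | y.1 e < (n : ℝ)})) ∩
        ⋂ e ∈ (G.sched s)ᶜ, {y | y.1 e = 0}) := by
    ext y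
    simp only [IsConfig, mem_ofPred_eq, mem_inter_iff, mem_iInter, Finset.mem_compl]
  rw [this]
  refine (measurableSet_le measurable_const measurable_snd).inter (MeasurableSet.inter ?_ ?_)
  · refine Finset.measurableSet_biInter _ fun e _ => ?_
    refine (measurableSet_le measurable_const (hc e)).inter ?_
    exact MeasurableSet.iInter fun n => MeasurableSet.iInter fun _ =>
      measurableSet_lt (hc e) measurable_const
  · exact Finset.measurableSet_biInter _ fun e _ => measurableSet_eq_fun (hc e) measurable_const

theorem measurableEmbedding_val : MeasurableEmbedding (Subtype.val : G.Config → S × (Ev → ℝ) × ℝ) :=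
  MeasurableEmbedding.subtype_coe G.measurableSet_isConfig

theorem stepProb_empty (z : G.Config) : G.stepProb z ∅ = 0 := by
  simp [stepProb, hit]

theorem stepProb_iUnion (z : G.Config) {A : ℕ → Set G.Config} (hA : ∀ i, MeasurableSet (A i))
    (hd : Pairwise (Function.onFun Disjoint A)) :
    G.stepProb z (⋃ i, A i) = ∑' i, G.stepProb z (A i) := by
  have hA' : ∀ i, MeasurableSet (Subtype.val '' A i) := fun i =>
    G.measurableEmbedding_val.measurableSet_image.2 (hA i)
  have hd' : Pairwise (Function.onFun Disjoint fun i => (Subtype.val '' A i)) := fun i j hij =>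
    (disjoint_image_iff Subtype.val_injective).2 (hd hij)
  unfold stepProb
  rw [ENNReal.tsum_add, Summable.tsum_finsetSum fun _ _ => ENNReal.summable, image_iUnion]
  congr 1
  · refine Finset.sum_congr rfl fun e he => ?_
    rw [← lintegral_tsum]
    · refine lintegral_congr fun t => ?_
      rw [hit_iUnion _ _ _ _ _ hA' hd', ENNReal.tsum_mul_right]
    · intro i
      have hp : Measurable fun t : ℝ => (z.1.2.1, t) := measurable_prodMk_left
      have m1 := (G.hit_measurable z.1.1 {e} (hA' i)).comp hp
      have m2 := ((G.winVar_measurable z.1.1 he).comp hp).ennreal_ofReal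
      exact (m1.mul m2).aemeasurable
  · split_ifs
    · rw [hit_iUnion _ _ _ _ _ hA' hd', ENNReal.tsum_mul_right]
    · simp

theorem stepProb_univ (z : G.Config) : G.stepProb z univ = 1 := by
  rw [← G.race_total z]
  unfold stepProb
  have : (Subtype.val '' (univ : Set G.Config)) = {z | G.IsConfig z} := by simp
  rw [this]
  congr 1
  · refine Finset.sum_congr rfl fun e he => ?_
    exact setLIntegral_congr_fun (G.measurableSet_raceWindow _ _) fun t ht =>
      G.hit_mul_winVar z t ht
  · split_ifs with h
    · exact G.hit_mul_winFix z h
    · rfl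

theorem firstFixed_measurable (s : S) (E : Finset Ev) :
    MeasurableSet {ν : Ev → ℝ | G.firstFixed s ν = E} := by
  have : {ν : Ev → ℝ | G.firstFixed s ν = E} = ⋂ e : Ev, {ν | (e ∈ G.fixSched s ∧
      ∀ f ∈ G.fixSched s, (G.lower e : ℝ) - ν e ≤ (G.lower f : ℝ) - ν f) ↔ e ∈ E} := by
    ext ν
    simp [firstFixed, Finset.ext_iff]
  rw [this]
  refine MeasurableSet.iInter fun e => measurableSet_setOfPred.2 ?_
  refine Measurable.iff (Measurable.and measurable_const ?_) measurable_const
  refine Measurable.forall fun f => Measurable.imp measurable_const ?_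
  exact measurableSet_setOfPred.1 (measurableSet_le
    (measurable_const.sub (measurable_pi_apply e)) (measurable_const.sub (measurable_pi_apply f)))

theorem stepProb_measurable {A : Set G.Config} (hA : MeasurableSet A) :
    Measurable fun z => G.stepProb z A := by
  have hA' : MeasurableSet (Subtype.val '' A) := G.measurableEmbedding_val.measurableSet_image.2 hA
  have key : Measurable fun z : S × (Ev → ℝ) × ℝ =>
      (∑ e ∈ G.varSched z.1, ∫⁻ t in G.raceWindow z.1 z.2.1,
        G.hit z.1 z.2.1 {e} t (Subtype.val '' A) * ENNReal.ofReal (G.winVar z.1 z.2.1 e t)) +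
      if h : (G.fixSched z.1).Nonempty then
        G.hit z.1 z.2.1 (G.firstFixed z.1 z.2.1) (G.firstFixedTime z.1 z.2.1 h)
          (Subtype.val '' A) *
        ENNReal.ofReal (G.winFix z.1 z.2.1 (G.firstFixedTime z.1 z.2.1 h))
      else 0 := by
    refine measurable_from_prod_countable_right fun s => ?_
    simp only
    refine Measurable.add ?_ ?_
    · refine Finset.measurable_fun_sum _ fun e he => ?_
      have hm : Measurable fun p : (Ev → ℝ) × ℝ =>
          {p : (Ev → ℝ) × ℝ | p.2 ∈ G.raceWindow s p.1}.indicator (fun p =>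
            G.hit s p.1 {e} p.2 (Subtype.val '' A) * ENNReal.ofReal (G.winVar s p.1 e p.2)) p :=
        ((G.hit_measurable s {e} hA').mul (G.winVar_measurable s he).ennreal_ofReal).indicator
          (G.measurableSet_raceWindow_prod s)
      have h2 := (hm.lintegral_prod_right' (ν := volume)).comp
        (measurable_fst : Measurable (Prod.fst : (Ev → ℝ) × ℝ → (Ev → ℝ)))
      convert h2 using 1
      funext y
      simp only [Function.comp]
      rw [← lintegral_indicator (G.measurableSet_raceWindow s y.1)]
      rfl
    · split_ifs with h
      · have hu : Measurable fun y : (Ev → ℝ) × ℝ => (y.1, G.firstFixedTime s y.1 h) :=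
          measurable_fst.prodMk ((G.firstFixedTime_measurable s h).comp measurable_fst)
        have mf := ((G.winFix_measurable s).comp hu).ennreal_ofReal
        refine Measurable.mul ?_ mf
        have heq : (fun y : (Ev → ℝ) × ℝ => G.hit s y.1 (G.firstFixed s y.1)
            (G.firstFixedTime s y.1 h) (Subtype.val '' A)) = fun y => ∑ E : Finset Ev,
            ({ν : Ev → ℝ | G.firstFixed s ν = E}).indicator (fun ν => G.hit s ν E
              (G.firstFixedTime s ν h) (Subtype.val '' A)) y.1 := by
          funext y
          rw [Finset.sum_eq_single (G.firstFixed s y.1)]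
          · have hn : y.1 ∈ {ν : Ev → ℝ | G.firstFixed s ν = G.firstFixed s y.1} := rfl
            rw [indicator_of_mem hn]
          · intro E _ hE
            have hn : y.1 ∉ {ν : Ev → ℝ | G.firstFixed s ν = E} := fun hmem => hE (Eq.symm hmem)
            rw [indicator_of_notMem hn]
          · simp
        rw [heq]
        refine Finset.measurable_fun_sum _ fun E _ => ?_
        have hp : Measurable fun ν : Ev → ℝ => (ν, G.firstFixedTime s ν h) :=
          measurable_id.prodMk (G.firstFixedTime_measurable s h)
        have mh := (G.hit_measurable s E hA').comp hp
        exact (mh.indicator (G.firstFixed_measurable s E)).comp measurable_fst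
      · exact measurable_const
  exact key.comp measurable_subtype_coe

/-- The transition kernel `P` on the configurations: `P z A = stepProb z A` for measurable `A`. -/
noncomputable def step : Kernel G.Config G.Config where
  toFun z := Measure.ofMeasurable (fun A _ => G.stepProb z A) (G.stepProb_empty z)
    fun _ hA hd => G.stepProb_iUnion z hA hd
  measurable' := by
    refine Measure.measurable_of_measurable_coe _ fun A hA => ?_
    simp only [Measure.ofMeasurable_apply _ hA]
    exact G.stepProb_measurable hA

theorem step_apply (z : G.Config) {A : Set G.Config} (hA : MeasurableSet A) :
    G.step z A = G.stepProb z A :=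
  Measure.ofMeasurable_apply (m0 := G.stepProb_empty z)
    (mU := fun _ hA hd => G.stepProb_iUnion z hA hd) A hA

instance : IsMarkovKernel G.step :=
  ⟨fun z => ⟨by rw [step_apply G z MeasurableSet.univ, stepProb_univ]⟩⟩

/-- the configuration `(s, 0)` in which all elapsed times are zero -/
def zeroConfig (s : S) : G.Config :=
  ⟨(s, fun _ => 0, 0), le_rfl, fun e _ => ⟨le_rfl, fun n hn => by
    have : n ≠ 0 := by
      rintro rfl
      exact G.upper_ne_zero e hn
    show (0 : ℝ) < n
    exact_mod_cast Nat.pos_of_ne_zero this⟩, fun _ _ => rfl⟩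

/-- the initial measure: start in `(s, 0)` with probability `init s` -/
noncomputable def initMeasure : Measure G.Config :=
  ∑ s : S, G.init s • Measure.dirac (G.zeroConfig s)

instance : IsProbabilityMeasure G.initMeasure := by
  refine ⟨?_⟩
  simp only [initMeasure, Measure.coe_finsetSum, Measure.coe_smul, Finset.sum_apply, Pi.smul_apply,
    measure_univ, smul_eq_mul, mul_one]
  rw [← tsum_fintype (L := SummationFilter.unconditional S)]
  exact G.init.tsum_coe

/-- The probability measure on the runs `z₀ z₁ z₂ ⋯` of the Markov chain with initial measure
`initMeasure` and transition kernel `step`. -/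
noncomputable def runMeasure : Measure (ℕ → G.Config) :=
  Kernel.trajMeasure (X := fun _ => G.Config) G.initMeasure
    fun n => G.step.comap (fun h : (i : Finset.Iic n) → G.Config => h ⟨n, Finset.mem_Iic.2 le_rfl⟩)
      (measurable_pi_apply _)

/-! ### The region graph -/

/-- the largest finite bound `B` of a delay -/
noncomputable def bound : ℕ := Finset.univ.sup fun e => max (G.lower e) (G.upper e).toNat

/-- `a` and `b` have the same integral part, and neither or both of them are integers -/
def AgreeInt (a b : ℝ) : Prop := ⌊a⌋ = ⌊b⌋ ∧ (Int.fract a = 0 ↔ Int.fract b = 0)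

/-- the region relation on configurations -/
def RegionRel (z₁ z₂ : G.Config) : Prop :=
  z₁.1.1 = z₂.1.1 ∧
  (∀ e ∈ G.sched z₁.1.1, AgreeInt (z₁.1.2.1 e) (z₂.1.2.1 e) ∨
    ((G.bound : ℝ) < z₁.1.2.1 e ∧ (G.bound : ℝ) < z₂.1.2.1 e)) ∧
  ∀ e ∈ G.sched z₁.1.1, ∀ f ∈ G.sched z₁.1.1,
    z₁.1.2.1 e ≤ G.bound → z₁.1.2.1 f ≤ G.bound →
      (Int.fract (z₁.1.2.1 e) ≤ Int.fract (z₁.1.2.1 f) ↔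
        Int.fract (z₂.1.2.1 e) ≤ Int.fract (z₂.1.2.1 f))

theorem AgreeInt.symm {a b : ℝ} (h : AgreeInt a b) : AgreeInt b a := ⟨h.1.symm, h.2.symm⟩

theorem AgreeInt.trans {a b c : ℝ} (h : AgreeInt a b) (h' : AgreeInt b c) : AgreeInt a c :=
  ⟨h.1.trans h'.1, h.2.trans h'.2⟩

theorem AgreeInt.le {a b : ℝ} (h : AgreeInt a b) {n : ℕ} (ha : a ≤ n) : b ≤ n := by
  rcases ha.lt_or_eq with hlt | heq
  · have h1 : ⌊a⌋ < (n : ℤ) := Int.floor_lt.2 (by exact_mod_cast hlt)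
    rw [h.1, Int.floor_lt] at h1
    exact_mod_cast h1.le
  · have h0 : Int.fract a = 0 := by rw [heq]; exact Int.fract_natCast n
    have h1 := h.2.1 h0
    have h2 := Int.floor_add_fract b
    have h3 := Int.floor_add_fract a
    rw [h1, ← h.1] at h2
    rw [h0] at h3
    linarith

theorem RegionRel.symm {z₁ z₂ : G.Config} (h : G.RegionRel z₁ z₂) : G.RegionRel z₂ z₁ := by
  obtain ⟨h1, h2, h3⟩ := h
  have hle : ∀ e ∈ G.sched z₁.1.1, z₂.1.2.1 e ≤ G.bound → z₁.1.2.1 e ≤ G.bound := by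
    intro e he hb
    rcases h2 e he with ha | ha
    · exact ha.symm.le hb
    · exact absurd hb (not_le.2 ha.2)
  refine ⟨h1.symm, ?_, ?_⟩
  · intro e he
    rw [← h1] at he
    exact (h2 e he).imp AgreeInt.symm And.symm
  · intro e he f hf hbe hbf
    rw [← h1] at he hf
    exact (h3 e he f hf (hle e he hbe) (hle f hf hbf)).symm

theorem RegionRel.trans {z₁ z₂ z₃ : G.Config} (h : G.RegionRel z₁ z₂) (h' : G.RegionRel z₂ z₃) :
    G.RegionRel z₁ z₃ := by
  obtain ⟨h1, h2, h3⟩ := h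
  obtain ⟨k1, k2, k3⟩ := h'
  rw [← h1] at k2 k3
  have hle : ∀ e ∈ G.sched z₁.1.1, z₁.1.2.1 e ≤ G.bound → z₂.1.2.1 e ≤ G.bound := by
    intro e he hb
    rcases h2 e he with ha | ha
    · exact ha.le hb
    · exact absurd hb (not_le.2 ha.1)
  refine ⟨h1.trans k1, ?_, ?_⟩
  · intro e he
    rcases h2 e he with ha | ha <;> rcases k2 e he with hb | hb
    · exact Or.inl (ha.trans hb)
    · by_cases hc : z₁.1.2.1 e ≤ G.bound
      · exact absurd (ha.le hc) (not_le.2 hb.1)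
      · exact Or.inr ⟨not_le.1 hc, hb.2⟩
    · by_cases hc : z₃.1.2.1 e ≤ G.bound
      · exact absurd (hb.symm.le hc) (not_le.2 ha.2)
      · exact Or.inr ⟨ha.1, not_le.1 hc⟩
    · exact Or.inr ⟨ha.1, hb.2⟩
  · intro e he f hf hbe hbf
    exact (h3 e he f hf hbe hbf).trans (k3 e he f hf (hle e he hbe) (hle f hf hbf))

/-- the region relation is an equivalence -/
def regionSetoid : Setoid G.Config where
  r := G.RegionRel
  iseqv :=
    { refl := fun _ => ⟨rfl, fun _ _ => Or.inl ⟨rfl, Iff.rfl⟩, fun _ _ _ _ _ _ => Iff.rfl⟩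
      symm := RegionRel.symm G
      trans := RegionRel.trans G }

/-- regions: the equivalence classes of the region relation -/
def Region : Type _ := Quotient G.regionSetoid

/-- the region of a configuration -/
def regionOf (z : G.Config) : G.Region := Quotient.mk G.regionSetoid z

/-- the edges of the region graph -/
def RegionEdge (R R' : G.Region) : Prop :=
  ∃ z : G.Config, G.regionOf z = R ∧ 0 < G.step z {z' | G.regionOf z' = R'}

/-- `C` is a bottom strongly connected component of the region graph: the set of all regions that
are mutually reachable with a given one, and no edge leaves it. -/
def IsBSCC (C : Set G.Region) : Prop :=
  (∃ R, C = {R' | Relation.ReflTransGen G.RegionEdge R R' ∧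
    Relation.ReflTransGen G.RegionEdge R' R}) ∧
  ∀ R ∈ C, ∀ R', G.RegionEdge R R' → R' ∈ C

/-! ### Single-ticking processes -/

/-- The fixed-delay event `f` can schedule the fixed-delay event `g`: `f` belongs to a set `E` of
fixed-delay events that are scheduled in a state `s`, and after an occurrence of `E` in `s` the
process can move to a state in which `g` is newly scheduled. -/
def Schedules (f g : Ev) : Prop :=
  (G.lower g : ℕ∞) = G.upper g ∧
  ∃ (s : S) (E : Finset Ev) (s' : S), E ⊆ G.fixSched s ∧ f ∈ E ∧ G.succ s E s' ≠ 0 ∧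
    g ∈ G.sched s' ∧ (g ∉ G.sched s ∨ g ∈ E)

/-- A fixed-delay event is ticking if it can schedule itself, directly or through a chain of
fixed-delay events. -/
def Ticking (f : Ev) : Prop := Relation.TransGen G.Schedules f f

/-- at most one fixed-delay event is ticking -/
def SingleTicking : Prop := ∀ f g, G.Ticking f → G.Ticking g → f = g

end Dynamics

end GSMP

/-! The argument rests on two facts. Almost every run returns to the configurations whose elapsed
times are at most some constant `K`. From these, a BSCC is reached within a fixed number of steps
with probability at least some `ε > 0`. `tendsto_avoid_zero` combines the two into "the BSCCs are
avoided forever with probability zero", and `ae_exists_mem_of_tendsto_avoid` carries this over to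
the measure on runs.

Recurrence is a Foster–Lyapunov argument (`exists_lyapunov`). A fixed-delay event of age `x` has
weight `x`. A variable-delay event has weight `tilt / surv`, where `surv` is its survival function.
Under the race, the product of this weight with the survival probabilities can be integrated by
parts. Outside the set of ages at most `K` the expected total weight drops by at least `1/2` in each
step. Finiteness of the mean delays is what keeps the weight nonnegative.

For the uniform bound, call a configuration `δ`-separated (`Sep`) if each difference of two active
clocks, the constant clock `0` included, is an integer or at distance at least `δ` from the
integers. From a `δ`-separated configuration with bounded ages every edge of the region graph is
followed with probability bounded below, and the result is `δ/3`-separated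
(`exists_le_step_region`). The region graph is finite and each of its vertices reaches a BSCC, so
separated configurations hit a BSCC uniformly (`uniformlyHits_sep`).

It remains to reach separation from arbitrary clocks with bounded ages, and here single-ticking
enters. By pigeonhole some interval of fixed length contains no time at which a clock becomes
integral. Variable-delay events are made to occur inside such an interval or one of its integer
translates (`exists_le_step_prepared`), so that the surviving clocks are then far from integers.
When a fixed-delay event `g` occurs, its clock is integral, hence an event scheduled at that moment
inherits from `g` its differences, modulo integers, to all other clocks (`Separates.next`). Bad
differences can therefore only come from chains of fixed-delay events that go back to the start.

After a long time such a chain must contain a ticking event. In a first phase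
(`uniformlyHits_fresh`) all pairs with a member that does not descend from a ticking event become
separated. In a second phase (`uniformlyHits_settled`) the clock is restarted. Two events that are
both ticking coincide by hypothesis, and every late event inherits its differences either from a
step of a variable-delay event or from a pair that is already separated. With two independent
ticking events their difference would never be refreshed, and no uniform `δ` would exist. -/

section MarkovChain

/-! ### Hitting a set in a Markov chain on a general state space. -/

variable {α : Type*} [MeasurableSpace α]

open Classical in
/-- The probability that the chain with kernel `κ` started in `z` avoids `T` at the times
`0, …, n`. -/
noncomputable def avoid (κ : Kernel α α) (T : Set α) : ℕ → α → ENNReal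
  | 0, z => if z ∈ T then 0 else 1
  | n + 1, z => if z ∈ T then 0 else ∫⁻ y, avoid κ T n y ∂(κ z)

theorem avoid_of_mem {κ : Kernel α α} {T : Set α} {z : α} (hz : z ∈ T) (n : ℕ) :
    avoid κ T n z = 0 := by
  cases n <;> simp [avoid, hz]

theorem avoid_zero_of_notMem {κ : Kernel α α} {T : Set α} {z : α} (hz : z ∉ T) :
    avoid κ T 0 z = 1 := by
  simp [avoid, hz]

theorem avoid_succ_of_notMem {κ : Kernel α α} {T : Set α} {z : α} (hz : z ∉ T) (n : ℕ) :
    avoid κ T (n + 1) z = ∫⁻ y, avoid κ T n y ∂(κ z) := by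
  simp [avoid, hz]

theorem avoid_measurable (κ : Kernel α α) {T : Set α} (hT : MeasurableSet T) (n : ℕ) :
    Measurable (avoid κ T n) := by
  induction n with
  | zero => exact Measurable.ite hT measurable_const measurable_const
  | succ n ih => exact Measurable.ite hT measurable_const ih.lintegral_kernel

theorem avoid_le_one (κ : Kernel α α) [IsMarkovKernel κ] (T : Set α) (n : ℕ) (z : α) :
    avoid κ T n z ≤ 1 := by
  induction n generalizing z with
  | zero => unfold avoid; split_ifs <;> simp
  | succ n ih =>
    unfold avoid
    split_ifs
    · simp
    · calc ∫⁻ y, avoid κ T n y ∂(κ z) ≤ ∫⁻ _, 1 ∂(κ z) := lintegral_mono ih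
        _ = 1 := by simp

theorem avoid_succ_le (κ : Kernel α α) [IsMarkovKernel κ] (T : Set α) (n : ℕ) (z : α) :
    avoid κ T (n + 1) z ≤ avoid κ T n z := by
  induction n generalizing z with
  | zero =>
    by_cases hz : z ∈ T
    · rw [avoid_of_mem hz]; exact zero_le
    · rw [avoid_zero_of_notMem hz]; exact avoid_le_one κ T 1 z
  | succ n ih =>
    by_cases hz : z ∈ T
    · rw [avoid_of_mem hz]; exact zero_le
    · rw [avoid_succ_of_notMem hz, avoid_succ_of_notMem hz]
      exact lintegral_mono ih

theorem avoid_antitone (κ : Kernel α α) [IsMarkovKernel κ] (T : Set α) (z : α) :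
    Antitone fun n => avoid κ T n z :=
  antitone_nat_of_succ_le fun n => avoid_succ_le κ T n z

/-- From every point of `X` the set `T` is hit within a fixed number of steps with a probability
bounded away from zero. -/
def UniformlyHits (κ : Kernel α α) (T X : Set α) : Prop :=
  ∃ (n : ℕ) (ε : ENNReal), 0 < ε ∧ ∀ z ∈ X, avoid κ T n z + ε ≤ 1

theorem UniformlyHits.mono {κ : Kernel α α} {T X Y : Set α} (h : UniformlyHits κ T Y)
    (hXY : X ⊆ Y) : UniformlyHits κ T X := by
  obtain ⟨n, ε, hε, h⟩ := h
  exact ⟨n, ε, hε, fun z hz => h z (hXY hz)⟩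

theorem uniformlyHits_self (κ : Kernel α α) (T : Set α) : UniformlyHits κ T T :=
  ⟨0, 1, one_pos, fun z hz => by rw [avoid_of_mem hz, zero_add]⟩

theorem UniformlyHits.union {κ : Kernel α α} [IsMarkovKernel κ] {T X Y : Set α}
    (hX : UniformlyHits κ T X) (hY : UniformlyHits κ T Y) : UniformlyHits κ T (X ∪ Y) := by
  obtain ⟨n, ε, hε, h⟩ := hX
  obtain ⟨m, ε', hε', h'⟩ := hY
  refine ⟨max n m, min ε ε', lt_min hε hε', ?_⟩
  rintro z (hz | hz)
  · exact (add_le_add (avoid_antitone κ T z (le_max_left _ _)) (min_le_left _ _)).trans (h z hz)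
  · exact (add_le_add (avoid_antitone κ T z (le_max_right _ _)) (min_le_right _ _)).trans (h' z hz)

theorem UniformlyHits.iUnion {κ : Kernel α α} [IsMarkovKernel κ] {T : Set α} {ι : Type*} [Finite ι]
    {X : ι → Set α} (h : ∀ i, UniformlyHits κ T (X i)) : UniformlyHits κ T (⋃ i, X i) := by
  classical
  cases nonempty_fintype ι
  have key : ∀ s : Finset ι, UniformlyHits κ T (⋃ i ∈ s, X i) := by
    intro s
    induction s using Finset.induction_on with
    | empty => exact ⟨0, 1, one_pos, fun z hz => by simp at hz⟩
    | insert a s _ ih =>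
      rw [Finset.set_biUnion_insert]
      exact (h a).union ih
  simpa using key Finset.univ

/-- This makes uniform hitting propagate backwards along a step of uniformly positive probability.
`Y` need not be measurable, since `κ z Y` is an outer measure; later targets are defined by
existential statements, and their measurability is never needed. -/
theorem UniformlyHits.of_step {κ : Kernel α α} [IsMarkovKernel κ] {T X Y : Set α}
    (hT : MeasurableSet T) (hY : UniformlyHits κ T Y) {ε : ENNReal} (hε : 0 < ε)
    (h : ∀ z ∈ X, ε ≤ κ z Y) : UniformlyHits κ T X := by
  obtain ⟨n, ε', hε', hn⟩ := hY
  have hm := avoid_measurable κ hT n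
  -- A measurable superset of `Y` on which the bound of `Y` still holds.
  let M : Set α := {z | avoid κ T n z + ε' ≤ 1}
  have hM : MeasurableSet M := measurableSet_le (hm.add_const _) measurable_const
  -- The minimum with `1` only serves the points of `T`, where the bound reads `ε' * min ε 1 ≤ 1`.
  refine ⟨n + 1, ε' * min ε 1, ENNReal.mul_pos hε'.ne' (lt_min hε one_pos).ne', fun z hz => ?_⟩
  by_cases hzT : z ∈ T
  · rw [avoid_of_mem hzT, zero_add]
    by_cases hXe : ∃ y, y ∈ Y
    · obtain ⟨y, hy⟩ := hXe
      exact (mul_le_mul' ((le_add_left le_rfl).trans (hn y hy)) (min_le_right _ _)).trans (by simp)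
    · have : Y = ∅ := Set.eq_empty_of_forall_notMem fun y hy => hXe ⟨y, hy⟩
      have := h z hz
      simp_all
  · rw [avoid_succ_of_notMem hzT]
    calc ∫⁻ y, avoid κ T n y ∂(κ z) + ε' * min ε 1
        ≤ ∫⁻ y, avoid κ T n y ∂(κ z) + ∫⁻ y, M.indicator (fun _ => ε') y ∂(κ z) := by
          gcongr
          rw [lintegral_indicator_const hM]
          gcongr
          exact (min_le_left _ _).trans ((h z hz).trans (measure_mono fun y hy => hn y hy))
      _ = ∫⁻ y, (avoid κ T n y + M.indicator (fun _ => ε') y) ∂(κ z) :=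
          (lintegral_add_left hm _).symm
      _ ≤ ∫⁻ _, 1 ∂(κ z) := by
          refine lintegral_mono fun y => ?_
          by_cases hy : y ∈ M
          · rw [indicator_of_mem hy]
            exact hy
          · simpa [hy] using avoid_le_one κ T n y
      _ = 1 := by simp

/-- The sum of the probabilities of not having visited `A` up to time `k` is controlled by a
Lyapunov function. -/
theorem sum_avoid_le (κ : Kernel α α) {A : Set α} (hA : MeasurableSet A)
    {L : α → ENNReal} (hL : ∀ z ∉ A, ∫⁻ y, L y ∂(κ z) + 2⁻¹ ≤ L z) (n : ℕ) (z : α) :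
    2⁻¹ * ∑ k ∈ Finset.range n, avoid κ A k z ≤ L z := by
  induction n generalizing z with
  | zero => simp
  | succ n ih =>
    by_cases hz : z ∈ A
    · simp [avoid_of_mem hz]
    · rw [Finset.sum_range_succ', avoid_zero_of_notMem hz]
      simp only [avoid_succ_of_notMem hz]
      rw [← lintegral_finsetSum _ fun k _ => avoid_measurable κ hA k, mul_add, mul_one,
        ← lintegral_const_mul _ (Finset.measurable_fun_sum _ fun k _ => avoid_measurable κ hA k)]
      exact (add_le_add (lintegral_mono ih) le_rfl).trans (hL z hz)

/-- The series of the avoidance probabilities is the expected hitting time of `A`. It is at most `2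
* L z`, so its terms tend to zero. -/
theorem tendsto_avoid_of_lyapunov (κ : Kernel α α) [IsMarkovKernel κ] {A : Set α}
    (hA : MeasurableSet A) {L : α → ENNReal} (hfin : ∀ z, L z ≠ ⊤)
    (hL : ∀ z ∉ A, ∫⁻ y, L y ∂(κ z) + 2⁻¹ ≤ L z) (z : α) :
    Tendsto (fun n => avoid κ A n z) atTop (nhds 0) := by
  have hs : ∑' k, avoid κ A k z ≠ ⊤ := by
    have h2 : 2⁻¹ * ∑' k, avoid κ A k z ≤ L z := by
      rw [ENNReal.tsum_eq_iSup_nat, ENNReal.mul_iSup]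
      exact iSup_le fun n => sum_avoid_le κ hA hL n z
    intro htop
    rw [htop] at h2
    refine hfin z (top_le_iff.1 (le_trans ?_ h2))
    rw [ENNReal.mul_top (by simp)]
  exact ENNReal.tendsto_atTop_zero_of_tsum_ne_top hs

/-- Let `M` be the supremum of the probability of never visiting `T`. Starting in `A` this
probability is at most `(1 - ε) M`. Since `A` is visited almost surely, the same bound holds from
everywhere, so `M ≤ (1 - ε) M` and `M = 0`. -/
theorem tendsto_avoid_zero (κ : Kernel α α) [IsMarkovKernel κ] {A T : Set α}
    (hA : MeasurableSet A) (hT : MeasurableSet T) {L : α → ENNReal} (hfin : ∀ z, L z ≠ ⊤)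
    (hL : ∀ z ∉ A, ∫⁻ y, L y ∂(κ z) + 2⁻¹ ≤ L z) (hAT : UniformlyHits κ T A) (z : α) :
    Tendsto (fun n => avoid κ T n z) atTop (nhds 0) := by
  let r : α → ENNReal := fun z => ⨅ n, avoid κ T n z
  have hlim : ∀ z, Tendsto (fun n => avoid κ T n z) atTop (nhds (r z)) := fun z =>
    tendsto_atTop_iInf (avoid_antitone κ T z)
  have hrT : ∀ z ∈ T, r z = 0 := fun z hz =>
    le_antisymm ((iInf_le _ 0).trans (avoid_of_mem hz 0).le) zero_le
  have hr1 : ∀ z, r z ≤ 1 := fun z => (iInf_le _ 0).trans (avoid_le_one κ T 0 z)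
  have hrm : Measurable r := Measurable.iInf fun n => avoid_measurable κ hT n
  have hstep : ∀ z ∉ T, r z ≤ ∫⁻ y, r y ∂(κ z) := by
    intro z hz
    rw [lintegral_iInf (fun n => avoid_measurable κ hT n)
      (fun a b hab y => avoid_antitone κ T y hab)
      (ne_top_of_le_ne_top ENNReal.one_ne_top
        ((lintegral_mono (avoid_le_one κ T 0)).trans (by simp)))]
    refine le_iInf fun n => ?_
    rw [← avoid_succ_of_notMem hz]
    exact iInf_le _ _
  let M : ENNReal := ⨆ z, r z
  have hrM : ∀ z, r z ≤ M := le_iSup r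
  have hM1 : M ≤ 1 := iSup_le hr1
  -- The Markov property at time `n`: never visiting `T` means avoiding it first, and then failing
  -- again with probability at most `M`.
  have h1 : ∀ n z, r z ≤ avoid κ T n z * M := by
    intro n
    induction n with
    | zero =>
      intro z
      by_cases hz : z ∈ T
      · rw [hrT z hz]; exact zero_le
      · rw [avoid_zero_of_notMem hz, one_mul]; exact hrM z
    | succ n ih =>
      intro z
      by_cases hz : z ∈ T
      · rw [hrT z hz]; exact zero_le
      · rw [avoid_succ_of_notMem hz, ← lintegral_mul_const _ (avoid_measurable κ hT n)]
        exact (hstep z hz).trans (lintegral_mono ih)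
  obtain ⟨N, ε, hε, hN⟩ := hAT
  have hA2 : ∀ z ∈ A, r z + ε * M ≤ M := fun z hz =>
    calc r z + ε * M ≤ avoid κ T N z * M + ε * M := by gcongr; exact h1 N z
      _ = (avoid κ T N z + ε) * M := (add_mul _ _ _).symm
      _ ≤ 1 * M := by gcongr; exact hN z hz
      _ = M := one_mul M
  -- If `A` were empty, the avoidance probabilities of `A` would all be `1`, against the Lyapunov
  -- condition. A point of `A` is needed to obtain `ε ≤ 1`, hence a finite `ε * M` to subtract.
  rcases A.eq_empty_or_nonempty with hAe | hAe
  · have hAemp : ∀ z, z ∉ A := fun z => by simp [hAe]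
    exfalso
    have hone : ∀ n z, avoid κ A n z = 1 := by
      intro n
      induction n with
      | zero => exact fun z => avoid_zero_of_notMem (hAemp z)
      | succ n ih =>
        intro z
        rw [avoid_succ_of_notMem (hAemp z)]
        simp [ih]
    have := tendsto_avoid_of_lyapunov κ hA hfin hL z
    simp only [hone] at this
    exact one_ne_zero (tendsto_nhds_unique tendsto_const_nhds this)
  · have hε1 : ε ≤ 1 := by
      obtain ⟨z, hz⟩ := hAe
      exact (le_add_left le_rfl).trans (hN z hz)
    have hεM : ε * M ≠ ⊤ := ENNReal.mul_ne_top (ne_top_of_le_ne_top ENNReal.one_ne_top hε1)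
      (ne_top_of_le_ne_top ENNReal.one_ne_top hM1)
    -- Either `A` is visited by time `n`, and the improved bound applies there, or it is not, and
    -- the trivial bound `M` is paid.
    have h3 : ∀ n z, r z ≤ (M - ε * M) + avoid κ A n z * M := by
      intro n
      induction n with
      | zero =>
        intro z
        by_cases hz : z ∈ A
        · exact (ENNReal.le_sub_of_add_le_right hεM (hA2 z hz)).trans (le_add_right le_rfl)
        · rw [avoid_zero_of_notMem hz, one_mul]; exact (hrM z).trans (le_add_left le_rfl)
      | succ n ih =>
        intro z
        by_cases hz : z ∈ A
        · exact (ENNReal.le_sub_of_add_le_right hεM (hA2 z hz)).trans (le_add_right le_rfl)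
        by_cases hzT : z ∈ T
        · rw [hrT z hzT]; exact zero_le
        · rw [avoid_succ_of_notMem hz, ← lintegral_mul_const _ (avoid_measurable κ hA n)]
          refine (hstep z hzT).trans ((lintegral_mono ih).trans ?_)
          rw [lintegral_add_left measurable_const]
          simp
    have h4 : ∀ z, r z ≤ M - ε * M := by
      intro z
      have h5 : Tendsto (fun n => (M - ε * M) + avoid κ A n z * M) atTop
          (nhds ((M - ε * M) + 0 * M)) :=
        tendsto_const_nhds.add (ENNReal.Tendsto.mul_const
          (tendsto_avoid_of_lyapunov κ hA hfin hL z)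
          (Or.inr (ne_top_of_le_ne_top ENNReal.one_ne_top hM1)))
      rw [zero_mul, add_zero] at h5
      exact ge_of_tendsto' h5 fun n => h3 n z
    have h6 : M ≤ M - ε * M := iSup_le h4
    have hM0 : M = 0 := by
      by_contra hne
      have hlt : M - ε * M < M := ENNReal.sub_lt_self
        (ne_top_of_le_ne_top ENNReal.one_ne_top hM1) hne (mul_ne_zero hε.ne' hne)
      exact absurd h6 (not_le.2 hlt)
    have : r z = 0 := le_antisymm ((hrM z).trans hM0.le) zero_le
    rw [← this]
    exact hlim z

/-- The function `avoid` is defined by recursion on the kernel, so it has to be identified with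
avoidance probabilities under the Ionescu-Tulcea measure. One unfolding of the recursion corresponds
to one application of the Markov property; dominated convergence over the initial state concludes.
-/
theorem ae_exists_mem_of_tendsto_avoid (κ : Kernel α α) [IsMarkovKernel κ] {T : Set α}
    (hT : MeasurableSet T) (h : ∀ z, Tendsto (fun n => avoid κ T n z) atTop (nhds 0))
    (μ₀ : Measure α) [IsProbabilityMeasure μ₀] :
    ∀ᵐ σ ∂(Kernel.trajMeasure (X := fun _ => α) μ₀ fun n =>
      κ.comap (fun h : (i : Finset.Iic n) → α => h ⟨n, Finset.mem_Iic.2 le_rfl⟩)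
        (measurable_pi_apply _)), ∃ n, σ n ∈ T := by
  set η : (n : ℕ) → Kernel ((i : Finset.Iic n) → α) α := fun n =>
    κ.comap (fun h : (i : Finset.Iic n) → α => h ⟨n, Finset.mem_Iic.2 le_rfl⟩)
      (measurable_pi_apply _) with hη
  set μ := Kernel.trajMeasure (X := fun _ => α) μ₀ η with hμ
  classical
  let P : ℕ → Set (ℕ → α) := fun a => ⋂ i ∈ Finset.range a, {σ | σ i ∉ T}
  let P' : (a : ℕ) → Set ((i : Finset.Iic a) → α) := fun a => ⋂ i, {σ | σ i ∉ T}
  have hPm : ∀ a, MeasurableSet (P a) := fun a =>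
    Finset.measurableSet_biInter _ fun i _ =>
      (measurableSet_preimage (measurable_pi_apply i) hT.compl :
        MeasurableSet ((fun σ : ℕ → α => σ i) ⁻¹' Tᶜ))
  have hP'm : ∀ a, MeasurableSet (P' a) := fun a =>
    MeasurableSet.iInter fun i =>
      (measurableSet_preimage (measurable_pi_apply i) hT.compl :
        MeasurableSet ((fun σ : (i : Finset.Iic a) → α => σ i) ⁻¹' Tᶜ))
  -- `P a` is the event that `T` is avoided before time `a`. Conditioning on the history up to `a`
  -- trades one step of `avoid` for one more coordinate of the trajectory.
  have hshift : ∀ a n, ∫⁻ σ, (P a).indicator (fun σ => avoid κ T (n + 1) (σ a)) σ ∂μ =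
      ∫⁻ σ, (P (a + 1)).indicator (fun σ => avoid κ T n (σ (a + 1))) σ ∂μ := by
    intro a n
    have hmn := avoid_measurable κ hT n
    have e0 : (fun σ : ℕ → α => (P (a + 1)).indicator (fun σ => avoid κ T n (σ (a + 1))) σ) =
        fun σ => (fun q : ((i : Finset.Iic a) → α) × α =>
          (P' a).indicator 1 q.1 * avoid κ T n q.2)
          (Preorder.frestrictLe a σ, σ (a + 1)) := by
      funext σ
      have : σ ∈ P (a + 1) ↔ Preorder.frestrictLe (π := fun _ => α) a σ ∈ P' a := by
        simp [P, P', Preorder.frestrictLe]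
      by_cases hs : σ ∈ P (a + 1)
      · simp [hs, this.1 hs]
      · have h2 : Preorder.frestrictLe (π := fun _ => α) a σ ∉ P' a := fun h => hs (this.2 h)
        simp [hs, h2]
    have hF : Measurable fun q : ((i : Finset.Iic a) → α) × α =>
          (P' a).indicator (1 : ((i : Finset.Iic a) → α) → ENNReal) q.1 * avoid κ T n q.2 :=
      ((measurable_one.indicator (hP'm a)).comp measurable_fst).mul (hmn.comp measurable_snd)
    rw [e0, ← lintegral_map (f := fun q : ((i : Finset.Iic a) → α) × α =>
          (P' a).indicator (1 : ((i : Finset.Iic a) → α) → ENNReal) q.1 * avoid κ T n q.2) hF (by fun_prop), hμ,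
      ← Kernel.map_frestrictLe_trajMeasure_compProd_eq_map_trajMeasure,
      Measure.lintegral_compProd hF, ← hμ, lintegral_map (hF.lintegral_kernel_prod_right')
        (by fun_prop)]
    refine lintegral_congr fun σ => ?_
    simp only [hη, Kernel.comap_apply]
    rw [lintegral_const_mul _ hmn]
    have hsplit : Preorder.frestrictLe (π := fun _ => α) a σ ∈ P' a ↔ σ ∈ P a ∧ σ a ∉ T := by
      simp only [P, P', Preorder.frestrictLe, mem_iInter, Finset.mem_range, mem_ofPred_eq,
        Subtype.forall, Finset.mem_Iic, Finset.restrict_def]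
      constructor
      · exact fun h => ⟨fun i hi => h i hi.le, h a le_rfl⟩
      · rintro ⟨h1, h2⟩ i hi
        rcases hi.lt_or_eq with hlt | rfl
        · exact h1 i hlt
        · exact h2
    by_cases hs : σ ∈ P a
    · by_cases ha : σ a ∈ T
      · have h2 : Preorder.frestrictLe (π := fun _ => α) a σ ∉ P' a := fun h => (hsplit.1 h).2 ha
        simp [hs, avoid_of_mem ha, h2]
      · have h2 := hsplit.2 ⟨hs, ha⟩
        rw [indicator_of_mem hs, indicator_of_mem h2, avoid_succ_of_notMem ha]
        simp [Preorder.frestrictLe]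
    · have h2 : Preorder.frestrictLe (π := fun _ => α) a σ ∉ P' a := fun h => hs (hsplit.1 h).1
      simp [hs, h2]
  have hall : ∀ n a, ∫⁻ σ, (P a).indicator (fun σ => avoid κ T n (σ a)) σ ∂μ =
      μ (P (a + n + 1)) := by
    intro n
    induction n with
    | zero =>
      intro a
      rw [add_zero, ← lintegral_indicator_one (hPm (a + 1))]
      refine lintegral_congr fun σ => ?_
      have hiff : σ ∈ P (a + 1) ↔ σ ∈ P a ∧ σ a ∉ T := by
        simp only [P, mem_iInter, Finset.mem_range, mem_ofPred_eq, Nat.lt_succ_iff]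
        constructor
        · exact fun h => ⟨fun i hi => h i hi.le, h a le_rfl⟩
        · rintro ⟨h1, h2⟩ i hi
          rcases hi.lt_or_eq with hlt | rfl
          · exact h1 i hlt
          · exact h2
      by_cases hs : σ ∈ P a <;> by_cases ha : σ a ∈ T <;>
        simp [indicator, hiff, hs, ha, avoid]
    | succ n ih =>
      intro a
      rw [hshift, ih]
      congr 2
      omega
  have hlim : Tendsto (fun n => ∫⁻ σ, avoid κ T n (σ 0) ∂μ) atTop (nhds (∫⁻ _, 0 ∂μ)) := by
    refine tendsto_lintegral_of_dominated_convergence (fun _ => 1)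
      (fun n => (avoid_measurable κ hT n).comp (measurable_pi_apply 0))
      (fun n => ae_of_all _ fun σ => avoid_le_one κ T n _) (by simp) (ae_of_all _ fun σ => h _)
  have hbad : ∀ n, μ {σ | ∀ i, σ i ∉ T} ≤ ∫⁻ σ, avoid κ T n (σ 0) ∂μ := by
    intro n
    have := hall n 0
    simp only [P, Finset.range_zero, Finset.notMem_empty, iInter_of_empty, iInter_univ,
      indicator_univ, zero_add] at this
    rw [this]
    refine measure_mono fun σ hσ => ?_
    simp only [mem_iInter]
    exact fun i _ => hσ i
  have h0 : μ {σ | ∀ i, σ i ∉ T} = 0 := by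
    have := ge_of_tendsto' hlim hbad
    simpa using this
  rw [ae_iff]
  convert h0 using 3
  simp

end MarkovChain

/-! ### The support of one step, and integrals against the transition kernel. -/

namespace GSMP

set_option linter.unusedSectionVars false

variable {S Ev : Type*} [Fintype S] [Fintype Ev] [DecidableEq Ev] (G : GSMP S Ev)

/-- If some variable-delay event other than `e` had reached its upper bound, its survival factor in
`winVar` would vanish; fixed-delay events are kept below their bound by the race window. -/
theorem isConfig_of_winVar_ne_zero (z : G.Config) {e : Ev} {t : ℝ}
    (ht : t ∈ G.raceWindow z.1.1 z.1.2.1) (hw : G.winVar z.1.1 z.1.2.1 e t ≠ 0) (s' : S) :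
    G.IsConfig (s', G.nextVal z.1.1 z.1.2.1 {e} t s', t) := by
  refine G.next_isConfig (τ := z.1.2.2) z.2 ht.1 (fun c hc hce n hn => ?_) s'
  rw [Finset.mem_singleton] at hce
  rcases (G.lower_le_upper c).eq_or_lt with hl | hl
  · have := ht.2 c (mem_fixSched.2 ⟨hc, hl⟩)
    have hln : G.lower c = n := by
      rw [hn] at hl
      exact_mod_cast hl
    rw [hln] at this
    linarith
  · by_contra hcon
    apply hw
    unfold winVar
    rw [Finset.prod_eq_zero (Finset.mem_erase.2 ⟨hce, mem_varSched.2 ⟨hc, hl⟩⟩)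
      (G.surv_eq_zero hl hn (not_lt.1 hcon)), mul_zero]

theorem isConfig_of_winFix_ne_zero (z : G.Config) (h : (G.fixSched z.1.1).Nonempty)
    (hw : G.winFix z.1.1 z.1.2.1 (G.firstFixedTime z.1.1 z.1.2.1 h) ≠ 0) (s' : S) :
    G.IsConfig (s', G.nextVal z.1.1 z.1.2.1 (G.firstFixed z.1.1 z.1.2.1)
      (G.firstFixedTime z.1.1 z.1.2.1 h) s', G.firstFixedTime z.1.1 z.1.2.1 h) := by
  refine G.next_isConfig (τ := z.1.2.2) z.2 (G.firstFixedTime_nonneg z h)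
    (fun c hc hce n hn => ?_) s'
  rcases (G.lower_le_upper c).eq_or_lt with hl | hl
  · have hcf := mem_fixSched.2 ⟨hc, hl⟩
    have hln : G.lower c = n := by
      rw [hn] at hl
      exact_mod_cast hl
    simp only [firstFixed, Finset.mem_filter, not_and, not_forall, not_le] at hce
    obtain ⟨f, hf, hlt⟩ := hce hcf
    have : G.firstFixedTime z.1.1 z.1.2.1 h ≤ (G.lower f : ℝ) - z.1.2.1 f :=
      Finset.inf'_le (fun e => (G.lower e : ℝ) - z.1.2.1 e) hf
    rw [hln] at hlt
    linarith
  · by_contra hcon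
    apply hw
    unfold winFix
    exact Finset.prod_eq_zero (mem_varSched.2 ⟨hc, hl⟩) (G.surv_eq_zero hl hn (not_lt.1 hcon))

open Classical in
theorem le_hit {s : S} {ν : Ev → ℝ} {E : Finset Ev} {t : ℝ} {A : Set (S × (Ev → ℝ) × ℝ)}
    (W : Set S) (h : ∀ s' ∈ W, G.succ s E s' ≠ 0 → (s', G.nextVal s ν E t s', t) ∈ A) :
    ∑ s' with s' ∈ W, G.succ s E s' ≤ G.hit s ν E t A := by
  unfold hit
  rw [Finset.sum_filter]
  refine Finset.sum_le_sum fun s' _ => ?_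
  split_ifs with hW
  · by_cases h0 : G.succ s E s' = 0
    · simp [h0]
    · rw [indicator_of_mem (h s' hW h0), mul_one]
  · exact zero_le

variable [MeasurableSpace S] [DiscreteMeasurableSpace S]

-- One summand of the race is kept, with its time restricted to `J` and its successor states to `W`.
-- Replacing `Y` by its measurable hull allows arbitrary target sets.
open Classical in
theorem le_step_of_winVar (z : G.Config) {e : Ev} (he : e ∈ G.varSched z.1.1) {J : Set ℝ}
    (hJm : MeasurableSet J) (hJ : J ⊆ G.raceWindow z.1.1 z.1.2.1) (W : Set S) {Y : Set G.Config}
    (hY : ∀ t ∈ J, ∀ s' ∈ W, G.succ z.1.1 {e} s' ≠ 0 → ∀ z' : G.Config,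
      z'.1 = (s', G.nextVal z.1.1 z.1.2.1 {e} t s', t) → z' ∈ Y) :
    (∑ s' with s' ∈ W, G.succ z.1.1 {e} s') *
      ∫⁻ t in J, ENNReal.ofReal (G.winVar z.1.1 z.1.2.1 e t) ≤ G.step z Y := by
  rw [← measure_toMeasurable Y, step_apply G z (measurableSet_toMeasurable _ _)]
  unfold stepProb
  refine le_trans ?_ (le_add_right (Finset.single_le_sum (f := fun e => ∫⁻ t in
    G.raceWindow z.1.1 z.1.2.1, G.hit z.1.1 z.1.2.1 {e} t
      (Subtype.val '' toMeasurable (G.step z) Y) * ENNReal.ofReal (G.winVar z.1.1 z.1.2.1 e t))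
    (fun _ _ => zero_le) he))
  refine le_trans ?_ (lintegral_mono_set hJ)
  rw [← lintegral_const_mul' _ _ (ne_top_of_le_ne_top ENNReal.one_ne_top
    ((Finset.sum_le_sum_of_subset (Finset.filter_subset _ _)).trans
      (by rw [← tsum_fintype (L := SummationFilter.unconditional S), (G.succ z.1.1 {e}).tsum_coe])))]
  refine setLIntegral_mono' hJm fun t ht => ?_
  by_cases hw : G.winVar z.1.1 z.1.2.1 e t = 0
  · simp [hw]
  · gcongr
    refine G.le_hit W fun s' hW h0 => ?_
    exact ⟨⟨_, G.isConfig_of_winVar_ne_zero z (hJ ht) hw s'⟩,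
      subset_toMeasurable _ _ (hY t ht s' hW h0 _ rfl), rfl⟩

open Classical in
theorem le_step_of_winFix (z : G.Config) (h : (G.fixSched z.1.1).Nonempty) (W : Set S)
    {Y : Set G.Config}
    (hY : ∀ s' ∈ W, G.succ z.1.1 (G.firstFixed z.1.1 z.1.2.1) s' ≠ 0 → ∀ z' : G.Config,
      z'.1 = (s', G.nextVal z.1.1 z.1.2.1 (G.firstFixed z.1.1 z.1.2.1)
        (G.firstFixedTime z.1.1 z.1.2.1 h) s', G.firstFixedTime z.1.1 z.1.2.1 h) → z' ∈ Y) :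
    (∑ s' with s' ∈ W, G.succ z.1.1 (G.firstFixed z.1.1 z.1.2.1) s') *
      ENNReal.ofReal (G.winFix z.1.1 z.1.2.1 (G.firstFixedTime z.1.1 z.1.2.1 h)) ≤ G.step z Y := by
  rw [← measure_toMeasurable Y, step_apply G z (measurableSet_toMeasurable _ _)]
  unfold stepProb
  rw [dif_pos h]
  refine le_trans ?_ (le_add_left le_rfl)
  by_cases hw : G.winFix z.1.1 z.1.2.1 (G.firstFixedTime z.1.1 z.1.2.1 h) = 0
  · simp [hw]
  · gcongr
    refine G.le_hit W fun s' hW h0 => ?_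
    exact ⟨⟨_, G.isConfig_of_winFix_ne_zero z h hw s'⟩,
      subset_toMeasurable _ _ (hY s' hW h0 _ rfl), rfl⟩

theorem exists_of_hit_ne_zero {s : S} {ν : Ev → ℝ} {E : Finset Ev} {t : ℝ} {A : Set G.Config}
    (h : G.hit s ν E t (Subtype.val '' A) ≠ 0) :
    ∃ s', G.succ s E s' ≠ 0 ∧ ∃ z' ∈ A, z'.1 = (s', G.nextVal s ν E t s', t) := by
  unfold hit at h
  obtain ⟨s', -, hs'⟩ := Finset.exists_ne_zero_of_sum_ne_zero h
  refine ⟨s', left_ne_zero_of_mul hs', ?_⟩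
  have := right_ne_zero_of_mul hs'
  rw [indicator_apply_ne_zero] at this
  obtain ⟨z', hz', hv⟩ := this.1
  exact ⟨z', hz', hv⟩

/-- A concrete outcome behind a positive transition probability. The winning time of a
variable-delay event has a density, so it can be taken outside any prescribed countable set `D`.
This genericity is used when an edge of the region graph is transferred to other configurations. -/
theorem exists_of_step_pos (z : G.Config) {A : Set G.Config} (hA : MeasurableSet A)
    (h : 0 < G.step z A) {D : Set ℝ} (hD : D.Countable) :
    (∃ e ∈ G.varSched z.1.1, ∃ t ∈ G.raceWindow z.1.1 z.1.2.1, t ∉ D ∧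
      G.winVar z.1.1 z.1.2.1 e t ≠ 0 ∧ ∃ s', G.succ z.1.1 {e} s' ≠ 0 ∧
        ∃ z' ∈ A, z'.1 = (s', G.nextVal z.1.1 z.1.2.1 {e} t s', t)) ∨
    ∃ hf : (G.fixSched z.1.1).Nonempty,
      G.winFix z.1.1 z.1.2.1 (G.firstFixedTime z.1.1 z.1.2.1 hf) ≠ 0 ∧
      ∃ s', G.succ z.1.1 (G.firstFixed z.1.1 z.1.2.1) s' ≠ 0 ∧ ∃ z' ∈ A,
        z'.1 = (s', G.nextVal z.1.1 z.1.2.1 (G.firstFixed z.1.1 z.1.2.1)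
          (G.firstFixedTime z.1.1 z.1.2.1 hf) s', G.firstFixedTime z.1.1 z.1.2.1 hf) := by
  rw [step_apply G z hA] at h
  unfold stepProb at h
  rcases add_pos_iff.1 h with h | h
  · left
    obtain ⟨e, he, hpos⟩ := Finset.exists_ne_zero_of_sum_ne_zero h.ne'
    refine ⟨e, he, ?_⟩
    by_contra! hcon
    apply hpos
    rw [lintegral_eq_zero_iff']
    · have hae : ∀ᵐ t ∂(volume.restrict (G.raceWindow z.1.1 z.1.2.1)), t ∉ D :=
        ae_restrict_of_ae (measure_eq_zero_iff_ae_notMem.1 (hD.measure_zero volume))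
      filter_upwards [hae, ae_restrict_mem (G.measurableSet_raceWindow _ _)] with t ht ht'
      simp only [Pi.zero_apply, mul_eq_zero, ENNReal.ofReal_eq_zero]
      by_contra! hne
      have hw : G.winVar z.1.1 z.1.2.1 e t ≠ 0 := hne.2.ne'
      obtain ⟨s', hs', z', hz', hv⟩ := G.exists_of_hit_ne_zero hne.1
      exact hcon t ht' ht hw s' hs' z' hz' hv
    · have hp : Measurable fun t : ℝ => (z.1.2.1, t) := measurable_prodMk_left
      have hA' := G.measurableEmbedding_val.measurableSet_image.2 hA
      have m1 := (G.hit_measurable z.1.1 {e} hA').comp hp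
      have m2 := ((G.winVar_measurable z.1.1 he).comp hp).ennreal_ofReal
      exact (m1.mul m2).aemeasurable
  · right
    split_ifs at h with hf
    · refine ⟨hf, ?_, G.exists_of_hit_ne_zero (left_ne_zero_of_mul h.ne')⟩
      have := right_ne_zero_of_mul h.ne'
      intro h0
      simp [h0] at this
    · simp at h

/-! ### Integration against the transition kernel -/

/-- the expectation of `Φ` after `E` occurs in `(s, ν)` at time `t` -/
noncomputable def succMean (s : S) (ν : Ev → ℝ) (E : Finset Ev) (t : ℝ)
    (Φ : S × (Ev → ℝ) × ℝ → ENNReal) : ENNReal :=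
  ∑ s' : S, G.succ s E s' * Φ (s', G.nextVal s ν E t s', t)

/-- the expectation of `Φ` after one step from `z` -/
noncomputable def stepMean (z : G.Config) (Φ : S × (Ev → ℝ) × ℝ → ENNReal) : ENNReal :=
  (∑ e ∈ G.varSched z.1.1, ∫⁻ t in G.raceWindow z.1.1 z.1.2.1,
      G.succMean z.1.1 z.1.2.1 {e} t Φ * ENNReal.ofReal (G.winVar z.1.1 z.1.2.1 e t)) +
    if h : (G.fixSched z.1.1).Nonempty then
      G.succMean z.1.1 z.1.2.1 (G.firstFixed z.1.1 z.1.2.1) (G.firstFixedTime z.1.1 z.1.2.1 h) Φ *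
        ENNReal.ofReal (G.winFix z.1.1 z.1.2.1 (G.firstFixedTime z.1.1 z.1.2.1 h))
    else 0

theorem succMean_mono {s : S} {ν : Ev → ℝ} {E : Finset Ev} {t : ℝ}
    {Φ Ψ : S × (Ev → ℝ) × ℝ → ENNReal} (h : Φ ≤ Ψ) :
    G.succMean s ν E t Φ ≤ G.succMean s ν E t Ψ :=
  Finset.sum_le_sum fun _ _ => mul_le_mul_right (h _) _

theorem stepMean_mono {z : G.Config} {Φ Ψ : S × (Ev → ℝ) × ℝ → ENNReal} (h : Φ ≤ Ψ) :
    G.stepMean z Φ ≤ G.stepMean z Ψ := by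
  unfold stepMean
  refine add_le_add (Finset.sum_le_sum fun e _ => lintegral_mono fun t => ?_) ?_
  · exact mul_le_mul_left (G.succMean_mono h) _
  · split_ifs
    · exact mul_le_mul_left (G.succMean_mono h) _
    · exact le_rfl

theorem succMean_measurable (s : S) (ν : Ev → ℝ) (E : Finset Ev)
    {Φ : S × (Ev → ℝ) × ℝ → ENNReal} (hΦ : Measurable Φ) :
    Measurable fun t => G.succMean s ν E t Φ := by
  unfold succMean
  refine Finset.measurable_fun_sum _ fun s' _ => Measurable.const_mul ?_ _
  refine hΦ.comp (measurable_const.prodMk (Measurable.prodMk ?_ measurable_id))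
  refine measurable_pi_lambda _ fun e => ?_
  unfold nextVal
  split_ifs
  · exact measurable_const.add measurable_id
  · exact measurable_const

/-- Only an upper bound is needed for the drift estimate. It also avoids a discussion of outcomes
that are not configurations: `stepMean` evaluates `Φ` on them as well, while the kernel ignores
them. -/
theorem lintegral_step_le (z : G.Config) {Φ : S × (Ev → ℝ) × ℝ → ENNReal} (hΦ : Measurable Φ) :
    ∫⁻ z', Φ z'.1 ∂(G.step z) ≤ G.stepMean z Φ := by
  have mw : ∀ e ∈ G.varSched z.1.1,
      Measurable fun t => ENNReal.ofReal (G.winVar z.1.1 z.1.2.1 e t) := fun e he =>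
    ((G.winVar_measurable z.1.1 he).comp
      (measurable_prodMk_left : Measurable fun t : ℝ => (z.1.2.1, t))).ennreal_ofReal
  refine Measurable.ennreal_induction
    (motive := fun Φ => ∫⁻ z', Φ z'.1 ∂(G.step z) ≤ G.stepMean z Φ) ?_ ?_ ?_ hΦ
  · intro c A hA
    have h1 : ∀ z' : G.Config, A.indicator (fun _ => c) z'.1 =
        (Subtype.val ⁻¹' A).indicator (fun _ => c) z' := fun z' => rfl
    have hm : MeasurableSet (Subtype.val ⁻¹' A : Set G.Config) := measurable_subtype_coe hA
    simp only [h1]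
    rw [lintegral_indicator_const hm, step_apply G z hm]
    have h2 : ∀ E t, c * G.hit z.1.1 z.1.2.1 E t (Subtype.val '' (Subtype.val ⁻¹' A : Set G.Config))
        ≤ G.succMean z.1.1 z.1.2.1 E t (A.indicator fun _ => c) := by
      intro E t
      unfold hit succMean
      rw [Finset.mul_sum]
      refine Finset.sum_le_sum fun s' _ => ?_
      rw [mul_left_comm]
      refine mul_le_mul_right ?_ _
      by_cases hx : (s', G.nextVal z.1.1 z.1.2.1 E t s', t) ∈
          Subtype.val '' (Subtype.val ⁻¹' A : Set G.Config)
      · rw [indicator_of_mem hx, indicator_of_mem (image_preimage_subset _ _ hx), mul_one]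
      · rw [indicator_of_notMem hx, mul_zero]
        exact zero_le
    unfold stepProb stepMean
    rw [mul_add, Finset.mul_sum]
    refine add_le_add (Finset.sum_le_sum fun e he => ?_) ?_
    · have hp : Measurable fun t : ℝ => (z.1.2.1, t) := measurable_prodMk_left
      refine (lintegral_const_mul c (((G.hit_measurable z.1.1 {e}
        (G.measurableEmbedding_val.measurableSet_image.2 hm)).comp hp).mul (mw e he))).symm.trans_le
        (lintegral_mono fun t => ?_)
      simp only [Function.comp, Pi.mul_apply]
      rw [← mul_assoc]
      exact mul_le_mul_left (h2 _ _) _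
    · split_ifs
      · rw [← mul_assoc]
        exact mul_le_mul_left (h2 _ _) _
      · simp
  · intro f g _ hf hg ihf ihg
    have : G.stepMean z (f + g) = G.stepMean z f + G.stepMean z g := by
      have h3 : ∀ E t, G.succMean z.1.1 z.1.2.1 E t (f + g) =
          G.succMean z.1.1 z.1.2.1 E t f + G.succMean z.1.1 z.1.2.1 E t g := by
        intro E t
        simp [succMean, mul_add, Finset.sum_add_distrib]
      unfold stepMean
      simp only [h3, add_mul]
      rw [add_add_add_comm, ← Finset.sum_add_distrib]
      congr 1
      · refine Finset.sum_congr rfl fun e he => ?_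
        exact lintegral_add_left ((G.succMean_measurable _ _ _ hf).mul (mw e he)) _
      · split_ifs <;> simp
    rw [this]
    exact (lintegral_add_left (hf.comp measurable_subtype_coe) _).trans_le (add_le_add ihf ihg)
  · intro f hf hmono ih
    refine (lintegral_iSup (fun n => (hf n).comp measurable_subtype_coe)
      (fun a b hab x => hmono hab _)).trans_le
      (iSup_le fun n => (ih n).trans (G.stepMean_mono fun x => ?_))
    exact le_iSup (fun n => f n x) n

end GSMP

namespace GSMP

set_option linter.unusedSectionVars false

variable {S Ev : Type*} [Fintype S] [Fintype Ev] [DecidableEq Ev] (G : GSMP S Ev)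

/-! ### Survival functions -/

/-- the probability that the delay of `e` exceeds `a` -/
noncomputable def surv (e : Ev) (a : ℝ) : ℝ := ∫ y in Ioi a, G.dens e y

theorem surv_nonneg {e : Ev} (he : (G.lower e : ℕ∞) < G.upper e) (a : ℝ) : 0 ≤ G.surv e a :=
  integral_nonneg (G.dens_nonneg he)

theorem surv_pos {e : Ev} (he : (G.lower e : ℕ∞) < G.upper e) {a : ℝ}
    (ha : ∀ n : ℕ, G.upper e = n → a < n) : 0 < G.surv e a :=
  G.dens_tail_pos he ha

theorem surv_antitone {e : Ev} (he : (G.lower e : ℕ∞) < G.upper e) : Antitone (G.surv e) :=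
  fun _ _ hab => setIntegral_mono_set (G.dens_integrable he).integrableOn
    (ae_of_all _ (G.dens_nonneg he)) (LE.le.eventuallyLE (Ioi_subset_Ioi hab))

theorem dens_integral_univ {e : Ev} (he : (G.lower e : ℕ∞) < G.upper e) :
    ∫ y, G.dens e y = 1 := by
  rw [← G.dens_integral e he, setIntegral_eq_integral_of_forall_compl_eq_zero]
  exact fun x hx => G.dens_zero e he x hx

theorem surv_zero {e : Ev} (he : (G.lower e : ℕ∞) < G.upper e) : G.surv e 0 = 1 := by
  rw [surv, ← integral_Ici_eq_integral_Ioi, ← G.dens_integral_univ he]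
  refine setIntegral_eq_integral_of_forall_compl_eq_zero fun x hx => G.dens_zero e he x fun h => ?_
  exact hx (le_trans (Nat.cast_nonneg _) h.1)

theorem surv_le_one {e : Ev} (he : (G.lower e : ℕ∞) < G.upper e) {a : ℝ} (ha : 0 ≤ a) :
    G.surv e a ≤ 1 :=
  (G.surv_antitone he ha).trans (G.surv_zero he).le

theorem integral_condDens {e : Ev} (a : ℝ) {t : ℝ} (ht : 0 ≤ t) :
    ∫ y in Ioi t, G.condDens e a y = G.surv e (a + t) / G.surv e a := by
  have h1 : ∫ y in Ioi t, G.condDens e a y =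
      ∫ x in Ioi t, G.dens e (x + a) / ∫ y in Ioi a, G.dens e y :=
    setIntegral_congr_fun measurableSet_Ioi fun x hx => by
      simp [condDens, ht.trans (mem_Ioi.1 hx).le]
  have h2 : ∫ x in Ioi t, G.dens e (x + a) = ∫ y in Ioi (a + t), G.dens e y := by
    have := (measurePreserving_add_right volume a).setIntegral_preimage_emb
      (measurableEmbedding_addRight a) (G.dens e) (Ioi (a + t))
    simpa using this
  rw [h1, integral_div, h2]
  rfl

theorem isClosed_delayInterval (l : ℕ) (u : ℕ∞) : IsClosed (delayInterval l u) := by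
  have : delayInterval l u = Ici (l : ℝ) ∩ ⋂ n : ℕ, ⋂ _ : u = n, Iic (n : ℝ) := by
    ext y; simp [delayInterval]
  rw [this]
  exact isClosed_Ici.inter (isClosed_iInter fun n => isClosed_iInter fun _ => isClosed_Iic)

/-- The part of the support below `K` is compact, and the density is continuous and positive on it;
there are finitely many events. -/
theorem exists_le_dens (K : ℝ) : ∃ m > 0, ∀ e, (G.lower e : ℕ∞) < G.upper e →
    ∀ x ∈ delayInterval (G.lower e) (G.upper e), x ≤ K → m ≤ G.dens e x := by
  have h : ∀ e, ∃ m > 0, (G.lower e : ℕ∞) < G.upper e →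
      ∀ x ∈ delayInterval (G.lower e) (G.upper e), x ≤ K → m ≤ G.dens e x := by
    intro e
    by_cases he : (G.lower e : ℕ∞) < G.upper e
    · have hc : IsCompact (delayInterval (G.lower e) (G.upper e) ∩ Iic K) := by
        refine (isCompact_Icc (a := (G.lower e : ℝ)) (b := K)).of_isClosed_subset
          ((isClosed_delayInterval _ _).inter isClosed_Iic) fun x hx => ⟨hx.1.1, hx.2⟩
      obtain ⟨m, hm, h⟩ := hc.exists_forall_le' (f := G.dens e) (a := 0)
        ((G.dens_cont e he).mono inter_subset_left) fun x hx => G.dens_pos e he x hx.1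
      exact ⟨m, hm, fun _ x hx hxK => h x ⟨hx, hxK⟩⟩
    · exact ⟨1, one_pos, fun h => absurd h he⟩
  choose m hm h using h
  rcases isEmpty_or_nonempty Ev with hE | hE
  · exact ⟨1, one_pos, fun e => (hE.false e).elim⟩
  · obtain ⟨e₀, -, he₀⟩ := Finset.exists_min_image Finset.univ m Finset.univ_nonempty
    exact ⟨m e₀, hm e₀, fun e he x hx hxK => (he₀ e (Finset.mem_univ e)).trans (h e he x hx hxK)⟩

theorem exists_surv_le : ∃ M ≥ 1, ∀ e, (G.lower e : ℕ∞) < G.upper e → ∀ n : ℕ, G.upper e = n →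
    ∀ a < (n : ℝ), G.surv e a ≤ M * (n - a) := by
  have h : ∀ e, ∃ M ≥ 1, (G.lower e : ℕ∞) < G.upper e → ∀ n : ℕ, G.upper e = n →
      ∀ a < (n : ℝ), G.surv e a ≤ M * (n - a) := by
    intro e
    by_cases he : (G.lower e : ℕ∞) < G.upper e
    · cases hu : G.upper e with
      | top => exact ⟨1, le_rfl, fun _ n hn => absurd hn (by simp)⟩
      | coe k =>
        have hc : IsCompact (delayInterval (G.lower e) (G.upper e)) := by
          refine (isCompact_Icc (a := (G.lower e : ℝ)) (b := k)).of_isClosed_subset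
            (isClosed_delayInterval _ _) fun x hx => ⟨hx.1, hx.2 k hu⟩
        obtain ⟨M, hM⟩ := hc.bddAbove_image (G.dens_cont e he)
        have hM' : ∀ x, G.dens e x ≤ max M 1 := by
          intro x
          by_cases hx : x ∈ delayInterval (G.lower e) (G.upper e)
          · exact (hM (mem_image_of_mem _ hx)).trans (le_max_left _ _)
          · rw [G.dens_zero e he x hx]
            exact zero_le_one.trans (le_max_right _ _)
        refine ⟨max M 1, le_max_right _ _, fun _ n hn a ha => ?_⟩
        have hkn : k = n := by exact_mod_cast hn
        subst hkn
        have h1 : G.surv e a = ∫ y in Ioc a k, G.dens e y := by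
          refine setIntegral_eq_of_subset_of_forall_sdiff_eq_zero measurableSet_Ioi
            Ioc_subset_Ioi_self fun x hx => G.dens_zero e he x fun hxd => ?_
          exact hx.2 ⟨hx.1, hxd.2 k hu⟩
        rw [h1]
        calc ∫ y in Ioc a k, G.dens e y ≤ ∫ _ in Ioc a (k : ℝ), max M 1 :=
              setIntegral_mono_on (G.dens_integrable he).integrableOn (by simp)
                measurableSet_Ioc fun x _ => hM' x
          _ = max M 1 * (k - a) := by
              rw [setIntegral_const, measureReal_def, Real.volume_Ioc,
                ENNReal.toReal_ofReal (by linarith), smul_eq_mul, mul_comm]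
    · exact ⟨1, le_rfl, fun h => absurd h he⟩
  choose M hM h using h
  refine ⟨1 + ∑ e, M e, ?_, fun e he n hn a ha => (h e he n hn a ha).trans ?_⟩
  · have : 0 ≤ ∑ e, M e := Finset.sum_nonneg fun e _ => zero_le_one.trans (hM e)
    linarith
  · have h2 : M e ≤ ∑ e, M e :=
      Finset.single_le_sum (fun e _ => zero_le_one.trans (hM e)) (Finset.mem_univ e)
    have : 0 ≤ (n : ℝ) - a := by linarith
    gcongr
    linarith

/-- When the upper bound `n` is finite, the density lies between positive constants on its support,
so the survival function is comparable to the remaining time `n - a`. Keeping a fixed fraction `δ`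
of the remaining time then costs only a constant factor, however small that remaining time is. When
the upper bound is infinite, `surv e K` itself is a bound. -/
theorem exists_le_surv_div (K : ℝ) {δ : ℝ} (hδ : 0 < δ) :
    ∃ κ > 0, κ ≤ 1 ∧ ∀ e, (G.lower e : ℕ∞) < G.upper e → ∀ a t, 0 ≤ a → 0 ≤ t → a + t ≤ K →
      (∀ n : ℕ, G.upper e = n → a < n ∧ δ * (n - a) ≤ n - a - t) →
      κ ≤ G.surv e (a + t) / G.surv e a := by
  have h : ∀ e, ∃ κ > 0, (G.lower e : ℕ∞) < G.upper e → ∀ a t, 0 ≤ a → 0 ≤ t → a + t ≤ K →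
      (∀ n : ℕ, G.upper e = n → a < n ∧ δ * (n - a) ≤ n - a - t) →
      κ ≤ G.surv e (a + t) / G.surv e a := by
    intro e
    by_cases he : (G.lower e : ℕ∞) < G.upper e
    swap
    · exact ⟨1, one_pos, fun h => absurd h he⟩
    cases hu : G.upper e with
    | top =>
      have htop : ∀ x : ℝ, 0 < G.surv e x := fun x =>
        G.surv_pos he fun n hn => absurd (hu.symm.trans hn) (by simp)
      refine ⟨G.surv e K, htop K, fun _ a t ha _ htK _ => ?_⟩
      rw [le_div_iff₀ (htop a)]
      calc G.surv e K * G.surv e a ≤ G.surv e K * 1 := by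
            gcongr
            · exact (htop K).le
            · exact G.surv_le_one he ha
        _ ≤ G.surv e (a + t) := by rw [mul_one]; exact G.surv_antitone he htK
    | coe k =>
      obtain ⟨m, hm, hmd⟩ := G.exists_le_dens k
      obtain ⟨M, hM, hMs⟩ := G.exists_surv_le
      have hlk : (G.lower e : ℝ) + 1 ≤ k := by
        have h1 : (G.lower e : ℕ∞) < k := hu ▸ he
        have h2 : G.lower e < k := by exact_mod_cast h1
        exact_mod_cast h2
      have hk1 : (1 : ℝ) ≤ k := le_trans (by linarith [Nat.cast_nonneg (α := ℝ) (G.lower e)]) hlk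
      have hlow1 : ∀ x : ℝ, (G.lower e : ℝ) ≤ x → x ≤ k → m * (k - x) ≤ G.surv e x := by
        intro x hx hxk
        calc m * (k - x) = ∫ _ in Ioc x (k : ℝ), m := by
              rw [setIntegral_const, measureReal_def, Real.volume_Ioc,
                ENNReal.toReal_ofReal (by linarith), smul_eq_mul, mul_comm]
          _ ≤ ∫ y in Ioc x k, G.dens e y := by
              refine setIntegral_mono_on (by simp) (G.dens_integrable he).integrableOn
                measurableSet_Ioc fun y hy => hmd e he y ⟨hx.trans hy.1.le, fun n hn => ?_⟩ hy.2
              have : k = n := by exact_mod_cast hu.symm.trans hn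
              rw [← this]
              exact hy.2
          _ ≤ G.surv e x := setIntegral_mono_set (G.dens_integrable he).integrableOn
              (ae_of_all _ (G.dens_nonneg he)) (LE.le.eventuallyLE Ioc_subset_Ioi_self)
      -- Below `lower e` the density may vanish. There the survival function is at least its value
      -- at `lower e`, and dividing `m` by `k` compensates for the longer remaining time, since `k -
      -- lower e ≥ 1`.
      have hlow : ∀ x : ℝ, 0 ≤ x → x ≤ k → m / k * (k - x) ≤ G.surv e x := by
        intro x hx hxk
        have h0 : 0 ≤ (k : ℝ) - x := by linarith
        rcases le_total (G.lower e : ℝ) x with hlx | hlx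
        · refine le_trans ?_ (hlow1 x hlx hxk)
          gcongr
          exact div_le_self hm.le hk1
        · refine le_trans ?_ (G.surv_antitone he hlx)
          refine le_trans ?_ (hlow1 _ le_rfl (by linarith))
          rw [div_mul_eq_mul_div, mul_div_assoc]
          gcongr
          calc ((k : ℝ) - x) / k ≤ 1 := by
                rw [div_le_one (by linarith)]; linarith
            _ ≤ k - G.lower e := by linarith
      refine ⟨m / k * δ / M, by positivity, fun _ a t ha ht htK h => ?_⟩
      obtain ⟨hak, hat⟩ := h k rfl
      have hpos : 0 < G.surv e a := G.surv_pos he fun n hn => by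
        have : k = n := by exact_mod_cast hu.symm.trans hn
        rwa [← this]
      rw [div_le_div_iff₀ (by linarith) hpos]
      have hδka : 0 ≤ δ * (k - a) := mul_nonneg hδ.le (by linarith)
      calc m / k * δ * G.surv e a ≤ m / k * δ * (M * (k - a)) := by
            gcongr
            exact hMs e he k hu a hak
        _ = m / k * (δ * (k - a)) * M := by ring
        _ ≤ m / k * (k - (a + t)) * M := by
            gcongr
            linarith
        _ ≤ G.surv e (a + t) * M := by
            gcongr
            exact hlow _ (by linarith) (by linarith)
  choose κ hκ h using h
  rcases isEmpty_or_nonempty Ev with hE | hE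
  · exact ⟨1, one_pos, le_rfl, fun e => (hE.false e).elim⟩
  · obtain ⟨e₀, -, he₀⟩ := Finset.exists_min_image Finset.univ κ Finset.univ_nonempty
    exact ⟨min (κ e₀) 1, lt_min (hκ e₀) one_pos, min_le_right _ _,
      fun e he a t h1 h2 h3 h4 => (min_le_left _ _).trans
        ((he₀ e (Finset.mem_univ e)).trans (h e he a t h1 h2 h3 h4))⟩

/-- The power `Fintype.card Ev` makes the constant independent of which variable-delay events are
scheduled; it is available because `κ ≤ 1`. -/
theorem exists_le_winFix (K : ℝ) {δ : ℝ} (hδ : 0 < δ) :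
    ∃ κ > 0, ∀ (z : G.Config) (t : ℝ), 0 ≤ t →
      (∀ c ∈ G.varSched z.1.1, z.1.2.1 c + t ≤ K ∧
        ∀ n : ℕ, G.upper c = n → δ * (n - z.1.2.1 c) ≤ n - z.1.2.1 c - t) →
      κ ≤ G.winFix z.1.1 z.1.2.1 t := by
  obtain ⟨κ, hκ, hκ1, h⟩ := G.exists_le_surv_div K hδ
  refine ⟨κ ^ Fintype.card Ev, by positivity, fun z t ht hc => ?_⟩
  unfold winFix
  calc κ ^ Fintype.card Ev ≤ κ ^ (G.varSched z.1.1).card :=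
        pow_le_pow_of_le_one hκ.le hκ1 (Finset.card_le_univ _)
    _ = ∏ _c ∈ G.varSched z.1.1, κ := by rw [Finset.prod_const]
    _ ≤ _ := Finset.prod_le_prod (fun _ _ => hκ.le) fun c hcv => by
        rw [G.integral_condDens _ ht]
        have hcs := (mem_varSched.1 hcv)
        exact h c hcs.2 _ _ (z.2.2.1 c hcs.1).1 ht (hc c hcv).1
          fun n hn => ⟨(z.2.2.1 c hcs.1).2 n hn, (hc c hcv).2 n hn⟩

/-- The conditional density of `e` is at least `m / surv e a`, and the window has length at least `δ
/ M * surv e a`. The factor `surv e a` cancels, so the estimate does not degrade when `e` is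
arbitrarily close to its deadline. -/
theorem exists_le_lintegral_winVar (K : ℝ) {δ : ℝ} (hδ : 0 < δ) :
    ∃ κ > 0, ∀ (z : G.Config), ∀ e ∈ G.varSched z.1.1, ∀ (t₁ t₂ : ℝ), 0 ≤ t₁ → t₁ ≤ t₂ →
      (∀ c ∈ G.varSched z.1.1, z.1.2.1 c + t₂ ≤ K ∧
        ∀ n : ℕ, G.upper c = n → δ * (n - z.1.2.1 c) ≤ n - z.1.2.1 c - t₂) →
      G.lower e ≤ z.1.2.1 e + t₁ →
      (δ ≤ t₂ - t₁ ∨ ∃ n : ℕ, G.upper e = n ∧ δ * (n - z.1.2.1 e) ≤ t₂ - t₁) →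
      ENNReal.ofReal κ ≤ ∫⁻ t in Icc t₁ t₂, ENNReal.ofReal (G.winVar z.1.1 z.1.2.1 e t) := by
  obtain ⟨κ, hκ, hκ1, h⟩ := G.exists_le_surv_div K hδ
  obtain ⟨m, hm, hmd⟩ := G.exists_le_dens K
  obtain ⟨M, hM, hMs⟩ := G.exists_surv_le
  refine ⟨m * (δ / M) * κ ^ Fintype.card Ev, by positivity, ?_⟩
  intro z e he t₁ t₂ h0 h12 hc hle hlen
  have hes := mem_varSched.1 he
  have hea := z.2.2.1 e hes.1
  set a := z.1.2.1 e with ha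
  have hSpos : 0 < G.surv e a := G.surv_pos hes.2 hea.2
  have hlen' : δ / M * G.surv e a ≤ t₂ - t₁ := by
    rcases hlen with hlen | ⟨n, hn, hlen⟩
    · calc δ / M * G.surv e a ≤ δ / M * 1 := by
            gcongr
            exact G.surv_le_one hes.2 hea.1
        _ ≤ δ := by rw [mul_one]; exact div_le_self hδ.le hM
        _ ≤ _ := hlen
    · calc δ / M * G.surv e a ≤ δ / M * (M * (n - a)) := by
            gcongr
            exact hMs e hes.2 n hn a (hea.2 n hn)
        _ = δ * (n - a) := by field_simp
        _ ≤ _ := hlen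
  have hpt : ∀ t ∈ Icc t₁ t₂, m / G.surv e a * κ ^ Fintype.card Ev ≤
      G.winVar z.1.1 z.1.2.1 e t := by
    intro t ht
    have ht0 : 0 ≤ t := h0.trans ht.1
    unfold winVar
    refine mul_le_mul ?_ ?_ (by positivity) (G.condDens_nonneg hes.2 _ _)
    · rw [condDens, if_pos ht0]
      change m / G.surv e a ≤ G.dens e (t + a) / G.surv e a
      gcongr
      refine hmd e hes.2 _ ⟨by linarith [ht.1], fun n hn => ?_⟩ (by linarith [(hc e he).1, ht.2])
      have h1 := (hc e he).2 n hn
      have h2 : 0 ≤ δ * (n - a) := mul_nonneg hδ.le (by linarith [hea.2 n hn])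
      linarith [ht.2]
    · calc κ ^ Fintype.card Ev ≤ κ ^ ((G.varSched z.1.1).erase e).card :=
            pow_le_pow_of_le_one hκ.le hκ1 (Finset.card_le_univ _)
        _ = ∏ _c ∈ (G.varSched z.1.1).erase e, κ := by rw [Finset.prod_const]
        _ ≤ _ := Finset.prod_le_prod (fun _ _ => hκ.le) fun c hcv => by
            rw [G.integral_condDens _ ht0]
            have hcv' := Finset.mem_of_mem_erase hcv
            have hcs := (mem_varSched.1 hcv')
            refine h c hcs.2 _ _ (z.2.2.1 c hcs.1).1 ht0 (by linarith [(hc c hcv').1, ht.2])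
              fun n hn => ⟨(z.2.2.1 c hcs.1).2 n hn, ?_⟩
            linarith [(hc c hcv').2 n hn, ht.2]
  calc ENNReal.ofReal (m * (δ / M) * κ ^ Fintype.card Ev)
      ≤ ENNReal.ofReal ((m / G.surv e a * κ ^ Fintype.card Ev) * (t₂ - t₁)) := by
        refine ENNReal.ofReal_le_ofReal ?_
        calc m * (δ / M) * κ ^ Fintype.card Ev
            = (m / G.surv e a * κ ^ Fintype.card Ev) * (δ / M * G.surv e a) := by field_simp
          _ ≤ _ := by gcongr
    _ = ∫⁻ _ in Icc t₁ t₂, ENNReal.ofReal (m / G.surv e a * κ ^ Fintype.card Ev) := by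
        rw [setLIntegral_const, Real.volume_Icc, ENNReal.ofReal_mul (by positivity)]
    _ ≤ _ := setLIntegral_mono' measurableSet_Icc fun t ht => ENNReal.ofReal_le_ofReal (hpt t ht)

end GSMP

namespace GSMP

set_option linter.unusedSectionVars false

variable {S Ev : Type*} [Fintype S] [Fintype Ev] [DecidableEq Ev] (G : GSMP S Ev)

/-! ### A Lyapunov function for the elapsed times -/

theorem surv_eq {e : Ev} (he : (G.lower e : ℕ∞) < G.upper e) (a b : ℝ) :
    G.surv e b = G.surv e a - ∫ y in a..b, G.dens e y := by
  have := intervalIntegral.integral_interval_add_Ioi (μ := volume) (a := a) (b := b)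
    (G.dens_integrable he).integrableOn (G.dens_integrable he).integrableOn
  unfold surv
  linarith

theorem surv_continuous {e : Ev} (he : (G.lower e : ℕ∞) < G.upper e) :
    Continuous (G.surv e) := by
  have h : G.surv e = fun b => G.surv e 0 - ∫ y in (0 : ℝ)..b, G.dens e y :=
    funext fun b => G.surv_eq he 0 b
  rw [h]
  exact continuous_const.sub (intervalIntegral.continuous_primitive
    (fun a b => (G.dens_integrable he).intervalIntegrable) 0)

/-- By the layer-cake formula the integral of the survival function is the mean delay, which is
finite. -/
theorem surv_integrableOn {e : Ev} (he : (G.lower e : ℕ∞) < G.upper e) :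
    IntegrableOn (G.surv e) (Ioi 0) := by
  refine ⟨(G.surv_continuous he).aestronglyMeasurable, ?_⟩
  rw [hasFiniteIntegral_iff_ofReal (ae_of_all _ (G.surv_nonneg he))]
  let μ : Measure ℝ := volume.withDensity fun y => ENNReal.ofReal (G.dens e y)
  have hd : Measurable fun y => ENNReal.ofReal (G.dens e y) := (G.dens_measurable he).ennreal_ofReal
  have hnn : 0 ≤ᵐ[μ] (id : ℝ → ℝ) := by
    rw [EventuallyLE, ae_withDensity_iff hd]
    refine ae_of_all _ fun x hx => ?_
    by_contra hneg
    refine hx ?_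
    rw [G.dens_zero e he x fun h => hneg ((Nat.cast_nonneg _).trans h.1), ENNReal.ofReal_zero]
  have h1 := lintegral_eq_lintegral_meas_lt μ hnn measurable_id.aemeasurable
  have h2 : ∀ t, μ {a | t < id a} = ENNReal.ofReal (G.surv e t) := by
    intro t
    change μ (Ioi t) = _
    rw [withDensity_apply _ measurableSet_Ioi, surv, ofReal_integral_eq_lintegral_ofReal
      (G.dens_integrable he).integrableOn (ae_of_all _ (G.dens_nonneg he))]
  simp only [h2] at h1
  rw [← h1, lintegral_withDensity_eq_lintegral_mul _ hd (by fun_prop)]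
  have h3 : Integrable fun x => x * G.dens e x := by
    refine (G.dens_mean e he).integrable_of_forall_notMem_eq_zero fun x hx => ?_
    rw [G.dens_zero e he x hx, mul_zero]
  have h4 := h3.lintegral_lt_top
  refine lt_of_le_of_lt (lintegral_mono fun x => ?_) h4
  simp only [Pi.mul_apply, id]
  rw [← ENNReal.ofReal_mul (G.dens_nonneg he x), mul_comm]

theorem tendsto_integral_surv {e : Ev} (he : (G.lower e : ℕ∞) < G.upper e) :
    Tendsto (fun K : ℝ => ∫ x in Ioi K, G.surv e x) atTop (nhds 0) := by
  have h2 := intervalIntegral_tendsto_integral_Ioi (μ := volume) 0 (G.surv_integrableOn he)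
    tendsto_id
  have h3 := h2.const_sub (∫ y in Ioi 0, G.surv e y)
  rw [sub_self] at h3
  refine h3.congr' ?_
  filter_upwards [eventually_ge_atTop 0] with K hK
  have := intervalIntegral.integral_Ioi_sub_Ioi (f := G.surv e) (μ := volume)
    (G.surv_integrableOn he) hK
  simp only [id]
  linarith

theorem tendsto_surv {e : Ev} (he : (G.lower e : ℕ∞) < G.upper e) :
    Tendsto (G.surv e) atTop (nhds 0) := by
  have h2 := intervalIntegral_tendsto_integral_Ioi (μ := volume) 0
    (G.dens_integrable he).integrableOn tendsto_id
  have h3 := h2.const_sub (G.surv e 0)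
  have h4 : G.surv e 0 - ∫ y in Ioi 0, G.dens e y = 0 := sub_self _
  rw [h4] at h3
  exact h3.congr fun K => (G.surv_eq he 0 K).symm

/-- the weight `α` of times up to `K`, and `-β` of later times -/
noncomputable def weight (α β K x : ℝ) : ℝ := if x < K then α else -β

theorem weight_antitone {α β K : ℝ} (h : -β ≤ α) : Antitone (weight α β K) := by
  intro x y hxy
  unfold weight
  split_ifs with h1 h2
  · exact le_rfl
  · exact absurd (hxy.trans_lt h1) h2
  · exact h
  · exact le_rfl

/-- the Lyapunov function of a variable-delay event, multiplied by its survival function -/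
noncomputable def tilt (θ α β K : ℝ) (e : Ev) (a : ℝ) : ℝ :=
  θ - (1 - G.surv e a) + ∫ x in (0 : ℝ)..a, G.surv e x * weight α β K x

theorem surv_mul_weight_intervalIntegrable {e : Ev} (he : (G.lower e : ℕ∞) < G.upper e)
    {α β : ℝ} (h : -β ≤ α) (K a b : ℝ) :
    IntervalIntegrable (fun x => G.surv e x * weight α β K x) volume a b :=
  (weight_antitone h).intervalIntegrable.continuousOn_mul (G.surv_continuous he).continuousOn

theorem tilt_continuous {e : Ev} (he : (G.lower e : ℕ∞) < G.upper e) (θ : ℝ)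
    {α β : ℝ} (h : -β ≤ α) (K : ℝ) : Continuous (G.tilt θ α β K e) :=
  (continuous_const.sub (continuous_const.sub (G.surv_continuous he))).add
    (intervalIntegral.continuous_primitive
      (fun a b => G.surv_mul_weight_intervalIntegrable he h K a b) 0)

theorem tilt_zero {e : Ev} (he : (G.lower e : ℕ∞) < G.upper e) (θ α β K : ℝ) :
    G.tilt θ α β K e 0 = θ := by
  simp [tilt, G.surv_zero he]

theorem surv_hasDerivAt {e : Ev} (he : (G.lower e : ℕ∞) < G.upper e) {x : ℝ}
    (hc : ContinuousAt (G.dens e) x) : HasDerivAt (G.surv e) (-G.dens e x) x := by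
  have h : G.surv e = fun b => G.surv e 0 - ∫ y in (0 : ℝ)..b, G.dens e y :=
    funext fun b => G.surv_eq he 0 b
  rw [h]
  exact (intervalIntegral.integral_hasDerivAt_right (G.dens_integrable he).intervalIntegrable
    ((G.dens_measurable he).stronglyMeasurable.stronglyMeasurableAtFilter) hc).const_sub _

theorem tilt_hasDerivAt {e : Ev} (he : (G.lower e : ℕ∞) < G.upper e) (θ : ℝ)
    {α β : ℝ} (h : -β ≤ α) (K : ℝ) {x : ℝ} (hc : ContinuousAt (G.dens e) x) (hx : x ≠ K) :
    HasDerivAt (G.tilt θ α β K e) (-G.dens e x + G.surv e x * weight α β K x) x := by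
  have hw : ContinuousAt (weight α β K) x := by
    rcases hx.lt_or_gt with hlt | hlt
    · refine (continuousAt_const (y := α)).congr ?_
      filter_upwards [gt_mem_nhds hlt] with y hy
      simp [weight, hy]
    · refine (continuousAt_const (y := -β)).congr ?_
      filter_upwards [lt_mem_nhds hlt] with y hy
      simp [weight, not_lt.2 hy.le]
  have hm : Measurable fun x => G.surv e x * weight α β K x :=
    (G.surv_continuous he).measurable.mul (weight_antitone h).measurable
  have h1 := intervalIntegral.integral_hasDerivAt_right
    (G.surv_mul_weight_intervalIntegrable he h K 0 x)
    hm.stronglyMeasurable.stronglyMeasurableAtFilter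
    ((G.surv_continuous he).continuousAt.mul hw)
  have h2 := ((G.surv_hasDerivAt he hc).const_sub 1).const_sub θ
  refine (h2.add h1).congr_deriv ?_
  ring

/-- Three ranges of ages are treated. Near `0` the survival function is at least `1 - θ`, so the
term `θ` suffices. From `a₀` on, the factor `α` makes the integral at least `1`, which absorbs `1 -
surv`. Beyond `K` the negative weight `-N * α` removes at most `θ`, because the tail of the survival
integral tends to zero. -/
theorem exists_tilt_nonneg {θ : ℝ} (hθ : 0 < θ) (hθ1 : θ ≤ 2⁻¹) {N : ℝ} (hN : 0 ≤ N) :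
    ∃ α ≥ (1 : ℝ), ∃ K ≥ (G.bound : ℝ), ∀ e, (G.lower e : ℕ∞) < G.upper e → ∀ a ≥ 0,
      0 ≤ G.tilt θ α (N * α) K e a := by
  obtain ⟨a₀, ha₀, ha₀1, hS⟩ : ∃ a₀ > (0 : ℝ), a₀ ≤ 1 ∧ ∀ e, (G.lower e : ℕ∞) < G.upper e →
      ∀ a, 0 ≤ a → a ≤ a₀ → 1 - θ ≤ G.surv e a := by
    have hev : ∀ᶠ a in nhds (0 : ℝ), ∀ e, (G.lower e : ℕ∞) < G.upper e → 1 - θ ≤ G.surv e a := by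
      refine eventually_all.2 fun e => ?_
      by_cases he : (G.lower e : ℕ∞) < G.upper e
      · have := (G.surv_continuous he).continuousAt (x := 0)
        filter_upwards [this.eventually (lt_mem_nhds (a := 1 - θ)
          (by rw [G.surv_zero he]; linarith))] with a ha _
        exact ha.le
      · exact Eventually.of_forall fun _ h => absurd h he
    obtain ⟨r, hr, h⟩ := Metric.eventually_nhds_iff.1 hev
    refine ⟨min (r / 2) 1, lt_min (by linarith) one_pos, min_le_right _ _, fun e he a ha har => ?_⟩
    refine h ?_ e he
    rw [Real.dist_eq, sub_zero, abs_of_nonneg ha]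
    linarith [har.trans (min_le_left _ _)]
  -- On `[0, a₀]` the survival function is at least `1/2`, so its integral is at least `a₀ / 2`.
  set α : ℝ := 2 / a₀ with hα
  have hα1 : 1 ≤ α := by rw [hα, le_div_iff₀ ha₀]; linarith
  have hNα : 0 ≤ N * α := mul_nonneg hN (by linarith)
  have hαβ : -(N * α) ≤ α := by linarith
  have hint : ∀ e, (G.lower e : ℕ∞) < G.upper e → ∀ a b, IntervalIntegrable (G.surv e) volume a b :=
    fun e he a b => (G.surv_continuous he).intervalIntegrable _ _
  have hone : ∀ e, (G.lower e : ℕ∞) < G.upper e → ∀ a ≥ a₀,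
      1 ≤ α * ∫ x in (0 : ℝ)..a, G.surv e x := by
    intro e he a ha
    have h1 : 2⁻¹ * a₀ ≤ ∫ x in (0 : ℝ)..a₀, G.surv e x := by
      calc 2⁻¹ * a₀ = ∫ _ in (0 : ℝ)..a₀, (2⁻¹ : ℝ) := by simp [mul_comm]
        _ ≤ _ := intervalIntegral.integral_mono_on ha₀.le (by simp) (hint e he _ _)
            fun x hx => by linarith [hS e he x hx.1 hx.2]
    have h2 := intervalIntegral.integral_add_adjacent_intervals (hint e he 0 a₀) (hint e he a₀ a)
    have h3 : 0 ≤ ∫ x in a₀..a, G.surv e x :=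
      intervalIntegral.integral_nonneg ha fun x _ => G.surv_nonneg he x
    calc (1 : ℝ) = α * (2⁻¹ * a₀) := by rw [hα]; field_simp
      _ ≤ _ := by
        gcongr
        linarith
  -- `K` is chosen after `α`, since the tail must be small compared with `N * α`. The condition `1 ≤
  -- K` guarantees `a₀ ≤ K`.
  obtain ⟨K, hKB, hK1, hK⟩ : ∃ K ≥ (G.bound : ℝ), 1 ≤ K ∧ ∀ e, (G.lower e : ℕ∞) < G.upper e →
      N * α * ∫ x in Ioi K, G.surv e x ≤ θ := by
    have hev : ∀ᶠ K in (atTop : Filter ℝ), ∀ e, (G.lower e : ℕ∞) < G.upper e →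
        N * α * ∫ x in Ioi K, G.surv e x ≤ θ := by
      refine eventually_all.2 fun e => ?_
      by_cases he : (G.lower e : ℕ∞) < G.upper e
      · have h1 := (G.tendsto_integral_surv he).const_mul (N * α)
        rw [mul_zero] at h1
        filter_upwards [h1.eventually (gt_mem_nhds hθ)] with K hK _
        exact hK.le
      · exact Eventually.of_forall fun _ h => absurd h he
    obtain ⟨K, h1, h2, h3⟩ := (hev.and ((eventually_ge_atTop (G.bound : ℝ)).and
      (eventually_ge_atTop 1))).exists
    exact ⟨K, h2, h3, h1⟩
  refine ⟨α, hα1, K, hKB, fun e he a ha => ?_⟩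
  have hw1 : ∀ b, 0 ≤ b → b ≤ K → ∫ x in (0 : ℝ)..b, G.surv e x * weight α (N * α) K x =
      α * ∫ x in (0 : ℝ)..b, G.surv e x := by
    intro b hb hbK
    rw [← intervalIntegral.integral_const_mul, intervalIntegral.integral_of_le hb,
      intervalIntegral.integral_of_le hb, ← restrict_Ico_eq_restrict_Ioc]
    refine setIntegral_congr_fun measurableSet_Ico fun x hx => ?_
    simp [weight, hx.2.trans_le hbK, mul_comm]
  have hpos := G.surv_nonneg he a
  unfold tilt
  rcases le_total a K with haK | haK
  · rw [hw1 a ha haK]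
    rcases le_total a a₀ with h1 | h1
    · have h2 : 0 ≤ ∫ x in (0 : ℝ)..a, G.surv e x :=
        intervalIntegral.integral_nonneg ha fun x _ => G.surv_nonneg he x
      have h3 := mul_nonneg (zero_le_one.trans hα1) h2
      linarith [hS e he a ha h1]
    · linarith [hone e he a h1]
  · have h1 := intervalIntegral.integral_add_adjacent_intervals
      (G.surv_mul_weight_intervalIntegrable he hαβ K 0 K)
      (G.surv_mul_weight_intervalIntegrable he hαβ K K a)
    have h2 : ∫ x in K..a, G.surv e x * weight α (N * α) K x =
        -(N * α) * ∫ x in K..a, G.surv e x := by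
      rw [← intervalIntegral.integral_const_mul]
      refine intervalIntegral.integral_congr fun x hx => ?_
      rw [uIcc_of_le haK] at hx
      simp [weight, not_lt.2 hx.1, mul_comm]
    have h3 : ∫ x in K..a, G.surv e x ≤ ∫ x in Ioi K, G.surv e x := by
      rw [intervalIntegral.integral_of_le haK]
      exact setIntegral_mono_set ((G.surv_integrableOn he).mono_set
        (Ioi_subset_Ioi (by linarith))) (ae_of_all _ (G.surv_nonneg he))
        (LE.le.eventuallyLE Ioc_subset_Ioi_self)
    have h4 := mul_le_mul_of_nonneg_left h3 hNα
    rw [← h1, hw1 K (by linarith) le_rfl, h2]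
    linarith [hone e he K (by linarith), hK e he]

end GSMP

/-! ### Integration by parts in the race, and the weights of single events. -/

namespace GSMP

set_option linter.unusedSectionVars false

/-- Integration by parts in a race between independent delays with densities `g i`. -/
theorem race_by_parts {ι : Type*} [DecidableEq ι] (V : Finset ι) (g : ι → ℝ → ℝ) (D : Set ℝ)
    (hD : D.Countable) (hm : ∀ i ∈ V, Measurable (g i))
    (hint : ∀ i ∈ V, IntegrableOn (g i) (Ioi 0)) (h1 : ∀ i ∈ V, ∫ y in Ioi 0, g i y = 1)
    (hc : ∀ i ∈ V, ∀ x > 0, x ∉ D → ContinuousAt (g i) x) {T : ℝ} (hT : 0 ≤ T)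
    {H h : ℝ → ℝ} (hH : ContinuousOn H (Icc 0 T)) (hH' : ∀ x ∈ Ioo 0 T \ D, HasDerivAt H (h x) x)
    (hh : IntervalIntegrable h volume 0 T) :
    IntervalIntegrable
      (fun t => H t * ∑ c ∈ V, g c t * ∏ d ∈ V.erase c, ∫ y in Ioi t, g d y) volume 0 T ∧
    IntervalIntegrable (fun t => h t * ∏ d ∈ V, ∫ y in Ioi t, g d y) volume 0 T ∧
    ∫ t in (0 : ℝ)..T, H t * ∑ c ∈ V, g c t * ∏ d ∈ V.erase c, ∫ y in Ioi t, g d y =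
      H 0 - H T * (∏ d ∈ V, ∫ y in Ioi T, g d y) +
        ∫ t in (0 : ℝ)..T, h t * ∏ d ∈ V, ∫ y in Ioi t, g d y := by
  have hprodcont : ∀ W ⊆ V, ContinuousOn (fun t => ∏ c ∈ W, ∫ y in Ioi t, g c y) (Icc 0 T) := by
    intro W hW
    exact continuousOn_finsetProd _ fun c hcW => race_continuousOn (hint c (hW hcW)) T
  have hterm : ∀ i ∈ V, IntervalIntegrable
      (fun t => g i t * ∏ c ∈ V.erase i, ∫ y in Ioi t, g c y) volume 0 T := by
    intro i hi
    apply IntervalIntegrable.mul_continuousOn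
    · exact (intervalIntegrable_iff_integrableOn_Ioc_of_le hT).2
        ((hint i hi).mono_set Ioc_subset_Ioi_self)
    · rw [uIcc_of_le hT]
      exact hprodcont _ (Finset.erase_subset _ _)
  have hsum : IntervalIntegrable
      (fun t => ∑ c ∈ V, g c t * ∏ d ∈ V.erase c, ∫ y in Ioi t, g d y) volume 0 T := by
    have h2 : IntervalIntegrable (∑ i ∈ V, fun t => g i t * ∏ c ∈ V.erase i, ∫ y in Ioi t, g c y)
        volume 0 T := IntervalIntegrable.sum V hterm
    have h3 : (fun t => ∑ c ∈ V, g c t * ∏ d ∈ V.erase c, ∫ y in Ioi t, g d y) =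
        ∑ i ∈ V, fun t => g i t * ∏ c ∈ V.erase i, ∫ y in Ioi t, g c y := by
      funext t
      simp
    rw [h3]
    exact h2
  have i1 : IntervalIntegrable
      (fun t => H t * ∑ c ∈ V, g c t * ∏ d ∈ V.erase c, ∫ y in Ioi t, g d y) volume 0 T :=
    hsum.continuousOn_mul (by rwa [uIcc_of_le hT])
  have i2 : IntervalIntegrable (fun t => h t * ∏ d ∈ V, ∫ y in Ioi t, g d y) volume 0 T :=
    hh.mul_continuousOn (by rw [uIcc_of_le hT]; exact hprodcont V subset_rfl)
  refine ⟨i1, i2, ?_⟩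
  have hftc := integral_eq_of_hasDerivAt_off_countable_of_le
    (fun t => H t * ∏ c ∈ V, ∫ y in Ioi t, g c y)
    (fun t => h t * (∏ d ∈ V, ∫ y in Ioi t, g d y) -
      H t * ∑ c ∈ V, g c t * ∏ d ∈ V.erase c, ∫ y in Ioi t, g d y) hT hD
    (hH.mul (hprodcont V subset_rfl)) (fun x hx => by
      have h2 := HasDerivAt.fun_finsetProd (u := V) (f := fun c t => ∫ y in Ioi t, g c y)
        (f' := fun c => -g c x) (x := x)
        (fun i hi => race_hasDerivAt (hint i hi) (hm i hi) hx.1.1 (hc i hi x hx.1.1 hx.2))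
      refine ((hH' x hx).mul h2).congr_deriv ?_
      simp only [smul_eq_mul, mul_neg, Finset.sum_neg_distrib, sub_eq_add_neg]
      congr 3
      exact Finset.sum_congr rfl fun i _ => mul_comm _ _) (i2.sub i1)
  rw [intervalIntegral.integral_sub i2 i1, Finset.prod_eq_one h1] at hftc
  linarith

variable {S Ev : Type*} [Fintype S] [Fintype Ev] [DecidableEq Ev] (G : GSMP S Ev)

open Classical in
/-- the Lyapunov function of the elapsed time of a single event -/
noncomputable def ageWeight (θ α β K : ℝ) (e : Ev) (x : ℝ) : ℝ :=
  if (G.lower e : ℕ∞) < G.upper e then G.tilt θ α β K e x / G.surv e x else x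

/-- the Lyapunov function on configurations -/
noncomputable def totalWeight (θ α β K : ℝ) (z : S × (Ev → ℝ) × ℝ) : ENNReal :=
  ∑ e ∈ G.sched z.1, ENNReal.ofReal (G.ageWeight θ α β K e (z.2.1 e))

theorem ageWeight_nonneg {θ α β K : ℝ} {e : Ev}
    (h : (G.lower e : ℕ∞) < G.upper e → ∀ a ≥ 0, 0 ≤ G.tilt θ α β K e a) {x : ℝ} (hx : 0 ≤ x) :
    0 ≤ G.ageWeight θ α β K e x := by
  unfold ageWeight
  split_ifs with he
  · exact div_nonneg (h he x hx) (G.surv_nonneg he x)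
  · exact hx

theorem ageWeight_zero_le {θ : ℝ} (hθ : 0 ≤ θ) (α β K : ℝ) (e : Ev) :
    G.ageWeight θ α β K e 0 ≤ θ := by
  unfold ageWeight
  split_ifs with he
  · rw [G.tilt_zero he, G.surv_zero he, div_one]
  · exact hθ

/-- The survival function in the denominator of the weight cancels against the probability of
surviving. Equality can fail only where the survival function vanishes and division by zero gives
`0`; there the nonnegativity of `tilt` is enough. -/
theorem ageWeight_mul_le {θ α β K : ℝ} {e : Ev} (he : (G.lower e : ℕ∞) < G.upper e) {a t : ℝ}
    (ha : ∀ n : ℕ, G.upper e = n → a < n) (h : 0 ≤ G.tilt θ α β K e (a + t)) :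
    G.ageWeight θ α β K e (a + t) * (G.surv e (a + t) / G.surv e a) ≤
      G.tilt θ α β K e (a + t) / G.surv e a := by
  rw [ageWeight, if_pos he]
  have hpos : 0 < G.surv e a := G.surv_pos he ha
  rcases (G.surv_nonneg he (a + t)).eq_or_lt with h0 | h0
  · rw [← h0, zero_div, mul_zero]
    exact div_nonneg h hpos.le
  · exact (by field_simp : _ = _).le

/-- The surviving clocks keep their aged weights. Each newly scheduled event costs at most `θ`,
hence all of them together at most `1/2`, whichever successor state is drawn. -/
theorem succMean_totalWeight_le {θ α β K : ℝ} (hθ : 0 ≤ θ) (hθc : Fintype.card Ev * θ ≤ 2⁻¹)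
    (htilt : ∀ e, (G.lower e : ℕ∞) < G.upper e → ∀ a ≥ 0, 0 ≤ G.tilt θ α β K e a)
    (z : G.Config) (E : Finset Ev) {t : ℝ} (ht : 0 ≤ t) :
    G.succMean z.1.1 z.1.2.1 E t (G.totalWeight θ α β K) ≤
      ENNReal.ofReal (∑ e ∈ G.sched z.1.1 \ E, G.ageWeight θ α β K e (z.1.2.1 e + t) + 2⁻¹) := by
  have hnn : ∀ e ∈ G.sched z.1.1 \ E, 0 ≤ G.ageWeight θ α β K e (z.1.2.1 e + t) := fun e he =>
    G.ageWeight_nonneg (htilt e)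
      (add_nonneg (z.2.2.1 e (Finset.mem_sdiff.1 he).1).1 ht)
  have hs' : ∀ s', G.totalWeight θ α β K (s', G.nextVal z.1.1 z.1.2.1 E t s', t) ≤
      ENNReal.ofReal (∑ e ∈ G.sched z.1.1 \ E, G.ageWeight θ α β K e (z.1.2.1 e + t) + 2⁻¹) := by
    intro s'
    have h1 : ∀ e ∈ G.sched s', ENNReal.ofReal (G.ageWeight θ α β K e
        (G.nextVal z.1.1 z.1.2.1 E t s' e)) ≤ (if e ∈ G.sched z.1.1 \ E then
          ENNReal.ofReal (G.ageWeight θ α β K e (z.1.2.1 e + t)) else 0) + ENNReal.ofReal θ := by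
      intro e he
      by_cases hin : e ∈ G.sched z.1.1 \ E
      · have hin' := Finset.mem_sdiff.1 hin
        rw [if_pos hin, nextVal, if_pos ⟨he, hin'.1, hin'.2⟩]
        exact le_add_right le_rfl
      · rw [if_neg hin, zero_add, nextVal, if_neg fun h => hin (Finset.mem_sdiff.2 h.2)]
        exact ENNReal.ofReal_le_ofReal (G.ageWeight_zero_le hθ α β K e)
    calc G.totalWeight θ α β K (s', G.nextVal z.1.1 z.1.2.1 E t s', t)
        ≤ ∑ e ∈ G.sched s', ((if e ∈ G.sched z.1.1 \ E then
          ENNReal.ofReal (G.ageWeight θ α β K e (z.1.2.1 e + t)) else 0) + ENNReal.ofReal θ) :=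
          Finset.sum_le_sum h1
      _ ≤ ∑ e, ((if e ∈ G.sched z.1.1 \ E then
          ENNReal.ofReal (G.ageWeight θ α β K e (z.1.2.1 e + t)) else 0) + ENNReal.ofReal θ) :=
          Finset.sum_le_sum_of_subset (Finset.subset_univ _)
      _ = ENNReal.ofReal (∑ e ∈ G.sched z.1.1 \ E, G.ageWeight θ α β K e (z.1.2.1 e + t) +
            Fintype.card Ev * θ) := by
          rw [Finset.sum_add_distrib, Finset.sum_ite_mem, Finset.univ_inter, Finset.sum_const,
            ENNReal.ofReal_add (Finset.sum_nonneg hnn) (by positivity),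
            ENNReal.ofReal_sum_of_nonneg hnn, nsmul_eq_mul, ENNReal.ofReal_mul (by positivity)]
          simp
      _ ≤ _ := ENNReal.ofReal_le_ofReal (by linarith)
  calc G.succMean z.1.1 z.1.2.1 E t (G.totalWeight θ α β K)
      ≤ ∑ s', G.succ z.1.1 E s' * _ := Finset.sum_le_sum fun s' _ => mul_le_mul_right (hs' s') _
    _ = _ := by
      rw [← Finset.sum_mul, ← tsum_fintype (L := SummationFilter.unconditional S),
        (G.succ z.1.1 E).tsum_coe, one_mul]

theorem firstFixed_subset (s : S) (ν : Ev → ℝ) : G.firstFixed s ν ⊆ G.fixSched s :=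
  Finset.filter_subset _ _

theorem add_firstFixedTime_of_mem {s : S} {ν : Ev → ℝ} (h : (G.fixSched s).Nonempty) {f : Ev}
    (hf : f ∈ G.firstFixed s ν) : ν f + G.firstFixedTime s ν h = G.lower f := by
  unfold firstFixed at hf
  rw [Finset.mem_filter] at hf
  have h1 : G.firstFixedTime s ν h ≤ (G.lower f : ℝ) - ν f :=
    Finset.inf'_le (fun e => (G.lower e : ℝ) - ν e) hf.1
  have h2 : (G.lower f : ℝ) - ν f ≤ G.firstFixedTime s ν h := Finset.le_inf' _ _ hf.2
  linarith

theorem firstFixed_nonempty {s : S} {ν : Ev → ℝ} (h : (G.fixSched s).Nonempty) :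
    (G.firstFixed s ν).Nonempty := by
  obtain ⟨f, hf, hmin⟩ := Finset.exists_min_image (G.fixSched s) (fun e => (G.lower e : ℝ) - ν e) h
  exact ⟨f, Finset.mem_filter.2 ⟨hf, hmin⟩⟩

theorem one_le_lower {f : Ev} (hf : (G.lower f : ℕ∞) = G.upper f) : (1 : ℝ) ≤ G.lower f := by
  have h : G.lower f ≠ 0 := fun h0 => G.upper_ne_zero f (by rw [← hf, h0]; rfl)
  exact_mod_cast Nat.one_le_iff_ne_zero.2 h

theorem sched_eq_union (s : S) : G.sched s = G.varSched s ∪ G.fixSched s := by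
  ext e
  rw [Finset.mem_union, mem_varSched, mem_fixSched, ← and_or_left]
  exact ⟨fun h => ⟨h, (G.lower_le_upper e).lt_or_eq⟩, fun h => h.1⟩

theorem disjoint_varSched_fixSched (s : S) : Disjoint (G.varSched s) (G.fixSched s) := by
  rw [Finset.disjoint_left]
  intro e h1 h2
  exact (mem_varSched.1 h1).2.ne (mem_fixSched.1 h2).2

end GSMP

/-! ### The drift inequality for the Lyapunov function. -/

namespace GSMP

set_option linter.unusedSectionVars false

variable {S Ev : Type*} [Fintype S] [Fintype Ev] [DecidableEq Ev] (G : GSMP S Ev)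

/-- an upper bound for the density with which the Lyapunov function is collected at time `t` -/
noncomputable def collected (θ α β K : ℝ) (s : S) (ν : Ev → ℝ) (t : ℝ) : ℝ :=
  (∑ e ∈ G.varSched s, G.tilt θ α β K e (ν e + t) / G.surv e (ν e) *
    ∑ c ∈ (G.varSched s).erase e, G.condDens c (ν c) t *
      ∏ d ∈ ((G.varSched s).erase e).erase c, ∫ y in Ioi t, G.condDens d (ν d) y) +
  (∑ f ∈ G.fixSched s, (ν f + t) * ∑ c ∈ G.varSched s, G.winVar s ν c t) +
  2⁻¹ * ∑ c ∈ G.varSched s, G.winVar s ν c t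

/-- The energy balance of the race. The derivative of `tilt` is `-dens + surv * weight`. Summed over
the variable-delay events, the first part integrates to minus the probability that one of them wins
before `T`. The second part, together with the unit growth of the fixed-delay clocks, is nonpositive
by `hneg`. Half of the gain pays for newly scheduled events, the other half is the drift. -/
theorem integral_collected_le {θ α β K : ℝ} (hαβ : -β ≤ α) (z : G.Config) {T : ℝ} (hT : 0 ≤ T)
    (hneg : ∀ t, 0 ≤ t → ∑ e ∈ G.varSched z.1.1, weight α β K (z.1.2.1 e + t) +
      (G.fixSched z.1.1).card ≤ 0) :
    IntervalIntegrable (G.collected θ α β K z.1.1 z.1.2.1) volume 0 T ∧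
    (∫ t in (0 : ℝ)..T, G.collected θ α β K z.1.1 z.1.2.1 t) +
      ((∑ e ∈ G.varSched z.1.1, G.tilt θ α β K e (z.1.2.1 e + T) / G.surv e (z.1.2.1 e) *
        ∏ d ∈ (G.varSched z.1.1).erase e, ∫ y in Ioi T, G.condDens d (z.1.2.1 d) y) +
      ∑ f ∈ G.fixSched z.1.1, (z.1.2.1 f + T) * G.winFix z.1.1 z.1.2.1 T) +
      2⁻¹ * (1 - G.winFix z.1.1 z.1.2.1 T) ≤
    ∑ e ∈ G.sched z.1.1, G.ageWeight θ α β K e (z.1.2.1 e) := by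
  obtain ⟨⟨s, ν, τ⟩, hz⟩ := z
  have hz' := hz.2.1
  simp only at hz' hneg ⊢
  set V := G.varSched s with hV
  -- The times at which a density may jump or a weight switches at `K`; they are countable, so
  -- integration by parts ignores them.
  let D : Set ℝ := (⋃ c : Ev, {(G.lower c : ℝ) - ν c, ((G.upper c).toNat : ℝ) - ν c}) ∪
    ⋃ c : Ev, {K - ν c}
  have hD : D.Countable := (countable_iUnion fun c => (by simp : Set.Countable _)).union
    (countable_iUnion fun c => countable_singleton _)
  have hvar : ∀ i ∈ V, (G.lower i : ℕ∞) < G.upper i := fun i hi => (mem_varSched.1 hi).2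
  have hm : ∀ i ∈ V, Measurable (G.condDens i (ν i)) := fun i hi =>
    (G.condDens_measurable (hvar i hi)).comp measurable_prodMk_left
  have hint : ∀ i ∈ V, IntegrableOn (G.condDens i (ν i)) (Ioi 0) := fun i hi =>
    G.condDens_integrableOn (hvar i hi) _
  have h1 : ∀ i ∈ V, ∫ y in Ioi 0, G.condDens i (ν i) y = 1 := fun i hi =>
    G.condDens_integral (hvar i hi) (hz' i (mem_varSched.1 hi).1).2
  have hDl : ∀ i x, x ∉ D → x + ν i ≠ G.lower i := fun i x hxD h =>
    hxD (Or.inl (mem_iUnion.2 ⟨i, Or.inl (by linarith)⟩))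
  have hDu : ∀ i x, x ∉ D → x + ν i ≠ ((G.upper i).toNat : ℝ) := fun i x hxD h =>
    hxD (Or.inl (mem_iUnion.2 ⟨i, Or.inr (by rw [mem_singleton_iff]; linarith)⟩))
  have hDK : ∀ i x, x ∉ D → ν i + x ≠ K := fun i x hxD h =>
    hxD (Or.inr (mem_iUnion.2 ⟨i, by rw [mem_singleton_iff]; linarith⟩))
  have hc : ∀ i ∈ V, ∀ x > 0, x ∉ D → ContinuousAt (G.condDens i (ν i)) x :=
    fun i hi x hx hxD => G.condDens_continuousAt (hvar i hi) _ hx (hDl i x hxD) (hDu i x hxD)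
  have hSpos : ∀ i ∈ V, 0 < G.surv i (ν i) := fun i hi =>
    G.surv_pos (hvar i hi) (hz' i (mem_varSched.1 hi).1).2
  have hdens : ∀ i ∈ V, ∀ x > 0, x ∉ D → ContinuousAt (G.dens i) (ν i + x) := by
    intro i hi x hx hxD
    have h2 : ContinuousAt (fun y => G.condDens i (ν i) y * G.surv i (ν i)) x :=
      (hc i hi x hx hxD).mul continuousAt_const
    have h3 : ContinuousAt (fun y => G.condDens i (ν i) (y - ν i) * G.surv i (ν i)) (ν i + x) :=
      ContinuousAt.comp (g := fun y => G.condDens i (ν i) y * G.surv i (ν i))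
        (f := fun y => y - ν i) (x := ν i + x)
        (by rwa [add_sub_cancel_left]) (by fun_prop)
    refine h3.congr ?_
    have h4 : ∀ᶠ y in nhds (ν i + x), 0 ≤ y - ν i := by
      filter_upwards [lt_mem_nhds (show ν i < ν i + x by linarith)] with y hy
      linarith
    filter_upwards [h4] with y hy
    rw [condDens, if_pos hy, sub_add_cancel]
    exact div_mul_cancel₀ _ (hSpos i hi).ne'
  have hFnn : ∀ t, 0 ≤ G.winFix s ν t := fun t =>
    Finset.prod_nonneg fun c hcV => integral_nonneg (G.condDens_nonneg (hvar c hcV) _)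
  -- the three applications of integration by parts
  obtain ⟨iA, -, eA⟩ := race_by_parts V (fun c => G.condDens c (ν c)) D hD hm hint h1 hc hT
    (H := fun _ => 1) (h := fun _ => 0) continuousOn_const (fun x _ => hasDerivAt_const x 1)
    (by simp)
  have hB := fun f : Ev => race_by_parts V (fun c => G.condDens c (ν c)) D hD hm hint h1 hc hT
    (H := fun t => ν f + t) (h := fun _ => 1) (by fun_prop)
    (fun x _ => by simpa using (hasDerivAt_id x).const_add (ν f)) (by simp)
  have herase : ∀ e, ∀ i ∈ V.erase e, i ∈ V := fun e i hi => Finset.mem_of_mem_erase hi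
  let hfun : Ev → ℝ → ℝ := fun e t =>
    (-G.dens e (ν e + t) + G.surv e (ν e + t) * weight α β K (ν e + t)) / G.surv e (ν e)
  have hC := fun (e : Ev) (he : e ∈ V) => race_by_parts (V.erase e) (fun c => G.condDens c (ν c))
    D hD (fun i hi => hm i (herase e i hi)) (fun i hi => hint i (herase e i hi))
    (fun i hi => h1 i (herase e i hi)) (fun i hi => hc i (herase e i hi)) hT
    (H := fun t => G.tilt θ α β K e (ν e + t) / G.surv e (ν e)) (h := hfun e)
    (((G.tilt_continuous (hvar e he) θ hαβ K).comp (by fun_prop)).div_const _).continuousOn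
    (fun x hx => by
      have h2 := G.tilt_hasDerivAt (hvar e he) θ hαβ K (hdens e he x hx.1.1 hx.2) (hDK e x hx.2)
      exact (h2.comp_const_add (ν e) x).div_const _)
    (by
      have h2 : IntervalIntegrable (fun x => -G.dens e x + G.surv e x * weight α β K x)
          volume (ν e + 0) (ν e + T) :=
        ((G.dens_integrable (hvar e he)).intervalIntegrable.neg).add
          (G.surv_mul_weight_intervalIntegrable (hvar e he) hαβ K _ _)
      have h3 := h2.comp_add_left (ν e)
      simp only [add_sub_cancel_left] at h3
      exact h3.div_const _)
  -- pointwise identity for the derivative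
  have hpt : ∀ e ∈ V, ∀ t, 0 ≤ t → hfun e t * ∏ d ∈ V.erase e, ∫ y in Ioi t, G.condDens d (ν d) y =
      -G.winVar s ν e t + weight α β K (ν e + t) * G.winFix s ν t := by
    intro e he t ht
    have h2 : G.winFix s ν t = G.surv e (ν e + t) / G.surv e (ν e) *
        ∏ d ∈ V.erase e, ∫ y in Ioi t, G.condDens d (ν d) y := by
      unfold winFix
      rw [← Finset.mul_prod_erase V _ he, G.integral_condDens _ ht]
    rw [h2, winVar, condDens, if_pos ht, ← hV]
    change (-G.dens e (ν e + t) + G.surv e (ν e + t) * weight α β K (ν e + t)) / G.surv e (ν e) * _ =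
      -(G.dens e (t + ν e) / G.surv e (ν e) * _) + _
    rw [add_comm t]
    ring
  have hwin : ∀ t, ∑ c ∈ V, G.condDens c (ν c) t * ∏ d ∈ V.erase c, ∫ y in Ioi t,
      G.condDens d (ν d) y = ∑ c ∈ V, G.winVar s ν c t := fun t => rfl
  have hwF : ∀ t, ∏ d ∈ V, ∫ y in Ioi t, G.condDens d (ν d) y = G.winFix s ν t := fun t => rfl
  simp only [hwin, hwF, one_mul, zero_mul, intervalIntegral.integral_zero, add_zero] at iA eA hB
  have i1 := IntervalIntegrable.sum V (fun e he => (hC e he).1)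
  have i2 := IntervalIntegrable.sum (G.fixSched s) (fun f _ => (hB f).1)
  have hcoll : G.collected θ α β K s ν = (∑ e ∈ V, fun t =>
      G.tilt θ α β K e (ν e + t) / G.surv e (ν e) * ∑ c ∈ V.erase e, G.condDens c (ν c) t *
        ∏ d ∈ (V.erase e).erase c, ∫ y in Ioi t, G.condDens d (ν d) y) +
      (∑ f ∈ G.fixSched s, fun t => (ν f + t) * ∑ c ∈ V, G.winVar s ν c t) +
      fun t => 2⁻¹ * ∑ c ∈ V, G.winVar s ν c t := by
    funext t
    simp [collected, hV]
  have icoll : IntervalIntegrable (G.collected θ α β K s ν) volume 0 T := by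
    rw [hcoll]
    exact (i1.add i2).add (iA.const_mul _)
  refine ⟨icoll, ?_⟩
  have ecoll : ∫ t in (0 : ℝ)..T, G.collected θ α β K s ν t =
      (∑ e ∈ V, ∫ t in (0 : ℝ)..T, G.tilt θ α β K e (ν e + t) / G.surv e (ν e) *
        ∑ c ∈ V.erase e, G.condDens c (ν c) t *
          ∏ d ∈ (V.erase e).erase c, ∫ y in Ioi t, G.condDens d (ν d) y) +
      (∑ f ∈ G.fixSched s, ∫ t in (0 : ℝ)..T, (ν f + t) * ∑ c ∈ V, G.winVar s ν c t) +
      2⁻¹ * ∫ t in (0 : ℝ)..T, ∑ c ∈ V, G.winVar s ν c t := by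
    rw [← intervalIntegral.integral_finsetSum (fun e he => (hC e he).1),
      ← intervalIntegral.integral_finsetSum (fun f _ => (hB f).1),
      ← intervalIntegral.integral_const_mul, ← intervalIntegral.integral_add,
      ← intervalIntegral.integral_add]
    · rfl
    · have := i1.add i2
      convert! this using 1
      funext t
      simp
    · exact iA.const_mul _
    · convert! i1 using 1
      funext t
      simp
    · convert! i2 using 1
      funext t
      simp
  have hsched : ∑ e ∈ G.sched s, G.ageWeight θ α β K e (ν e) =
      ∑ e ∈ V, G.tilt θ α β K e (ν e) / G.surv e (ν e) + ∑ f ∈ G.fixSched s, ν f := by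
    rw [sched_eq_union, Finset.sum_union (G.disjoint_varSched_fixSched s)]
    congr 1
    · exact Finset.sum_congr rfl fun e he => by rw [ageWeight, if_pos (hvar e he)]
    · exact Finset.sum_congr rfl fun e he => by
        rw [ageWeight, if_neg fun h => h.ne (mem_fixSched.1 he).2]
  have iF := (hB (G.sched_nonempty s).choose).2.1
  -- The only place where `hneg` enters.
  have hderiv : ∑ e ∈ V, (∫ t in (0 : ℝ)..T, hfun e t * ∏ d ∈ V.erase e, ∫ y in Ioi t,
      G.condDens d (ν d) y) + ∑ f ∈ G.fixSched s, ∫ t in (0 : ℝ)..T, G.winFix s ν t ≤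
      -∫ t in (0 : ℝ)..T, ∑ c ∈ V, G.winVar s ν c t := by
    have i3 : IntervalIntegrable (fun t => ∑ e ∈ V, hfun e t * ∏ d ∈ V.erase e, ∫ y in Ioi t,
        G.condDens d (ν d) y) volume 0 T := by
      convert! IntervalIntegrable.sum V (fun e he => (hC e he).2.1) using 1
      funext t
      simp
    rw [← intervalIntegral.integral_finsetSum (fun e he => (hC e he).2.1), Finset.sum_const,
      nsmul_eq_mul, ← intervalIntegral.integral_const_mul, ← intervalIntegral.integral_neg,
      ← intervalIntegral.integral_add i3 (iF.const_mul _)]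
    refine intervalIntegral.integral_mono_on hT (i3.add (iF.const_mul _)) iA.neg fun t ht => ?_
    rw [Finset.sum_congr rfl fun e he => hpt e he t ht.1, Finset.sum_add_distrib,
      Finset.sum_neg_distrib, ← Finset.sum_mul]
    have := mul_nonpos_of_nonpos_of_nonneg (hneg t ht.1) (hFnn t)
    linarith
  rw [ecoll, hsched, Finset.sum_congr rfl fun e he => (hC e he).2.2,
    Finset.sum_congr rfl fun f _ => (hB f).2.2]
  simp only [Finset.sum_add_distrib, Finset.sum_sub_distrib, add_zero]
  rw [eA] at hderiv ⊢
  linarith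

end GSMP

namespace GSMP

set_option linter.unusedSectionVars false

variable {S Ev : Type*} [Fintype S] [Fintype Ev] [DecidableEq Ev] (G : GSMP S Ev)

theorem winVar_nonneg {s : S} (ν : Ev → ℝ) {c : Ev} (hc : c ∈ G.varSched s) (t : ℝ) :
    0 ≤ G.winVar s ν c t :=
  mul_nonneg (G.condDens_nonneg (mem_varSched.1 hc).2 _ _) (Finset.prod_nonneg fun _ hd =>
    integral_nonneg (G.condDens_nonneg (mem_varSched.1 (Finset.mem_of_mem_erase hd)).2 _))

theorem winFix_nonneg (s : S) (ν : Ev → ℝ) (t : ℝ) : 0 ≤ G.winFix s ν t :=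
  Finset.prod_nonneg fun _ hd => integral_nonneg (G.condDens_nonneg (mem_varSched.1 hd).2 _)

/-- In the density of `c` winning, the survival factor of each other event `e` is split off and
merged with the weight of `e`. Exchanging the sums over winners and survivors then gives the
expression to which integration by parts applies. -/
theorem sum_mul_winVar_le_collected {θ α β K : ℝ}
    (htilt : ∀ e, (G.lower e : ℕ∞) < G.upper e → ∀ a ≥ 0, 0 ≤ G.tilt θ α β K e a)
    (z : G.Config) {t : ℝ} (ht : 0 ≤ t) :
    ∑ c ∈ G.varSched z.1.1, (∑ e ∈ G.sched z.1.1 \ {c},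
      G.ageWeight θ α β K e (z.1.2.1 e + t) + 2⁻¹) * G.winVar z.1.1 z.1.2.1 c t ≤
    G.collected θ α β K z.1.1 z.1.2.1 t := by
  obtain ⟨⟨s, ν, τ⟩, hz⟩ := z
  have hz' := hz.2.1
  simp only at hz' ⊢
  set V := G.varSched s with hV
  have hvar : ∀ i ∈ V, (G.lower i : ℕ∞) < G.upper i := fun i hi => (mem_varSched.1 hi).2
  have hsplit : ∀ c ∈ V, G.sched s \ {c} = V.erase c ∪ G.fixSched s := by
    intro c hc
    rw [G.sched_eq_union, Finset.union_sdiff_distrib, ← Finset.erase_eq, ← Finset.erase_eq]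
    rw [Finset.erase_eq_of_notMem (s := G.fixSched s)
      (Finset.disjoint_left.1 (G.disjoint_varSched_fixSched s) hc)]
  have hdisj : ∀ c, Disjoint (V.erase c) (G.fixSched s) := fun c =>
    (G.disjoint_varSched_fixSched s).mono_left (Finset.erase_subset _ _)
  have hX : ∀ c ∈ V, (∑ e ∈ G.sched s \ {c}, G.ageWeight θ α β K e (ν e + t) + 2⁻¹) *
      G.winVar s ν c t ≤ (∑ e ∈ V.erase c, G.tilt θ α β K e (ν e + t) / G.surv e (ν e) *
        (G.condDens c (ν c) t * ∏ d ∈ (V.erase e).erase c, ∫ y in Ioi t, G.condDens d (ν d) y)) +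
      (∑ f ∈ G.fixSched s, (ν f + t) * G.winVar s ν c t) + 2⁻¹ * G.winVar s ν c t := by
    intro c hc
    rw [hsplit c hc, Finset.sum_union (hdisj c), add_mul, add_mul, Finset.sum_mul, Finset.sum_mul]
    refine add_le_add (add_le_add (Finset.sum_le_sum fun e he => ?_)
      (Finset.sum_le_sum fun f hf => ?_)) le_rfl
    · obtain ⟨hec, heV⟩ := Finset.mem_erase.1 he
      have h1 : G.winVar s ν c t = G.surv e (ν e + t) / G.surv e (ν e) *
          (G.condDens c (ν c) t * ∏ d ∈ (V.erase e).erase c,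
            ∫ y in Ioi t, G.condDens d (ν d) y) := by
        rw [winVar, ← hV, ← Finset.mul_prod_erase (V.erase c) _ he, G.integral_condDens _ ht,
          Finset.erase_right_comm]
        ring
      rw [h1, ← mul_assoc]
      refine mul_le_mul_of_nonneg_right (G.ageWeight_mul_le (hvar e heV)
        (hz' e (mem_varSched.1 heV).1).2
        (htilt e (hvar e heV) _ (add_nonneg (hz' e (mem_varSched.1 heV).1).1 ht)))
        (mul_nonneg (G.condDens_nonneg (hvar c hc) _ _) (Finset.prod_nonneg fun d hd =>
          integral_nonneg (G.condDens_nonneg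
            (hvar d (Finset.mem_of_mem_erase (Finset.mem_of_mem_erase hd))) _)))
    · rw [ageWeight, if_neg fun h => h.ne (mem_fixSched.1 hf).2]
  refine (Finset.sum_le_sum hX).trans (le_of_eq ?_)
  rw [Finset.sum_add_distrib, Finset.sum_add_distrib, collected, ← hV, Finset.mul_sum]
  congr 2
  · simp only [Finset.mul_sum]
    refine Finset.sum_comm' fun c e => ?_
    simp only [Finset.mem_erase]
    tauto
  · rw [Finset.sum_comm]
    exact Finset.sum_congr rfl fun f _ => (Finset.mul_sum _ _ _).symm

variable [MeasurableSpace S] [DiscreteMeasurableSpace S]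

theorem totalWeight_measurable {θ α β K : ℝ} (hαβ : -β ≤ α) :
    Measurable (G.totalWeight θ α β K) := by
  refine measurable_from_prod_countable_right fun s => ?_
  show Measurable fun y : (Ev → ℝ) × ℝ =>
    ∑ e ∈ G.sched s, ENNReal.ofReal (G.ageWeight θ α β K e (y.1 e))
  refine Finset.measurable_fun_sum _ fun e _ => ?_
  refine Measurable.ennreal_ofReal ?_
  have h1 : Measurable (G.ageWeight θ α β K e) := by
    unfold ageWeight
    split_ifs with he
    · exact (G.tilt_continuous he θ hαβ K).measurable.div (G.surv_continuous he).measurable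
    · exact measurable_id
  exact h1.comp ((measurable_pi_apply e).comp measurable_fst)

theorem sum_lintegral_succMean_le {θ α β K : ℝ} (hθ : 0 ≤ θ) (hθc : Fintype.card Ev * θ ≤ 2⁻¹)
    (hαβ : -β ≤ α) (htilt : ∀ e, (G.lower e : ℕ∞) < G.upper e → ∀ a ≥ 0, 0 ≤ G.tilt θ α β K e a)
    (z : G.Config) {T : ℝ} (hT : 0 ≤ T)
    (hcoll : IntervalIntegrable (G.collected θ α β K z.1.1 z.1.2.1) volume 0 T) :
    ∑ c ∈ G.varSched z.1.1, ∫⁻ t in Ico 0 T,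
      G.succMean z.1.1 z.1.2.1 {c} t (G.totalWeight θ α β K) *
        ENNReal.ofReal (G.winVar z.1.1 z.1.2.1 c t) ≤
    ENNReal.ofReal (∫ t in (0 : ℝ)..T, G.collected θ α β K z.1.1 z.1.2.1 t) := by
  have hX : ∀ t, 0 ≤ t → ∀ c, 0 ≤ ∑ e ∈ G.sched z.1.1 \ {c},
      G.ageWeight θ α β K e (z.1.2.1 e + t) + 2⁻¹ := by
    intro t ht c
    refine add_nonneg (Finset.sum_nonneg fun e he => G.ageWeight_nonneg (htilt e) ?_) (by norm_num)
    exact add_nonneg (z.2.2.1 e (Finset.mem_sdiff.1 he).1).1 ht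
  rw [← lintegral_finsetSum]
  · rw [intervalIntegral.integral_of_le hT, ofReal_integral_eq_lintegral_ofReal,
      restrict_Ico_eq_restrict_Ioc]
    · refine setLIntegral_mono' measurableSet_Ioc fun t ht => ?_
      calc _ ≤ ∑ c ∈ G.varSched z.1.1, ENNReal.ofReal ((∑ e ∈ G.sched z.1.1 \ {c},
            G.ageWeight θ α β K e (z.1.2.1 e + t) + 2⁻¹) * G.winVar z.1.1 z.1.2.1 c t) := by
            refine Finset.sum_le_sum fun c _ => ?_
            rw [ENNReal.ofReal_mul (hX t ht.1.le c)]
            exact mul_le_mul_left (G.succMean_totalWeight_le hθ hθc htilt z {c} ht.1.le) _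
        _ = ENNReal.ofReal (∑ c ∈ G.varSched z.1.1, (∑ e ∈ G.sched z.1.1 \ {c},
            G.ageWeight θ α β K e (z.1.2.1 e + t) + 2⁻¹) * G.winVar z.1.1 z.1.2.1 c t) :=
            (ENNReal.ofReal_sum_of_nonneg fun c hc =>
              mul_nonneg (hX t ht.1.le c) (G.winVar_nonneg _ hc t)).symm
        _ ≤ _ := ENNReal.ofReal_le_ofReal (G.sum_mul_winVar_le_collected htilt z ht.1.le)
    · exact (intervalIntegrable_iff_integrableOn_Ioc_of_le hT).1 hcoll
    · filter_upwards [ae_restrict_mem measurableSet_Ioc] with t ht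
      exact (Finset.sum_nonneg fun c hc => mul_nonneg (hX t ht.1.le c)
        (G.winVar_nonneg _ hc t)).trans (G.sum_mul_winVar_le_collected htilt z ht.1.le)
  · intro c hc
    exact (G.succMean_measurable _ _ _ (G.totalWeight_measurable hαβ)).mul
      ((G.winVar_measurable z.1.1 hc).comp
        (measurable_prodMk_left : Measurable fun t : ℝ => (z.1.2.1, t))).ennreal_ofReal

theorem tendsto_winFix (z : G.Config) (h : (G.varSched z.1.1).Nonempty) :
    Tendsto (fun n : ℕ => G.winFix z.1.1 z.1.2.1 n) atTop (nhds 0) := by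
  have h1 : ∀ c ∈ G.varSched z.1.1, Tendsto (fun n : ℕ => ∫ y in Ioi (n : ℝ),
      G.condDens c (z.1.2.1 c) y) atTop (nhds 0) := by
    intro c hc
    have hcs := mem_varSched.1 hc
    have h2 := ((G.tendsto_surv hcs.2).comp (tendsto_atTop_add_const_left atTop (z.1.2.1 c)
      tendsto_natCast_atTop_atTop)).div_const (G.surv c (z.1.2.1 c))
    rw [zero_div] at h2
    exact h2.congr fun n => (G.integral_condDens _ (Nat.cast_nonneg n)).symm
  have h2 := tendsto_finsetProd (M := ℝ) (G.varSched z.1.1) h1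
  rwa [Finset.prod_const, zero_pow (Finset.card_ne_zero.2 h)] at h2

/-- all elapsed times are at most `K` -/
def AgeLe (K : ℝ) (z : G.Config) : Prop := ∀ e ∈ G.sched z.1.1, z.1.2.1 e ≤ K

theorem lower_le_bound (e : Ev) : G.lower e ≤ G.bound :=
  (le_max_left _ _).trans (Finset.le_sup (f := fun e => max (G.lower e) (G.upper e).toNat)
    (Finset.mem_univ e))

theorem upper_le_bound {e : Ev} {n : ℕ} (h : G.upper e = n) : n ≤ G.bound := by
  have h1 : (G.upper e).toNat ≤ G.bound :=
    (le_max_right _ _).trans (Finset.le_sup (f := fun e => max (G.lower e) (G.upper e).toNat)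
      (Finset.mem_univ e))
  rwa [h, ENat.toNat_natCast] at h1

/-- The drift comes from `integral_collected_le` up to the first fixed-delay time `T`. If the
fixed-delay events win, the clock that is dropped has weight at least `1`, as a fixed delay is a
positive integer. Without scheduled fixed-delay events, `T` tends to infinity. -/
theorem stepMean_totalWeight_le {θ α K : ℝ} (hθ : 0 ≤ θ) (hθc : Fintype.card Ev * θ ≤ 2⁻¹)
    (hα : 1 ≤ α) (hK : (G.bound : ℝ) ≤ K) (htilt : ∀ e, (G.lower e : ℕ∞) < G.upper e → ∀ a ≥ 0,
      0 ≤ G.tilt θ α (Fintype.card Ev * α) K e a) (z : G.Config) (hz : ¬ G.AgeLe K z) :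
    G.stepMean z (G.totalWeight θ α (Fintype.card Ev * α) K) + 2⁻¹ ≤
      G.totalWeight θ α (Fintype.card Ev * α) K z.1 := by
  set β : ℝ := Fintype.card Ev * α with hβ
  have hβ0 : 0 ≤ β := by positivity
  have hαβ : -β ≤ α := by linarith
  have haw : ∀ e ∈ G.sched z.1.1, ∀ t, 0 ≤ t → 0 ≤ G.ageWeight θ α β K e (z.1.2.1 e + t) :=
    fun e he t ht => G.ageWeight_nonneg (htilt e) (add_nonneg (z.2.2.1 e he).1 ht)
  have hL : G.totalWeight θ α β K z.1 = ENNReal.ofReal (∑ e ∈ G.sched z.1.1,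
      G.ageWeight θ α β K e (z.1.2.1 e)) := by
    rw [totalWeight, ENNReal.ofReal_sum_of_nonneg]
    intro e he
    simpa using haw e he 0 le_rfl
  obtain ⟨e₀, he₀, hage⟩ : ∃ e ∈ G.sched z.1.1, K < z.1.2.1 e := by
    simpa [AgeLe] using hz
  -- A fixed-delay clock stays below its delay, hence below `G.bound ≤ K`; an age above `K` belongs
  -- to a variable-delay event.
  have he₀V : e₀ ∈ G.varSched z.1.1 := by
    refine mem_varSched.2 ⟨he₀, lt_of_le_of_ne (G.lower_le_upper e₀) fun heq => ?_⟩
    have h1 := (z.2.2.1 e₀ he₀).2 _ heq.symm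
    have h2 : (G.lower e₀ : ℝ) ≤ G.bound := by exact_mod_cast G.lower_le_bound e₀
    linarith
  -- The old event `e₀` has weight `-β`, and `β = card Ev * α` outweighs `α` from every other
  -- variable-delay event and `1 ≤ α` from every fixed-delay event.
  have hneg : ∀ t, 0 ≤ t → ∑ e ∈ G.varSched z.1.1, weight α β K (z.1.2.1 e + t) +
      (G.fixSched z.1.1).card ≤ 0 := by
    intro t ht
    have hcard : ((G.varSched z.1.1).card : ℝ) + (G.fixSched z.1.1).card ≤ Fintype.card Ev := by
      have h1 := Finset.card_union_of_disjoint (G.disjoint_varSched_fixSched z.1.1)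
      have h2 := Finset.card_le_univ (G.varSched z.1.1 ∪ G.fixSched z.1.1)
      rw [h1] at h2
      exact_mod_cast h2
    have hw : ∀ x, weight α β K x ≤ α := fun x => by
      unfold weight
      split_ifs <;> linarith
    rw [← Finset.add_sum_erase _ _ he₀V]
    have h1 : weight α β K (z.1.2.1 e₀ + t) = -β := by
      rw [weight, if_neg (by linarith)]
    have h2 : ∑ e ∈ (G.varSched z.1.1).erase e₀, weight α β K (z.1.2.1 e + t) ≤
        (G.varSched z.1.1).card * α := by
      calc _ ≤ ∑ _e ∈ (G.varSched z.1.1).erase e₀, α := Finset.sum_le_sum fun e _ => hw _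
        _ = ((G.varSched z.1.1).erase e₀).card * α := by rw [Finset.sum_const, nsmul_eq_mul]
        _ ≤ _ := by
          have := Finset.card_erase_le (s := G.varSched z.1.1) (a := e₀)
          gcongr
    have h3 : (((G.varSched z.1.1).card : ℝ) + (G.fixSched z.1.1).card) * α ≤ β := by
      rw [hβ]
      gcongr
    have h4 : ((G.fixSched z.1.1).card : ℝ) * 1 ≤ (G.fixSched z.1.1).card * α := by gcongr
    rw [h1]
    linarith
  have hbdry : ∀ T, 0 ≤ T → 0 ≤ (∑ e ∈ G.varSched z.1.1, G.tilt θ α β K e (z.1.2.1 e + T) /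
      G.surv e (z.1.2.1 e) * ∏ d ∈ (G.varSched z.1.1).erase e,
        ∫ y in Ioi T, G.condDens d (z.1.2.1 d) y) +
      ∑ f ∈ G.fixSched z.1.1, (z.1.2.1 f + T) * G.winFix z.1.1 z.1.2.1 T := by
    intro T hT
    refine add_nonneg (Finset.sum_nonneg fun e he => ?_) (Finset.sum_nonneg fun f hf => ?_)
    · have hes := mem_varSched.1 he
      exact mul_nonneg (div_nonneg (htilt e hes.2 _ (add_nonneg (z.2.2.1 e hes.1).1 hT))
        (G.surv_nonneg hes.2 _)) (Finset.prod_nonneg fun d hd => integral_nonneg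
          (G.condDens_nonneg (mem_varSched.1 (Finset.mem_of_mem_erase hd)).2 _))
    · exact mul_nonneg (add_nonneg (z.2.2.1 f (mem_fixSched.1 hf).1).1 hT) (G.winFix_nonneg _ _ _)
  have hcollnn : ∀ T, 0 ≤ T → 0 ≤ ∫ t in (0 : ℝ)..T, G.collected θ α β K z.1.1 z.1.2.1 t := by
    intro T hT
    refine intervalIntegral.integral_nonneg hT fun t ht => ?_
    refine le_trans (Finset.sum_nonneg fun c hc => mul_nonneg (add_nonneg
      (Finset.sum_nonneg fun e he => haw e (Finset.mem_sdiff.1 he).1 t ht.1) (by norm_num))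
      (G.winVar_nonneg _ hc t)) (G.sum_mul_winVar_le_collected htilt z ht.1)
  have htwo : (2⁻¹ : ENNReal) = ENNReal.ofReal 2⁻¹ := by
    rw [ENNReal.ofReal_inv_of_pos two_pos]; simp
  unfold stepMean
  by_cases h : (G.fixSched z.1.1).Nonempty
  · have hT := G.firstFixedTime_nonneg z h
    rw [dif_pos h, raceWindow_of_nonempty G _ h]
    set T := G.firstFixedTime z.1.1 z.1.2.1 h with hTdef
    obtain ⟨icoll, hle⟩ := G.integral_collected_le (θ := θ) hαβ z hT hneg
    -- Of the dropped weight `lower f₀ ≥ 1` of an event that occurs, `1/2` pays for new events and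
    -- `1/2` remains as drift.
    have hfix : (∑ e ∈ G.sched z.1.1 \ G.firstFixed z.1.1 z.1.2.1,
        G.ageWeight θ α β K e (z.1.2.1 e + T) + 2⁻¹) * G.winFix z.1.1 z.1.2.1 T ≤
        ((∑ e ∈ G.varSched z.1.1, G.tilt θ α β K e (z.1.2.1 e + T) / G.surv e (z.1.2.1 e) *
          ∏ d ∈ (G.varSched z.1.1).erase e, ∫ y in Ioi T, G.condDens d (z.1.2.1 d) y) +
        ∑ f ∈ G.fixSched z.1.1, (z.1.2.1 f + T) * G.winFix z.1.1 z.1.2.1 T) -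
        2⁻¹ * G.winFix z.1.1 z.1.2.1 T := by
      have hV : ∑ e ∈ G.varSched z.1.1, G.ageWeight θ α β K e (z.1.2.1 e + T) *
          G.winFix z.1.1 z.1.2.1 T ≤ ∑ e ∈ G.varSched z.1.1,
          G.tilt θ α β K e (z.1.2.1 e + T) / G.surv e (z.1.2.1 e) *
          ∏ d ∈ (G.varSched z.1.1).erase e, ∫ y in Ioi T, G.condDens d (z.1.2.1 d) y := by
        refine Finset.sum_le_sum fun e he => ?_
        have hes := mem_varSched.1 he
        rw [winFix, ← Finset.mul_prod_erase _ _ he, G.integral_condDens _ hT, ← mul_assoc]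
        refine mul_le_mul_of_nonneg_right (G.ageWeight_mul_le hes.2 (z.2.2.1 e hes.1).2
          (htilt e hes.2 _ (add_nonneg (z.2.2.1 e hes.1).1 hT))) ?_
        exact Finset.prod_nonneg fun d hd => integral_nonneg
          (G.condDens_nonneg (mem_varSched.1 (Finset.mem_of_mem_erase hd)).2 _)
      obtain ⟨f₀, hf₀⟩ := G.firstFixed_nonempty (ν := z.1.2.1) h
      have hf₀F := G.firstFixed_subset _ _ hf₀
      have hsub : G.sched z.1.1 \ G.firstFixed z.1.1 z.1.2.1 ⊆
          G.varSched z.1.1 ∪ (G.fixSched z.1.1).erase f₀ := by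
        intro e he
        rw [Finset.mem_sdiff, G.sched_eq_union, Finset.mem_union] at he
        rw [Finset.mem_union, Finset.mem_erase]
        refine he.1.imp_right fun hef => ⟨?_, hef⟩
        rintro rfl
        exact he.2 hf₀
      have h1 : ∑ e ∈ G.sched z.1.1 \ G.firstFixed z.1.1 z.1.2.1,
          G.ageWeight θ α β K e (z.1.2.1 e + T) ≤
          ∑ e ∈ G.varSched z.1.1, G.ageWeight θ α β K e (z.1.2.1 e + T) +
          (∑ f ∈ G.fixSched z.1.1, (z.1.2.1 f + T) - 1) := by
        refine (Finset.sum_le_sum_of_subset_of_nonneg hsub fun e he _ => haw e ?_ T hT).trans ?_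
        · rw [G.sched_eq_union]
          exact Finset.union_subset_union_right (Finset.erase_subset _ _) he
        · rw [Finset.sum_union ((G.disjoint_varSched_fixSched _).mono_right
            (Finset.erase_subset _ _)), ← Finset.add_sum_erase _ _ hf₀F,
            G.add_firstFixedTime_of_mem h hf₀]
          have h2 := G.one_le_lower (mem_fixSched.1 hf₀F).2
          have h3 : ∑ e ∈ (G.fixSched z.1.1).erase f₀, G.ageWeight θ α β K e (z.1.2.1 e + T) =
              ∑ e ∈ (G.fixSched z.1.1).erase f₀, (z.1.2.1 e + T) :=
            Finset.sum_congr rfl fun e he => by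
              rw [ageWeight, if_neg fun h => h.ne (mem_fixSched.1 (Finset.mem_of_mem_erase he)).2]
          linarith
      have h2 := mul_le_mul_of_nonneg_right h1 (G.winFix_nonneg z.1.1 z.1.2.1 T)
      rw [add_mul, ← Finset.sum_mul] at *
      linarith
    calc _ ≤ ENNReal.ofReal (∫ t in (0 : ℝ)..T, G.collected θ α β K z.1.1 z.1.2.1 t) +
          ENNReal.ofReal ((∑ e ∈ G.sched z.1.1 \ G.firstFixed z.1.1 z.1.2.1,
            G.ageWeight θ α β K e (z.1.2.1 e + T) + 2⁻¹) * G.winFix z.1.1 z.1.2.1 T) +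
          ENNReal.ofReal 2⁻¹ := by
          rw [htwo]
          gcongr
          · exact G.sum_lintegral_succMean_le hθ hθc hαβ htilt z hT icoll
          · rw [ENNReal.ofReal_mul (add_nonneg (Finset.sum_nonneg fun e he =>
              haw e (Finset.mem_sdiff.1 he).1 T hT) (by norm_num))]
            exact mul_le_mul_left (G.succMean_totalWeight_le hθ hθc htilt z _ hT) _
      _ ≤ _ := by
          rw [hL, ← ENNReal.ofReal_add (hcollnn T hT), ← ENNReal.ofReal_add _ (by norm_num)]
          · refine ENNReal.ofReal_le_ofReal ?_
            linarith
          · refine add_nonneg (hcollnn T hT) (mul_nonneg (add_nonneg (Finset.sum_nonneg fun e he =>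
              haw e (Finset.mem_sdiff.1 he).1 T hT) (by norm_num)) (G.winFix_nonneg _ _ _))
          · exact mul_nonneg (add_nonneg (Finset.sum_nonneg fun e he =>
              haw e (Finset.mem_sdiff.1 he).1 T hT) (by norm_num)) (G.winFix_nonneg _ _ _)
  · rw [dif_neg h, raceWindow_of_empty G _ h, add_zero, hL]
    have hU : Ici (0 : ℝ) = ⋃ n : ℕ, Ico (0 : ℝ) n := by
      ext x
      simp only [mem_Ici, mem_iUnion, mem_Ico]
      exact ⟨fun h => (exists_nat_gt x).imp fun n hn => ⟨h, hn⟩, fun ⟨_, h, _⟩ => h⟩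
    have hmono : Monotone fun n : ℕ => Ico (0 : ℝ) n := fun a b hab =>
      Ico_subset_Ico_right (by exact_mod_cast hab)
    have hlim : Tendsto (fun n : ℕ => ∑ c ∈ G.varSched z.1.1, ∫⁻ t in Ico (0 : ℝ) n,
        G.succMean z.1.1 z.1.2.1 {c} t (G.totalWeight θ α β K) *
          ENNReal.ofReal (G.winVar z.1.1 z.1.2.1 c t)) atTop
        (nhds (∑ c ∈ G.varSched z.1.1, ∫⁻ t in Ici (0 : ℝ),
        G.succMean z.1.1 z.1.2.1 {c} t (G.totalWeight θ α β K) *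
          ENNReal.ofReal (G.winVar z.1.1 z.1.2.1 c t))) := by
      refine tendsto_finsetSum _ fun c _ => ?_
      rw [hU, setLIntegral_iUnion_of_directed _ (hmono.directed_le)]
      exact tendsto_atTop_iSup fun a b hab => lintegral_mono_set (hmono hab)
    have hlim2 : Tendsto (fun n : ℕ => ENNReal.ofReal (2⁻¹ * (1 - G.winFix z.1.1 z.1.2.1 n)))
        atTop (nhds 2⁻¹) := by
      have h1 := ENNReal.tendsto_ofReal
        (((G.tendsto_winFix z ⟨e₀, he₀V⟩).const_sub 1).const_mul (2⁻¹ : ℝ))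
      rwa [sub_zero, mul_one, ← htwo] at h1
    refine le_of_tendsto' (hlim.add hlim2) fun n => ?_
    have hn : (0 : ℝ) ≤ n := Nat.cast_nonneg n
    obtain ⟨icoll, hle⟩ := G.integral_collected_le (θ := θ) hαβ z hn hneg
    have hF1 : G.winFix z.1.1 z.1.2.1 n ≤ 1 := by
      refine Finset.prod_le_one (fun c hc => integral_nonneg
        (G.condDens_nonneg (mem_varSched.1 hc).2 _)) fun c hc => ?_
      have hcs := mem_varSched.1 hc
      rw [G.integral_condDens _ hn]
      exact div_le_one_of_le₀ (G.surv_antitone hcs.2 (by linarith)) (G.surv_nonneg hcs.2 _)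
    refine (add_le_add (G.sum_lintegral_succMean_le hθ hθc hαβ htilt z hn icoll) le_rfl).trans ?_
    rw [← ENNReal.ofReal_add (hcollnn n hn) (by linarith)]
    refine ENNReal.ofReal_le_ofReal ?_
    linarith [hbdry n hn]

theorem exists_lyapunov : ∃ K ≥ (G.bound : ℝ), ∃ L : G.Config → ENNReal, (∀ z, L z ≠ ⊤) ∧
    ∀ z, ¬ G.AgeLe K z → ∫⁻ y, L y ∂(G.step z) + 2⁻¹ ≤ L z := by
  rcases isEmpty_or_nonempty Ev with hE | hE
  · refine ⟨G.bound, le_rfl, 0, fun _ => ENNReal.zero_ne_top, fun z => ?_⟩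
    exact (hE.false (G.sched_nonempty z.1.1).choose).elim
  have hc : (1 : ℝ) ≤ Fintype.card Ev := by exact_mod_cast Fintype.card_pos
  -- Chosen so that rescheduling all events at once costs at most `1/2`.
  set θ : ℝ := 2⁻¹ / Fintype.card Ev with hθ
  have hθ0 : 0 < θ := by positivity
  obtain ⟨α, hα, K, hK, htilt⟩ := G.exists_tilt_nonneg hθ0
    (div_le_self (by norm_num) hc) (N := Fintype.card Ev) (by positivity)
  refine ⟨K, hK, fun z => G.totalWeight θ α (Fintype.card Ev * α) K z.1, fun z => ?_, fun z hz => ?_⟩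
  · exact ENNReal.sum_ne_top.2 fun e _ => ENNReal.ofReal_ne_top
  · refine (add_le_add (G.lintegral_step_le z (G.totalWeight_measurable ?_)) le_rfl).trans
      (G.stepMean_totalWeight_le hθ0.le ?_ hα hK htilt z hz)
    · have : (0 : ℝ) ≤ Fintype.card Ev * α := by positivity
      linarith
    · rw [hθ, mul_div_cancel₀ _ (by positivity)]

end GSMP

namespace GSMP

set_option linter.unusedSectionVars false

variable {S Ev : Type*} [Fintype S] [Fintype Ev] [DecidableEq Ev] (G : GSMP S Ev)

/-! ### Lower bounds for one-step probabilities -/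

theorem exists_le_succ : ∃ σ : ENNReal, 0 < σ ∧ ∀ s E s', G.succ s E s' ≠ 0 → σ ≤ G.succ s E s' := by
  rcases isEmpty_or_nonempty S with hS | hS
  · exact ⟨1, one_pos, fun s => (hS.false s).elim⟩
  classical
  let g : S × Finset Ev × S → ENNReal := fun p =>
    if G.succ p.1 p.2.1 p.2.2 = 0 then 1 else G.succ p.1 p.2.1 p.2.2
  obtain ⟨p, hp⟩ := Finite.exists_min g
  refine ⟨g p, ?_, fun s E s' h => ?_⟩
  · simp only [g]
    split_ifs with h0
    · exact one_pos
    · exact pos_iff_ne_zero.2 h0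
  · have := hp (s, E, s')
    simp only [g, if_neg h] at this
    simpa only [g] using this

variable [MeasurableSpace S] [DiscreteMeasurableSpace S]

/-- The conditions on upper bounds are relative to the remaining times. This form is indispensable
for clocks that may be arbitrarily close to their deadlines, as in `exists_le_step_urgent`;
elsewhere the absolute form below suffices. -/
theorem exists_le_step_of_window_rel (K : ℝ) {δ : ℝ} (hδ : 0 < δ) :
    ∃ ε : ENNReal, 0 < ε ∧ ∀ (z : G.Config), ∀ e ∈ G.varSched z.1.1, ∀ (t₁ t₂ : ℝ),
      0 ≤ t₁ → t₁ ≤ t₂ →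
      (∀ f ∈ G.fixSched z.1.1, t₂ < G.lower f - z.1.2.1 f) →
      (∀ c ∈ G.varSched z.1.1, z.1.2.1 c + t₂ ≤ K ∧
        ∀ n : ℕ, G.upper c = n → δ * (n - z.1.2.1 c) ≤ n - z.1.2.1 c - t₂) →
      G.lower e ≤ z.1.2.1 e + t₁ →
      (δ ≤ t₂ - t₁ ∨ ∃ n : ℕ, G.upper e = n ∧ δ * (n - z.1.2.1 e) ≤ t₂ - t₁) →
      ∀ s', G.succ z.1.1 {e} s' ≠ 0 → ∀ Y : Set G.Config, (∀ t ∈ Icc t₁ t₂, ∀ z' : G.Config,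
        z'.1 = (s', G.nextVal z.1.1 z.1.2.1 {e} t s', t) → z' ∈ Y) → ε ≤ G.step z Y := by
  obtain ⟨κ, hκ, h⟩ := G.exists_le_lintegral_winVar K hδ
  obtain ⟨σ, hσ, hs⟩ := G.exists_le_succ
  refine ⟨σ * ENNReal.ofReal κ, ENNReal.mul_pos hσ.ne' (ENNReal.ofReal_pos.2 hκ).ne', ?_⟩
  intro z e he t₁ t₂ h0 h12 hf hc hl hlen s' hs' Y hY
  refine le_trans (mul_le_mul' ?_ (h z e he t₁ t₂ h0 h12 hc hl hlen))
    (G.le_step_of_winVar z he (measurableSet_Icc (a := t₁) (b := t₂)) (fun t ht =>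
      ⟨h0.trans ht.1, fun f hff => ht.2.trans_lt (hf f hff)⟩) {s'} (Y := Y) ?_)
  · refine (hs _ _ _ hs').trans (Finset.single_le_sum (f := fun x => G.succ z.1.1 {e} x)
      (fun _ _ => zero_le) ?_)
    simp
  · rintro t ht s'' rfl - z' hz'
    exact hY t ht z' hz'

/-- Remaining times are at most `G.bound`, so an absolute margin is also a relative one. -/
theorem rel_of_abs {e : Ev} {δ a x : ℝ} (hδ : 0 < δ) (ha : 0 ≤ a) {n : ℕ} (hn : G.upper e = n)
    (h : δ ≤ x) : δ / (G.bound + 1) * (n - a) ≤ x := by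
  have hb : (n : ℝ) ≤ G.bound := by exact_mod_cast G.upper_le_bound hn
  have hB : (0 : ℝ) < G.bound + 1 := by positivity
  calc δ / (G.bound + 1) * (n - a) ≤ δ / (G.bound + 1) * (G.bound + 1) := by
        gcongr; linarith
    _ = δ := by field_simp
    _ ≤ x := h

theorem exists_le_step_of_window (K : ℝ) {δ : ℝ} (hδ : 0 < δ) :
    ∃ ε : ENNReal, 0 < ε ∧ ∀ (z : G.Config), ∀ e ∈ G.varSched z.1.1, ∀ (t₁ t₂ : ℝ),
      0 ≤ t₁ → δ ≤ t₂ - t₁ →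
      (∀ c ∈ G.varSched z.1.1, z.1.2.1 c + t₂ ≤ K) →
      (∀ c ∈ G.sched z.1.1, ∀ n : ℕ, G.upper c = n → δ ≤ n - z.1.2.1 c - t₂) →
      G.lower e ≤ z.1.2.1 e + t₁ →
      ∀ s', G.succ z.1.1 {e} s' ≠ 0 → ∀ Y : Set G.Config, (∀ t ∈ Icc t₁ t₂, ∀ z' : G.Config,
        z'.1 = (s', G.nextVal z.1.1 z.1.2.1 {e} t s', t) → z' ∈ Y) → ε ≤ G.step z Y := by
  have hB : (0 : ℝ) < G.bound + 1 := by positivity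
  obtain ⟨ε, hε, h⟩ := G.exists_le_step_of_window_rel K (δ := δ / (G.bound + 1)) (by positivity)
  refine ⟨ε, hε, fun z e he t₁ t₂ h0 h12 hK hc hl => ?_⟩
  refine h z e he t₁ t₂ h0 (by linarith) (fun f hf => ?_) (fun c hcv => ⟨hK c hcv, fun n hn => ?_⟩)
    hl (Or.inl ?_)
  · obtain ⟨hfs, hfu⟩ := mem_fixSched.1 hf
    have := hc f hfs _ hfu.symm
    linarith
  · have hcs := (mem_varSched.1 hcv).1
    exact G.rel_of_abs hδ (z.2.2.1 c hcs).1 hn (hc c hcs n hn)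
  · refine le_trans ?_ h12
    exact div_le_self hδ.le (by linarith [(Nat.cast_nonneg G.bound : (0:ℝ) ≤ _)])

theorem exists_le_step_of_fixed_rel (K : ℝ) {δ : ℝ} (hδ : 0 < δ) :
    ∃ ε : ENNReal, 0 < ε ∧ ∀ (z : G.Config) (hf : (G.fixSched z.1.1).Nonempty),
      (∀ c ∈ G.varSched z.1.1, z.1.2.1 c + G.firstFixedTime z.1.1 z.1.2.1 hf ≤ K ∧
        ∀ n : ℕ, G.upper c = n →
          δ * (n - z.1.2.1 c) ≤ n - z.1.2.1 c - G.firstFixedTime z.1.1 z.1.2.1 hf) →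
      ∀ s', G.succ z.1.1 (G.firstFixed z.1.1 z.1.2.1) s' ≠ 0 → ∀ Y : Set G.Config,
        (∀ z' : G.Config, z'.1 = (s', G.nextVal z.1.1 z.1.2.1 (G.firstFixed z.1.1 z.1.2.1)
          (G.firstFixedTime z.1.1 z.1.2.1 hf) s', G.firstFixedTime z.1.1 z.1.2.1 hf) → z' ∈ Y) →
        ε ≤ G.step z Y := by
  obtain ⟨κ, hκ, h⟩ := G.exists_le_winFix K hδ
  obtain ⟨σ, hσ, hs⟩ := G.exists_le_succ
  refine ⟨σ * ENNReal.ofReal κ, ENNReal.mul_pos hσ.ne' (ENNReal.ofReal_pos.2 hκ).ne', ?_⟩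
  intro z hf hc s' hs' Y hY
  refine le_trans (mul_le_mul' ?_ (ENNReal.ofReal_le_ofReal
    (h z _ (G.firstFixedTime_nonneg z hf) hc))) (G.le_step_of_winFix z hf {s'} (Y := Y) ?_)
  · refine (hs _ _ _ hs').trans (Finset.single_le_sum
      (f := fun x => G.succ z.1.1 (G.firstFixed z.1.1 z.1.2.1) x) (fun _ _ => zero_le) ?_)
    simp
  · rintro s'' rfl - z' hz'
    exact hY z' hz'

theorem exists_le_step_of_fixed (K : ℝ) {δ : ℝ} (hδ : 0 < δ) :
    ∃ ε : ENNReal, 0 < ε ∧ ∀ (z : G.Config) (hf : (G.fixSched z.1.1).Nonempty),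
      (∀ c ∈ G.varSched z.1.1, z.1.2.1 c + G.firstFixedTime z.1.1 z.1.2.1 hf ≤ K) →
      (∀ c ∈ G.varSched z.1.1, ∀ n : ℕ, G.upper c = n →
        δ ≤ n - z.1.2.1 c - G.firstFixedTime z.1.1 z.1.2.1 hf) →
      ∀ s', G.succ z.1.1 (G.firstFixed z.1.1 z.1.2.1) s' ≠ 0 → ∀ Y : Set G.Config,
        (∀ z' : G.Config, z'.1 = (s', G.nextVal z.1.1 z.1.2.1 (G.firstFixed z.1.1 z.1.2.1)
          (G.firstFixedTime z.1.1 z.1.2.1 hf) s', G.firstFixedTime z.1.1 z.1.2.1 hf) → z' ∈ Y) →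
        ε ≤ G.step z Y := by
  have hB : (0 : ℝ) < G.bound + 1 := by positivity
  obtain ⟨ε, hε, h⟩ := G.exists_le_step_of_fixed_rel K (δ := δ / (G.bound + 1)) (by positivity)
  refine ⟨ε, hε, fun z hf hK hc => h z hf fun c hcv => ⟨hK c hcv, fun n hn => ?_⟩⟩
  exact G.rel_of_abs hδ (z.2.2.1 c (mem_varSched.1 hcv).1).1 hn (hc c hcv n hn)

theorem add_le_upper_of_winVar_ne_zero (z : G.Config) {e : Ev} {t : ℝ}
    (ht : t ∈ G.raceWindow z.1.1 z.1.2.1) (he : e ∈ G.varSched z.1.1)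
    (hw : G.winVar z.1.1 z.1.2.1 e t ≠ 0) {c : Ev} (hc : c ∈ G.sched z.1.1) {n : ℕ}
    (hn : G.upper c = n) : z.1.2.1 c + t ≤ n := by
  rcases (G.lower_le_upper c).eq_or_lt with hl | hl
  · have := ht.2 c (mem_fixSched.2 ⟨hc, hl⟩)
    have hln : G.lower c = n := by
      rw [hn] at hl
      exact_mod_cast hl
    rw [hln] at this
    linarith
  · by_contra hcon
    apply hw
    unfold winVar
    by_cases hce : c = e
    · subst hce
      unfold condDens
      rw [if_pos ht.1, G.dens_zero c hl, zero_div, zero_mul]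
      intro hmem
      have := hmem.2 n hn
      linarith
    · rw [Finset.prod_eq_zero (Finset.mem_erase.2 ⟨hce, mem_varSched.2 ⟨hc, hl⟩⟩)
        (G.surv_eq_zero hl hn (not_le.1 hcon).le), mul_zero]

theorem lower_le_of_winVar_ne_zero {s : S} {ν : Ev → ℝ} {e : Ev} {t : ℝ} (he : e ∈ G.varSched s)
    (hw : G.winVar s ν e t ≠ 0) : G.lower e ≤ ν e + t := by
  by_contra hcon
  apply hw
  unfold winVar condDens
  split_ifs
  · rw [G.dens_zero e (mem_varSched.1 he).2, zero_div, zero_mul]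
    intro hmem
    have := hmem.1
    linarith
  · rw [zero_mul]

theorem add_lt_upper_of_winFix_ne_zero {s : S} {ν : Ev → ℝ} {t : ℝ}
    (hw : G.winFix s ν t ≠ 0) {c : Ev} (hc : c ∈ G.varSched s) {n : ℕ}
    (hn : G.upper c = n) : ν c + t < n := by
  by_contra hcon
  apply hw
  unfold winFix
  exact Finset.prod_eq_zero hc (G.surv_eq_zero (mem_varSched.1 hc).2 hn (not_lt.1 hcon))

end GSMP

namespace GSMP

/-! ### Difference constraints -/

/-- The difference of `x` and `y` is an integer or has distance at least `δ` to the integers. -/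
def Good (δ x y : ℝ) : Prop := ∀ k : ℤ, x - y = k ∨ δ ≤ |x - y - k|

theorem Good.mono {δ δ' x y : ℝ} (h : Good δ x y) (hδ : δ' ≤ δ) : Good δ' x y := fun k =>
  (h k).imp id hδ.trans

theorem Good.symm {δ x y : ℝ} (h : Good δ x y) : Good δ y x := by
  intro k
  rcases h (-k) with h1 | h1
  · left
    push_cast at h1
    linarith
  · right
    rw [show y - x - k = -(x - y - (-k : ℤ)) by push_cast; ring, abs_neg]
    exact h1

theorem good_self {δ : ℝ} (hδ : δ ≤ 1) (x : ℝ) : Good δ x x := by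
  intro k
  rw [sub_self, zero_sub, abs_neg]
  rcases eq_or_ne k 0 with rfl | hk
  · simp
  · right
    have : (1 : ℤ) ≤ |k| := Int.one_le_abs hk
    exact hδ.trans (by exact_mod_cast this)

theorem Good.le_of_lt {δ x y : ℝ} (h : Good δ x y) {k : ℤ} (hk : x - y < k) : δ ≤ k - (x - y) := by
  rcases h k with h1 | h1
  · exact absurd h1 hk.ne
  · rw [abs_of_neg (by linarith)] at h1
    linarith

theorem Good.add_right {δ x y t : ℝ} (h : Good δ x y) : Good δ (x + t) (y + t) := by
  intro k
  rw [show x + t - (y + t) = x - y by ring]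
  exact h k

/-- `x - y` and `x' - y'` satisfy the same integral bounds. -/
def SameDiff (x y x' y' : ℝ) : Prop := ∀ k : ℤ, x - y < k ↔ x' - y' < k

/-- Whether `a - b < k` holds is decided by the integral parts, and in the case of equality by
comparing the fractional parts. -/
theorem sameDiff_of_fract {x y x' y' : ℝ} (hx : ⌊x⌋ = ⌊x'⌋) (hy : ⌊y⌋ = ⌊y'⌋)
    (h : Int.fract y ≤ Int.fract x ↔ Int.fract y' ≤ Int.fract x') : SameDiff x y x' y' := by
  have key : ∀ (a b : ℝ) (k : ℤ), a - b < k ↔ ⌊a⌋ - ⌊b⌋ < k ∨ (⌊a⌋ - ⌊b⌋ = k ∧ Int.fract a < Int.fract b) := by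
    intro a b k
    have ha := Int.floor_add_fract a
    have hb := Int.floor_add_fract b
    have ha0 := Int.fract_nonneg a
    have ha1 := Int.fract_lt_one a
    have hb0 := Int.fract_nonneg b
    have hb1 := Int.fract_lt_one b
    rcases lt_trichotomy (⌊a⌋ - ⌊b⌋) k with h | h | h
    · have h' : (⌊a⌋ : ℝ) - ⌊b⌋ + 1 ≤ k := by exact_mod_cast h
      exact ⟨fun _ => Or.inl h, fun _ => by linarith⟩
    · have h' : (⌊a⌋ : ℝ) - ⌊b⌋ = k := by exact_mod_cast h
      simp only [h, lt_irrefl, false_or, true_and]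
      constructor <;> intro <;> linarith
    · have h' : (k : ℝ) + 1 ≤ (⌊a⌋ : ℝ) - ⌊b⌋ := by exact_mod_cast h
      constructor
      · intro; linarith
      · rintro (h2 | h2)
        · omega
        · omega
  have h' : Int.fract x < Int.fract y ↔ Int.fract x' < Int.fract y' := by
    rw [← not_le, ← not_le, h]
  intro k
  rw [key, key, hx, hy, h']

theorem floor_eq_of_sameDiff {x x' : ℝ} (h : SameDiff x 0 x' 0) : ⌊x⌋ = ⌊x'⌋ := by
  have h' : ∀ k : ℤ, ⌊x⌋ < k ↔ ⌊x'⌋ < k := fun k => by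
    have := h k
    rw [sub_zero, sub_zero] at this
    rw [Int.floor_lt, Int.floor_lt, this]
  have h1 := (h' (⌊x⌋ + 1)).1 (by omega)
  have h2 := (h' (⌊x'⌋ + 1)).2 (by omega)
  omega

theorem fract_le_iff_of_sameDiff {x y x' y' : ℝ} (hx : ⌊x⌋ = ⌊x'⌋) (hy : ⌊y⌋ = ⌊y'⌋)
    (h : SameDiff x y x' y') : Int.fract y ≤ Int.fract x ↔ Int.fract y' ≤ Int.fract x' := by
  have h1 := h (⌊x⌋ - ⌊y⌋)
  have e1 := Int.floor_add_fract x
  have e2 := Int.floor_add_fract y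
  have e3 := Int.floor_add_fract x'
  have e4 := Int.floor_add_fract y'
  rw [← hx] at e3
  rw [← hy] at e4
  push_cast at h1
  rw [← not_lt, ← not_lt, not_iff_not]
  constructor <;> intro h2
  · have := h1.1 (by linarith)
    linarith
  · have := h1.2 (by linarith)
    linarith

theorem fract_le_zero_iff (x : ℝ) : Int.fract x ≤ 0 ↔ Int.fract x = 0 :=
  ⟨fun h => le_antisymm h (Int.fract_nonneg x), fun h => h.le⟩

set_option linter.unusedSectionVars false

variable {S Ev : Type*} [Fintype S] [Fintype Ev] [DecidableEq Ev] (G : GSMP S Ev)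

/-- the clock of an event, and the constant clock `0` -/
def clk (ν : Ev → ℝ) (o : Option Ev) : ℝ := o.elim 0 ν

/-- the zero clock and the clocks of scheduled events that do not exceed the bound -/
def Active (z : G.Config) (o : Option Ev) : Prop :=
  ∀ e ∈ o, e ∈ G.sched z.1.1 ∧ z.1.2.1 e ≤ G.bound

theorem active_none (z : G.Config) : G.Active z none := fun e he => by simp at he

theorem active_some {z : G.Config} {e : Ev} :
    G.Active z (some e) ↔ e ∈ G.sched z.1.1 ∧ z.1.2.1 e ≤ G.bound := by
  simp [Active]

/-- Regions as zones: a region is given by the state, the set of clocks up to the bound, and the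
integer constraints on differences of active clocks. The constant clock `none` turns constraints on
single clocks into differences. This form is stable under the passage of time, which shifts all
event clocks alike. -/
theorem regionRel_iff {z₁ z₂ : G.Config} : G.RegionRel z₁ z₂ ↔ z₁.1.1 = z₂.1.1 ∧
    (∀ e ∈ G.sched z₁.1.1, z₁.1.2.1 e ≤ G.bound ↔ z₂.1.2.1 e ≤ G.bound) ∧
    ∀ x y, G.Active z₁ x → G.Active z₁ y →
      SameDiff (clk z₁.1.2.1 x) (clk z₁.1.2.1 y) (clk z₂.1.2.1 x) (clk z₂.1.2.1 y) := by
  constructor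
  · rintro ⟨h1, h2, h3⟩
    have hle : ∀ e ∈ G.sched z₁.1.1, z₁.1.2.1 e ≤ G.bound ↔ z₂.1.2.1 e ≤ G.bound := by
      intro e he
      rcases h2 e he with h | h
      · exact ⟨h.le, h.symm.le⟩
      · exact ⟨fun hb => absurd hb (not_le.2 h.1), fun hb => absurd hb (not_le.2 h.2)⟩
    have hag : ∀ e ∈ G.sched z₁.1.1, z₁.1.2.1 e ≤ G.bound →
        AgreeInt (z₁.1.2.1 e) (z₂.1.2.1 e) := by
      intro e he hb
      rcases h2 e he with h | h
      · exact h
      · exact absurd hb (not_le.2 h.1)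
    refine ⟨h1, hle, ?_⟩
    have hfl : ∀ x, G.Active z₁ x → ⌊clk z₁.1.2.1 x⌋ = ⌊clk z₂.1.2.1 x⌋ := by
      rintro (_ | e) he
      · rfl
      · obtain ⟨he, hb⟩ := (G.active_some).1 he
        exact (hag e he hb).1
    intro x y hx hy
    refine sameDiff_of_fract (hfl x hx) (hfl y hy) ?_
    rcases x with _ | e <;> rcases y with _ | f
    · rfl
    · obtain ⟨hf, hfb⟩ := (G.active_some).1 hy
      simp only [clk, Option.elim, Int.fract_zero, fract_le_zero_iff]
      exact (hag f hf hfb).2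
    · simp [clk, Option.elim, Int.fract_nonneg]
    · obtain ⟨he, heb⟩ := (G.active_some).1 hx
      obtain ⟨hf, hfb⟩ := (G.active_some).1 hy
      exact h3 f hf e he hfb heb
  · rintro ⟨h1, h2, h3⟩
    have hfl : ∀ e ∈ G.sched z₁.1.1, z₁.1.2.1 e ≤ G.bound → ⌊z₁.1.2.1 e⌋ = ⌊z₂.1.2.1 e⌋ :=
      fun e he hb => floor_eq_of_sameDiff
        (h3 (some e) none (G.active_some.2 ⟨he, hb⟩) (G.active_none _))
    refine ⟨h1, fun e he => ?_, fun e he f hf heb hfb => ?_⟩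
    · by_cases hb : z₁.1.2.1 e ≤ G.bound
      · refine Or.inl ⟨hfl e he hb, ?_⟩
        have := fract_le_iff_of_sameDiff rfl (hfl e he hb)
          (h3 none (some e) (G.active_none _) (G.active_some.2 ⟨he, hb⟩))
        simpa only [clk, Option.elim, Int.fract_zero, fract_le_zero_iff] using this
      · exact Or.inr ⟨not_le.1 hb, not_le.1 fun h => hb ((h2 e he).2 h)⟩
    · exact fract_le_iff_of_sameDiff (hfl f hf hfb) (hfl e he heb)
        (h3 (some f) (some e) (G.active_some.2 ⟨hf, hfb⟩) (G.active_some.2 ⟨he, heb⟩))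

theorem nextVal_of_inherited {s s' : S} {ν : Ev → ℝ} {E : Finset Ev} {t : ℝ} {e : Ev}
    (h : e ∈ G.sched s' ∧ e ∈ G.sched s ∧ e ∉ E) : G.nextVal s ν E t s' e = ν e + t := if_pos h

theorem nextVal_of_not_inherited {s s' : S} {ν : Ev → ℝ} {E : Finset Ev} {t : ℝ} {e : Ev}
    (h : ¬ (e ∈ G.sched s' ∧ e ∈ G.sched s ∧ e ∉ E)) : G.nextVal s ν E t s' e = 0 := if_neg h

/-- A clock after a step is either reset or comes from a clock before the step. -/
theorem clk_next {z z' : G.Config} {E : Finset Ev} {t : ℝ} {s' : S}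
    (hz' : z'.1 = (s', G.nextVal z.1.1 z.1.2.1 E t s', t)) {o : Option Ev} (ho : G.Active z' o) :
    clk z'.1.2.1 o = 0 ∨ ∃ c, o = some c ∧ c ∈ G.sched s' ∧ c ∈ G.sched z.1.1 ∧ c ∉ E ∧
      z'.1.2.1 c = z.1.2.1 c + t ∧ z.1.2.1 c + t ≤ G.bound := by
  rcases o with _ | c
  · exact Or.inl rfl
  · obtain ⟨-, hb⟩ := (G.active_some).1 ho
    have hv : z'.1.2.1 c = G.nextVal z.1.1 z.1.2.1 E t s' c := by rw [hz']
    by_cases h : c ∈ G.sched s' ∧ c ∈ G.sched z.1.1 ∧ c ∉ E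
    · rw [G.nextVal_of_inherited h] at hv
      exact Or.inr ⟨c, rfl, h.1, h.2.1, h.2.2, hv, hv ▸ hb⟩
    · rw [G.nextVal_of_not_inherited h] at hv
      exact Or.inl hv

/-- Differences of two inherited clocks do not change, so only the position of the inherited clocks
relative to the integers up to the bound has to be compared, which is the hypothesis `hk`. -/
theorem regionRel_next {z₀ z z₀' z' : G.Config} (h : G.RegionRel z₀ z) {E : Finset Ev}
    {t₀ t : ℝ} {s' : S} (ht₀ : 0 ≤ t₀) (hz₀' : z₀'.1 = (s', G.nextVal z₀.1.1 z₀.1.2.1 E t₀ s', t₀))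
    (hz' : z'.1 = (s', G.nextVal z.1.1 z.1.2.1 E t s', t))
    (hk : ∀ c ∈ G.sched z₀.1.1, c ∉ E → ∀ k : ℤ, k ≤ G.bound →
      (z₀.1.2.1 c + t₀ < k ↔ z.1.2.1 c + t < k) ∧ (k < z₀.1.2.1 c + t₀ ↔ k < z.1.2.1 c + t)) :
    G.RegionRel z₀' z' := by
  obtain ⟨hs, hb, hd⟩ := (G.regionRel_iff).1 h
  have hv₀ : ∀ c, z₀'.1.2.1 c = G.nextVal z₀.1.1 z₀.1.2.1 E t₀ s' c := fun c => by rw [hz₀']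
  have hv : ∀ c, z'.1.2.1 c = G.nextVal z₀.1.1 z.1.2.1 E t s' c := fun c => by rw [hz', hs]
  have hs₀' : z₀'.1.1 = s' := by rw [hz₀']
  have hs' : z'.1.1 = s' := by rw [hz']
  have hkB := fun c hc hcE => (hk c hc hcE (G.bound : ℤ) le_rfl).2
  simp only [Int.cast_natCast] at hkB
  refine (G.regionRel_iff).2 ⟨by rw [hs₀', hs'], ?_, ?_⟩
  · intro c hc
    rw [hv₀, hv]
    by_cases h1 : c ∈ G.sched s' ∧ c ∈ G.sched z₀.1.1 ∧ c ∉ E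
    · rw [G.nextVal_of_inherited h1, G.nextVal_of_inherited h1, ← not_lt, ← not_lt,
        hkB c h1.2.1 h1.2.2]
    · rw [G.nextVal_of_not_inherited h1, G.nextVal_of_not_inherited h1]
  · have hcl : ∀ x, G.Active z₀' x → (clk z₀'.1.2.1 x = 0 ∧ clk z'.1.2.1 x = 0) ∨
        ∃ c ∈ G.sched z₀.1.1, c ∉ E ∧ z₀.1.2.1 c + t₀ ≤ G.bound ∧
          clk z₀'.1.2.1 x = z₀.1.2.1 c + t₀ ∧ clk z'.1.2.1 x = z.1.2.1 c + t := by
      rintro (_ | c) hx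
      · exact Or.inl ⟨rfl, rfl⟩
      · obtain ⟨-, hcb⟩ := (G.active_some).1 hx
        show (z₀'.1.2.1 c = 0 ∧ z'.1.2.1 c = 0) ∨ ∃ d ∈ G.sched z₀.1.1, d ∉ E ∧ _ ∧
          z₀'.1.2.1 c = _ ∧ z'.1.2.1 c = _
        rw [hv₀] at hcb
        rw [hv₀, hv]
        by_cases h1 : c ∈ G.sched s' ∧ c ∈ G.sched z₀.1.1 ∧ c ∉ E
        · rw [G.nextVal_of_inherited h1] at hcb
          rw [G.nextVal_of_inherited h1, G.nextVal_of_inherited h1]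
          exact Or.inr ⟨c, h1.2.1, h1.2.2, hcb, rfl, rfl⟩
        · rw [G.nextVal_of_not_inherited h1, G.nextVal_of_not_inherited h1]
          exact Or.inl ⟨rfl, rfl⟩
    have hlt : ∀ c ∈ G.sched z₀.1.1, c ∉ E → z₀.1.2.1 c + t₀ ≤ G.bound → ∀ k : ℤ,
        (z₀.1.2.1 c + t₀ < k ↔ z.1.2.1 c + t < k) ∧
        (k < z₀.1.2.1 c + t₀ ↔ k < z.1.2.1 c + t) := by
      intro c hc hcE hcb k
      rcases le_or_gt k (G.bound : ℤ) with hkb | hkb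
      · exact hk c hc hcE k hkb
      -- Integers beyond the bound lie above both clocks, so the hypothesis `hk` is needed only up
      -- to the bound.
      · have h1 : (G.bound : ℝ) < k := by exact_mod_cast hkb
        have h2 : z.1.2.1 c + t ≤ G.bound := by
          rw [← not_lt, ← hkB c hc hcE, not_lt]
          exact hcb
        constructor <;> constructor <;> intro <;> linarith
    intro x y hx hy k
    rcases hcl x hx with ⟨hx0, hx1⟩ | ⟨c, hc, hcE, hcb, hx0, hx1⟩ <;>
    rcases hcl y hy with ⟨hy0, hy1⟩ | ⟨d, hdd, hdE, hdb, hy0, hy1⟩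
    · rw [hx0, hx1, hy0, hy1]
    · have := (hlt d hdd hdE hdb (-k)).2
      push_cast at this
      rw [hx0, hx1, hy0, hy1, zero_sub, zero_sub, neg_lt, this, neg_lt]
    · have := (hlt c hc hcE hcb k).1
      rw [hx0, hx1, hy0, hy1, sub_zero, sub_zero, this]
    · rw [hx0, hx1, hy0, hy1, add_sub_add_right_eq_sub, add_sub_add_right_eq_sub]
      exact hd (some c) (some d) (G.active_some.2 ⟨hc, by linarith⟩)
        (G.active_some.2 ⟨hdd, by linarith⟩) k

/-- All differences of active clocks are integral or at distance at least `δ` to the integers. -/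
def Sep (δ : ℝ) (z : G.Config) : Prop :=
  ∀ x y, G.Active z x → G.Active z y → Good δ (clk z.1.2.1 x) (clk z.1.2.1 y)

variable {G} in
theorem Sep.mono {δ δ' : ℝ} {z : G.Config} (h : G.Sep δ z) (hδ : δ' ≤ δ) : G.Sep δ' z :=
  fun x y hx hy => (h x y hx hy).mono hδ

variable {G} in
theorem Sep.good {δ : ℝ} {z : G.Config} (h : G.Sep δ z) : ∀ c ∈ G.sched z.1.1, ∀ d ∈ G.sched z.1.1,
    z.1.2.1 c ≤ G.bound → z.1.2.1 d ≤ G.bound → Good δ (z.1.2.1 c) (z.1.2.1 d) :=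
  fun c hc d hd hcb hdb => h (some c) (some d) (G.active_some.2 ⟨hc, hcb⟩)
    (G.active_some.2 ⟨hd, hdb⟩)

/-- Pairs of inherited clocks keep their differences, and a reset clock equals the zero clock. Hence
only the distances of inherited clocks to the integers are new. -/
theorem sep_next {z z' : G.Config} {δ : ℝ} (hδ : δ ≤ 1)
    (hpair : ∀ c ∈ G.sched z.1.1, ∀ d ∈ G.sched z.1.1,
      z.1.2.1 c ≤ G.bound → z.1.2.1 d ≤ G.bound → Good δ (z.1.2.1 c) (z.1.2.1 d)) {E : Finset Ev} {t : ℝ}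
    {s' : S} (ht : 0 ≤ t) (hz' : z'.1 = (s', G.nextVal z.1.1 z.1.2.1 E t s', t))
    (h : ∀ c ∈ G.sched z.1.1, c ∉ E → z.1.2.1 c + t ≤ G.bound → Good δ (z.1.2.1 c + t) 0) :
    G.Sep δ z' := by
  intro x y hx hy
  rcases G.clk_next hz' hx with hx0 | ⟨c, rfl, -, hc, hcE, hcv, hcb⟩ <;>
  rcases G.clk_next hz' hy with hy0 | ⟨d, rfl, -, hd, hdE, hdv, hdb⟩
  · rw [hx0, hy0]
    exact good_self hδ 0
  · rw [hx0, show clk z'.1.2.1 (some d) = z'.1.2.1 d from rfl, hdv]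
    exact (h d hd hdE hdb).symm
  · rw [hy0, show clk z'.1.2.1 (some c) = z'.1.2.1 c from rfl, hcv]
    exact h c hc hcE hcb
  · rw [show clk z'.1.2.1 (some c) = z'.1.2.1 c from rfl, hcv,
      show clk z'.1.2.1 (some d) = z'.1.2.1 d from rfl, hdv]
    exact (hpair c hc d hd (by linarith) (by linarith)).add_right

theorem ageLe_next {z z' : G.Config} {K t : ℝ} (hK : 0 ≤ K) (hz : G.AgeLe K z) {E : Finset Ev} {s' : S}
    (ht : 0 ≤ t) (hz' : z'.1 = (s', G.nextVal z.1.1 z.1.2.1 E t s', t)) : G.AgeLe (K + t) z' := by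
  intro c _
  have hv : z'.1.2.1 c = G.nextVal z.1.1 z.1.2.1 E t s' c := by rw [hz']
  rw [hv]
  by_cases h : c ∈ G.sched s' ∧ c ∈ G.sched z.1.1 ∧ c ∉ E
  · rw [G.nextVal_of_inherited h]
    linarith [hz c h.2.1]
  · rw [G.nextVal_of_not_inherited h]
    linarith

end GSMP

/-! ### Following an edge of the region graph with uniform probability. -/

namespace GSMP

set_option linter.unusedSectionVars false

variable {S Ev : Type*} [Fintype S] [Fintype Ev] [DecidableEq Ev] (G : GSMP S Ev)

theorem good_zero_of_gap {δ x : ℝ} {B : ℕ} (hδ : δ ≤ 1) (h0 : 0 ≤ x) (hB : x ≤ B)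
    (h : ∀ k : ℤ, 0 ≤ k → k ≤ B → x ≠ k → δ ≤ |x - k|) : Good δ x 0 := by
  intro k
  rw [sub_zero]
  by_cases hxk : x = k
  · exact Or.inl hxk
  refine Or.inr ?_
  rcases lt_or_ge k 0 with hk | hk
  · have : (k : ℝ) ≤ -1 := by exact_mod_cast (by omega : k ≤ -1)
    exact le_trans (by linarith) (le_abs_self _)
  rcases le_or_gt k (B : ℤ) with hk' | hk'
  · exact h k hk hk' hxk
  · have : (B : ℝ) + 1 ≤ k := by exact_mod_cast hk'
    exact le_trans (by linarith) (neg_abs_le _ |> neg_le_neg |>.trans_eq (neg_neg _))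

variable [MeasurableSpace S] [DiscreteMeasurableSpace S]

theorem clk_nonneg (z : G.Config) {o : Option Ev} (ho : G.Active z o) : 0 ≤ clk z.1.2.1 o := by
  rcases o with _ | e
  · exact le_rfl
  · exact (z.2.2.1 e ((G.active_some).1 ho).1).1

theorem measurableSet_regionOf (R : G.Region) :
    MeasurableSet {z : G.Config | G.regionOf z = R} := by
  obtain ⟨z₁, rfl⟩ : ∃ z₁, G.regionOf z₁ = R := Quotient.exists_rep R
  have h1 : {z : G.Config | G.regionOf z = G.regionOf z₁} = {z | G.RegionRel z z₁} := by
    ext z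
    exact ⟨fun h => Quotient.exact h, fun h => Quotient.sound h⟩
  rw [h1]
  have key : Measurable fun z : S × (Ev → ℝ) × ℝ => z.1 = z₁.1.1 ∧
      (∀ e ∈ G.sched z.1, AgreeInt (z.2.1 e) (z₁.1.2.1 e) ∨
        ((G.bound : ℝ) < z.2.1 e ∧ (G.bound : ℝ) < z₁.1.2.1 e)) ∧
      ∀ e ∈ G.sched z.1, ∀ f ∈ G.sched z.1, z.2.1 e ≤ G.bound → z.2.1 f ≤ G.bound →
        (Int.fract (z.2.1 e) ≤ Int.fract (z.2.1 f) ↔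
          Int.fract (z₁.1.2.1 e) ≤ Int.fract (z₁.1.2.1 f)) := by
    refine measurable_from_prod_countable_right fun s => ?_
    dsimp only
    have hc : ∀ e : Ev, Measurable fun y : (Ev → ℝ) × ℝ => y.1 e := fun e =>
      (measurable_pi_apply e).comp measurable_fst
    have hfr : ∀ e : Ev, Measurable fun y : (Ev → ℝ) × ℝ => Int.fract (y.1 e) := fun e =>
      (hc e).fract
    refine Measurable.and measurable_const (Measurable.and ?_ ?_)
    · refine Measurable.forall fun e => Measurable.imp measurable_const (Measurable.or ?_ ?_)
      · refine Measurable.and ?_ (Measurable.iff ?_ measurable_const)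
        · exact measurableSet_setOfPred.1 (measurableSet_eq_fun (hc e).floor measurable_const)
        · exact measurableSet_setOfPred.1 (measurableSet_eq_fun (hfr e) measurable_const)
      · exact Measurable.and (measurableSet_setOfPred.1 (measurableSet_lt measurable_const (hc e)))
          measurable_const
    · refine Measurable.forall fun e => Measurable.imp measurable_const
        (Measurable.forall fun f => Measurable.imp measurable_const (Measurable.imp ?_
          (Measurable.imp ?_ (Measurable.iff ?_ measurable_const))))
      · exact measurableSet_setOfPred.1 (measurableSet_le (hc e) measurable_const)
      · exact measurableSet_setOfPred.1 (measurableSet_le (hc f) measurable_const)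
      · exact measurableSet_setOfPred.1 (measurableSet_le (hfr e) (hfr f))
  exact measurableSet_setOfPred.2 (key.comp measurable_subtype_coe)

theorem active_congr {z₀ z : G.Config} (h : G.RegionRel z₀ z) (x : Option Ev) :
    G.Active z₀ x ↔ G.Active z x := by
  obtain ⟨hs, hb, -⟩ := (G.regionRel_iff).1 h
  rcases x with _ | e
  · exact iff_of_true (G.active_none _) (G.active_none _)
  · rw [active_some, active_some, ← hs]
    exact and_congr_right fun he => hb e he

theorem firstFixed_congr {z₀ z : G.Config} (h : G.RegionRel z₀ z) :
    G.firstFixed z₀.1.1 z₀.1.2.1 = G.firstFixed z.1.1 z.1.2.1 := by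
  obtain ⟨hs, hb, hd⟩ := (G.regionRel_iff).1 h
  have hact : ∀ f ∈ G.fixSched z₀.1.1, G.Active z₀ (some f) := by
    intro f hf
    obtain ⟨hfs, hfu⟩ := mem_fixSched.1 hf
    refine (G.active_some).2 ⟨hfs, ?_⟩
    have h1 := (z₀.2.2.1 f hfs).2 _ hfu.symm
    have h2 : (G.lower f : ℝ) ≤ G.bound := by exact_mod_cast G.lower_le_bound f
    linarith
  unfold firstFixed
  rw [← hs]
  refine Finset.filter_congr fun f hf => forall₂_congr fun g hg => ?_
  have := hd (some f) (some g) (hact f hf) (hact g hg) (G.lower f - G.lower g)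
  simp only [clk, Option.elim] at this
  push_cast at this
  rw [← not_lt, ← not_lt, not_iff_not]
  constructor <;> intro h1
  · have := this.1 (by linarith)
    linarith
  · have := this.2 (by linarith)
    linarith

theorem firstFixedTime_eq {s : S} {ν : Ev → ℝ} (h : (G.fixSched s).Nonempty) {f : Ev}
    (hf : f ∈ G.firstFixed s ν) : G.firstFixedTime s ν h = G.lower f - ν f := by
  linarith [G.add_firstFixedTime_of_mem h hf]

/-- The edge has one witness `z₀`, and the step is imitated from every separated `z` in the same
region. If fixed-delay events win, the time of the step is a difference to a clock, so the outcome
lies in `R'` by the difference constraints. If a variable-delay event wins, the order in which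
clocks pass integers is the same for `z` and `z₀`, and separation leaves a window of length `δ` at
the right place in this order. -/
theorem exists_le_step_region {R R' : G.Region} (hE : G.RegionEdge R R') {δ : ℝ} (hδ : 0 < δ)
    (hδ1 : δ ≤ 1) {K : ℝ} (hK : 0 ≤ K) :
    ∃ ε : ENNReal, 0 < ε ∧ ∀ z : G.Config, G.regionOf z = R → G.Sep δ z → G.AgeLe K z →
      ε ≤ G.step z {z' | G.regionOf z' = R' ∧ G.Sep (δ / 3) z' ∧ G.AgeLe (K + (G.bound + 1)) z'} := by
  obtain ⟨z₀, rfl, hpos⟩ := hE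
  -- The times at which some clock of `z₀` is integral. A winning time outside `D` lies strictly
  -- between two consecutive passages.
  set D : Set ℝ := ⋃ (x : Option Ev) (k : ℤ), {(k : ℝ) - clk z₀.1.2.1 x} with hD
  have hDc : D.Countable := countable_iUnion fun x => countable_iUnion fun k => countable_singleton _
  have hB0 : (0 : ℝ) ≤ G.bound := Nat.cast_nonneg _
  rcases G.exists_of_step_pos z₀ (G.measurableSet_regionOf R') hpos hDc with
    ⟨e, he, t₀, ht₀, htD, hw, s', hs', z₀', hR', hz₀'⟩ | ⟨hf₀, hw, s', hs', z₀', hR', hz₀'⟩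
  · have hgen : ∀ (x : Option Ev) (k : ℤ), clk z₀.1.2.1 x + t₀ < k ∨ k < clk z₀.1.2.1 x + t₀ := by
      intro x k
      refine lt_or_gt_of_ne fun h => htD ?_
      simp only [hD, mem_iUnion, mem_singleton_iff]
      exact ⟨x, k, by linarith⟩
    have ht₀pos : 0 < t₀ := by
      rcases hgen none 0 with h | h <;> simp only [clk, Option.elim, zero_add, Int.cast_zero] at h
      · linarith [ht₀.1]
      · exact h
    obtain ⟨ε, hε, hstep⟩ := G.exists_le_step_of_window (K + (G.bound + 1)) (δ := δ / 3) (by positivity)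
    refine ⟨ε, hε, fun z hzR hsep hage => ?_⟩
    have hrel : G.RegionRel z₀ z := Quotient.exact hzR.symm
    obtain ⟨hs, hb, hd⟩ := (G.regionRel_iff).1 hrel
    have hact := G.active_congr hrel
    classical
    -- The passages of integers by active clocks that precede `t₀` in the race from `z₀`. Including
    -- the zero clock with the integer `0` makes the latest of them, `t₁`, nonnegative.
    let P : Finset (Option Ev × ℤ) := (Finset.univ ×ˢ Finset.Icc 0 (G.bound : ℤ)).filter fun p =>
      G.Active z p.1 ∧ p.2 < clk z₀.1.2.1 p.1 + t₀
    have hmemP : ∀ x k, (x, k) ∈ P ↔ (0 ≤ k ∧ k ≤ (G.bound : ℤ)) ∧ G.Active z x ∧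
        k < clk z₀.1.2.1 x + t₀ := by
      intro x k
      simp [P]
    have hPne : (none, 0) ∈ P := by
      rw [hmemP]
      refine ⟨⟨le_rfl, by positivity⟩, G.active_none z, ?_⟩
      simpa [clk] using ht₀pos
    obtain ⟨⟨y, m⟩, hp, hmax⟩ := P.exists_max_image (fun p => (p.2 : ℝ) - clk z.1.2.1 p.1) ⟨_, hPne⟩
    obtain ⟨⟨hm0, hmB⟩, hy, hym⟩ := (hmemP y m).1 hp
    set t₁ : ℝ := m - clk z.1.2.1 y with ht₁
    have hL : ∀ x, G.Active z x → ∀ k : ℤ, 0 ≤ k → k ≤ (G.bound : ℤ) →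
        k < clk z₀.1.2.1 x + t₀ → k - clk z.1.2.1 x ≤ t₁ := fun x hx k h0 h1 h2 =>
      hmax (x, k) ((hmemP x k).2 ⟨⟨h0, h1⟩, hx, h2⟩)
    -- A passage after `t₀` from `z₀` comes after the passage `t₁` from `z` because of the common
    -- difference constraints, and at least `δ` later because of separation.
    have hU : ∀ x, G.Active z x → ∀ k : ℤ, clk z₀.1.2.1 x + t₀ < k →
        t₁ + δ ≤ k - clk z.1.2.1 x := by
      intro x hx k h2
      have h3 := (hd x y ((hact x).2 hx) ((hact y).2 hy) (k - m)).1 (by push_cast; linarith)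
      have h4 := (hsep x y hx hy).le_of_lt h3
      push_cast at h4
      linarith
    have ht₁0 : 0 ≤ t₁ := by
      have := hmax _ hPne
      simpa [clk] using this
    have ht₁B : t₁ ≤ G.bound := by
      have := G.clk_nonneg z hy
      have : (m : ℝ) ≤ G.bound := by exact_mod_cast hmB
      linarith
    -- Occurring in the middle third of the window keeps all clocks at distance `δ / 3` from their
    -- passages.
    have hdist : ∀ t ∈ Icc (t₁ + δ / 3) (t₁ + 2 * δ / 3), ∀ x, G.Active z x → ∀ k : ℤ, 0 ≤ k →
        k ≤ (G.bound : ℤ) →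
        (clk z₀.1.2.1 x + t₀ < k ∧ clk z.1.2.1 x + t + δ / 3 ≤ k) ∨
        (k < clk z₀.1.2.1 x + t₀ ∧ k + δ / 3 ≤ clk z.1.2.1 x + t) := by
      intro t ht x hx k hk0 hkB
      rcases hgen x k with h | h
      · have := hU x hx k h
        exact Or.inl ⟨h, by linarith [ht.2]⟩
      · have := hL x hx k hk0 hkB h
        exact Or.inr ⟨h, by linarith [ht.1]⟩
    refine hstep z e (hs ▸ he) (t₁ + δ / 3) (t₁ + 2 * δ / 3) (by linarith) (by linarith)
      (fun c hc => ?_) (fun c hc n hn => ?_) ?_ s' (hs ▸ hs') _ fun t ht z' hz' => ?_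
    · linarith [hage c (mem_varSched.1 hc).1]
    · have hnB : (n : ℝ) ≤ G.bound := by exact_mod_cast G.upper_le_bound hn
      have hlt := (z.2.2.1 c hc).2 n hn
      have hcact : G.Active z (some c) := (G.active_some).2 ⟨hc, by linarith⟩
      have h1 := G.add_le_upper_of_winVar_ne_zero z₀ ht₀ he hw (hs ▸ hc) hn
      have h2 := hU (some c) hcact n (by
        rcases hgen (some c) n with h | h
        · exact h
        · simp only [clk, Option.elim, Int.cast_natCast] at h
          linarith)
      simp only [clk, Option.elim, Int.cast_natCast] at h2
      linarith
    · have hes : e ∈ G.sched z.1.1 := hs ▸ (mem_varSched.1 he).1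
      have hlB : (G.lower e : ℝ) ≤ G.bound := by exact_mod_cast G.lower_le_bound e
      by_cases heb : z.1.2.1 e ≤ G.bound
      · have h1 := G.lower_le_of_winVar_ne_zero he hw
        have h2 := hL (some e) ((G.active_some).2 ⟨hes, heb⟩) (G.lower e) (by positivity)
          (by exact_mod_cast G.lower_le_bound e) (by
            rcases hgen (some e) (G.lower e) with h | h
            · simp only [clk, Option.elim, Int.cast_natCast] at h
              linarith
            · exact h)
        simp only [clk, Option.elim, Int.cast_natCast] at h2
        linarith
      · linarith
    · have ht0 : 0 ≤ t := by linarith [ht.1]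
      refine ⟨?_, ?_, ?_⟩
      · rw [← show G.regionOf z₀' = R' from hR']
        refine (Quotient.sound (G.regionRel_next hrel ht₀pos.le hz₀' hz' fun c hc _ k hkB => ?_)).symm
        have hc0 := (z₀.2.2.1 c hc).1
        have hc1 := (z.2.2.1 c (hs ▸ hc)).1
        rcases lt_or_ge k 0 with hk | hk
        · have : (k : ℝ) < 0 := by exact_mod_cast hk
          constructor <;> constructor <;> intro <;> linarith
        by_cases hcb : z.1.2.1 c ≤ G.bound
        · rcases hdist t ht (some c) ((G.active_some).2 ⟨hs ▸ hc, hcb⟩) k hk hkB with h | h <;>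
          simp only [clk, Option.elim] at h <;> constructor <;> constructor <;> intro <;> linarith
        · have hcb0 : ¬ z₀.1.2.1 c ≤ G.bound := fun h => hcb ((hb c hc).1 h)
          have : (k : ℝ) ≤ G.bound := by exact_mod_cast hkB
          constructor <;> constructor <;> intro <;> linarith
      · refine G.sep_next (by linarith) (hsep.mono (by linarith)).good ht0 hz' fun c hc _ hcb => ?_
        have hc1 := (z.2.2.1 c hc).1
        refine good_zero_of_gap (by linarith) (by linarith) hcb fun k hk0 hkB _ => ?_
        rcases hdist t ht (some c) ((G.active_some).2 ⟨hc, by linarith⟩) k hk0 hkB with h | h <;>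
          simp only [clk, Option.elim] at h
        · rw [abs_sub_comm]
          exact le_trans (by linarith) (le_abs_self _)
        · exact le_trans (by linarith) (le_abs_self _)
      · have h1 := G.ageLe_next hK hage ht0 hz'
        intro c hc
        linarith [h1 c hc, ht.2]
  · obtain ⟨ε, hε, hstep⟩ := G.exists_le_step_of_fixed (K + (G.bound + 1)) (δ := δ) hδ
    refine ⟨ε, hε, fun z hzR hsep hage => ?_⟩
    have hrel : G.RegionRel z₀ z := Quotient.exact hzR.symm
    obtain ⟨hs, hb, hd⟩ := (G.regionRel_iff).1 hrel
    have hact := G.active_congr hrel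
    have hff := G.firstFixed_congr hrel
    have hf : (G.fixSched z.1.1).Nonempty := hs ▸ hf₀
    obtain ⟨f, hfm⟩ := G.firstFixed_nonempty (ν := z.1.2.1) hf
    have hT := G.firstFixedTime_eq hf hfm
    have hT₀ := G.firstFixedTime_eq hf₀ (hff ▸ hfm)
    have hTn := G.firstFixedTime_nonneg z hf
    have hTn₀ := G.firstFixedTime_nonneg z₀ hf₀
    obtain ⟨hfs, hfu⟩ := mem_fixSched.1 (G.firstFixed_subset _ _ hfm)
    have hlB : (G.lower f : ℝ) ≤ G.bound := by exact_mod_cast G.lower_le_bound f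
    have hfact : G.Active z (some f) := (G.active_some).2 ⟨hfs, by linarith⟩
    have hf0 := (z.2.2.1 f hfs).1
    refine hstep z hf (fun c hc => ?_) (fun c hc n hn => ?_) s' (hff ▸ hs ▸ hs') _ fun z' hz' => ?_
    · linarith [hage c (mem_varSched.1 hc).1]
    · have hcs := (mem_varSched.1 hc).1
      have hnB : (n : ℝ) ≤ G.bound := by exact_mod_cast G.upper_le_bound hn
      have hlt := (z.2.2.1 c hcs).2 n hn
      have hcact : G.Active z (some c) := (G.active_some).2 ⟨hcs, by linarith⟩
      have h1 := G.add_lt_upper_of_winFix_ne_zero hw (hs ▸ hc) hn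
      have h2 := (hd _ _ ((hact _).2 hcact) ((hact _).2 hfact) (n - G.lower f)).1 (by
        simp only [clk, Option.elim]
        push_cast
        linarith)
      have h3 := (hsep _ _ hcact hfact).le_of_lt h2
      simp only [clk, Option.elim] at h3
      push_cast at h3
      linarith
    -- At the time of the step the clock of `f` equals `lower f`, so comparing another clock with
    -- `k` amounts to comparing its difference to `f` with `k - lower f`.
    · have hcomm : ∀ c, G.Active z (some c) → ∀ k : ℤ,
          (z₀.1.2.1 c + G.firstFixedTime z₀.1.1 z₀.1.2.1 hf₀ < k ↔
            z.1.2.1 c + G.firstFixedTime z.1.1 z.1.2.1 hf < k) ∧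
          (k < z₀.1.2.1 c + G.firstFixedTime z₀.1.1 z₀.1.2.1 hf₀ ↔
            k < z.1.2.1 c + G.firstFixedTime z.1.1 z.1.2.1 hf) := by
        intro c hc k
        have h1 := hd _ _ ((hact _).2 hc) ((hact _).2 hfact) (k - G.lower f)
        have h2 := hd _ _ ((hact _).2 hfact) ((hact _).2 hc) (G.lower f - k)
        simp only [clk, Option.elim] at h1 h2
        push_cast at h1 h2
        rw [hT, hT₀]
        constructor <;> constructor <;> intro h3
        · have := h1.1 (by linarith)
          linarith
        · have := h1.2 (by linarith)
          linarith
        · have := h2.1 (by linarith)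
          linarith
        · have := h2.2 (by linarith)
          linarith
      refine ⟨?_, ?_, ?_⟩
      · rw [← show G.regionOf z₀' = R' from hR']
        rw [← hff] at hz'
        refine (Quotient.sound (G.regionRel_next hrel hTn₀ hz₀' hz' fun c hc _ k hkB => ?_)).symm
        by_cases hcb : z.1.2.1 c ≤ G.bound
        · exact hcomm c ((G.active_some).2 ⟨hs ▸ hc, hcb⟩) k
        · have hcb0 : ¬ z₀.1.2.1 c ≤ G.bound := fun h => hcb ((hb c hc).1 h)
          have : (k : ℝ) ≤ G.bound := by exact_mod_cast hkB
          constructor <;> constructor <;> intro <;> linarith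
      · refine G.sep_next (by linarith) (hsep.mono (by linarith)).good hTn hz' fun c hc _ hcb => ?_
        have hg := (hsep (some c) (some f) ((G.active_some).2 ⟨hc, by linarith⟩) hfact).mono
          (show δ / 3 ≤ δ by linarith)
        intro k
        have := hg (k - G.lower f)
        simp only [clk, Option.elim] at this
        push_cast at this
        rw [hT]
        refine this.imp (fun h => by linarith) (fun h => ?_)
        rwa [show z.1.2.1 c + (G.lower f - z.1.2.1 f) - 0 - k =
          z.1.2.1 c - z.1.2.1 f - (k - G.lower f) by ring]
      · have h1 := G.ageLe_next hK hage hTn hz'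
        intro c hc
        linarith [h1 c hc]

end GSMP

namespace GSMP

/-! ### Bottom strongly connected components -/

/-- Among the vertices reachable from `v`, one with the fewest descendants is chosen. A descendant
cannot have fewer, so it reaches the same vertices, including the chosen one. -/
theorem exists_reflTransGen_recurrent {V : Type*} [Finite V] (r : V → V → Prop) (v : V) :
    ∃ w, Relation.ReflTransGen r v w ∧
      ∀ x, Relation.ReflTransGen r w x → Relation.ReflTransGen r x w := by
  obtain ⟨w, hw, hmin⟩ := (Set.toFinite {w | Relation.ReflTransGen r v w}).exists_minimalFor
    (fun w => {x | Relation.ReflTransGen r w x}.ncard) _ ⟨v, Relation.ReflTransGen.refl⟩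
  refine ⟨w, hw, fun x hx => ?_⟩
  have hsub : {y | Relation.ReflTransGen r x y} ⊆ {y | Relation.ReflTransGen r w y} :=
    fun y hy => hx.trans hy
  have h1 := hmin (j := x) (Relation.ReflTransGen.trans hw hx) (Set.ncard_le_ncard hsub)
  have h2 := Set.eq_of_subset_of_ncard_le hsub h1
  have h3 : w ∈ {y | Relation.ReflTransGen r w y} := Relation.ReflTransGen.refl
  rw [← h2] at h3
  exact h3

set_option linter.unusedSectionVars false

variable {S Ev : Type*} [Fintype S] [Fintype Ev] [DecidableEq Ev] (G : GSMP S Ev)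
variable [MeasurableSpace S] [DiscreteMeasurableSpace S]

/-- A region is determined by finitely many data. Integral parts are capped at `G.bound + 1`, as the
cap is never attained by a clock within the bound. -/
instance finite_region : Finite G.Region := by
  let code : G.Config → S × (Ev → Fin (G.bound + 2)) × (Ev → Prop) × (Ev → Prop) × (Ev → Ev → Prop) :=
    fun z => (z.1.1, fun e => ⟨min ⌊z.1.2.1 e⌋₊ (G.bound + 1), by omega⟩,
      fun e => z.1.2.1 e ≤ G.bound, fun e => Int.fract (z.1.2.1 e) = 0,
      fun e f => Int.fract (z.1.2.1 e) ≤ Int.fract (z.1.2.1 f))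
  suffices key : ∀ z z', code z = code z' → G.RegionRel z z' from
    Finite.of_injective (fun R : G.Region => code (Quotient.out R)) fun R R' h => by
      rw [← Quotient.out_eq R, ← Quotient.out_eq R']
      exact Quotient.sound (key _ _ h)
  intro z z' h
  simp only [code, Prod.mk.injEq] at h
  obtain ⟨h1, h2, h3, h4, h5⟩ := h
  refine ⟨h1, fun e he => ?_, fun e _ f _ _ _ => iff_of_eq (congrFun (congrFun h5 e) f)⟩
  have h3e := iff_of_eq (congrFun h3 e)
  by_cases hb : z.1.2.1 e ≤ G.bound
  · refine Or.inl ⟨?_, iff_of_eq (congrFun h4 e)⟩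
    have hb' := h3e.1 hb
    have h2e := Fin.mk.inj_iff.1 (congrFun h2 e)
    have hf := Nat.floor_le_of_le hb
    have hf' := Nat.floor_le_of_le hb'
    rw [min_eq_left (by omega), min_eq_left (by omega)] at h2e
    rw [← Int.natCast_floor_eq_floor (z.2.2.1 e he).1,
      ← Int.natCast_floor_eq_floor (z'.2.2.1 e (h1 ▸ he)).1, h2e]
  · exact Or.inr ⟨not_le.1 hb, not_le.1 fun h => hb (h3e.2 h)⟩

/-- the configurations whose region belongs to a bottom strongly connected component -/
def bottom : Set G.Config := {z | ∃ C, G.IsBSCC C ∧ G.regionOf z ∈ C}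

theorem measurableSet_bottom : MeasurableSet G.bottom := by
  have : G.bottom = ⋃ R : G.Region, ⋃ _ : ∃ C, G.IsBSCC C ∧ R ∈ C, {z | G.regionOf z = R} := by
    ext z
    simp [bottom]
  rw [this]
  exact MeasurableSet.iUnion fun R => MeasurableSet.iUnion fun _ => G.measurableSet_regionOf R

theorem exists_reach_bottom (R : G.Region) :
    ∃ R', Relation.ReflTransGen G.RegionEdge R R' ∧ ∃ C, G.IsBSCC C ∧ R' ∈ C := by
  obtain ⟨w, hw, hrec⟩ := exists_reflTransGen_recurrent G.RegionEdge R
  refine ⟨w, hw, {R' | Relation.ReflTransGen G.RegionEdge w R' ∧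
    Relation.ReflTransGen G.RegionEdge R' w}, ⟨⟨w, rfl⟩, ?_⟩, .refl, .refl⟩
  rintro R₁ ⟨h1, -⟩ R₂ hE
  have h2 := h1.tail hE
  exact ⟨h2, hrec _ h2⟩

/-- Induction backwards along a path to a BSCC. Each edge costs a factor `3` in the separation and
`G.bound + 1` in the ages, but the path depends only on the region and there are finitely many
regions. -/
theorem uniformlyHits_sep {δ : ℝ} (hδ : 0 < δ) (K : ℝ) :
    UniformlyHits G.step G.bottom {z | G.Sep δ z ∧ G.AgeLe K z} := by
  have key : ∀ R : G.Region, ∀ δ : ℝ, 0 < δ → δ ≤ 1 → ∀ K : ℝ, 0 ≤ K →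
      UniformlyHits G.step G.bottom {z | G.regionOf z = R ∧ G.Sep δ z ∧ G.AgeLe K z} := by
    intro R
    obtain ⟨R', hR, C, hC, hRC⟩ := G.exists_reach_bottom R
    induction hR using Relation.ReflTransGen.head_induction_on with
    | refl =>
      intro δ _ _ K _
      refine (uniformlyHits_self G.step G.bottom).mono ?_
      rintro z ⟨rfl, -⟩
      exact ⟨C, hC, hRC⟩
    | head hE _ ih =>
      intro δ hδ hδ1 K hK
      obtain ⟨ε, hε, h⟩ := G.exists_le_step_region hE hδ hδ1 hK
      exact (ih (δ / 3) (by positivity) (by linarith) (K + (G.bound + 1)) (by positivity)).of_step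
        G.measurableSet_bottom hε fun z hz => h z hz.1 hz.2.1 hz.2.2
  refine (UniformlyHits.iUnion fun R => key R (min δ 1) (by positivity) (min_le_right _ _) (max K 0)
    (le_max_right _ _)).mono ?_
  rintro z ⟨h1, h2⟩
  exact mem_iUnion.2 ⟨G.regionOf z, rfl, h1.mono (min_le_left _ _),
    fun e he => (h2 e he).trans (le_max_left _ _)⟩

theorem measurableSet_ageLe (K : ℝ) : MeasurableSet {z : G.Config | G.AgeLe K z} := by
  have key : Measurable fun z : S × (Ev → ℝ) × ℝ => ∀ e ∈ G.sched z.1, z.2.1 e ≤ K := by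
    refine measurable_from_prod_countable_right fun s => ?_
    dsimp only
    refine Measurable.forall fun e => Measurable.imp measurable_const ?_
    exact measurableSet_setOfPred.1 (measurableSet_le
      ((measurable_pi_apply e).comp measurable_fst) measurable_const)
  exact measurableSet_setOfPred.2 (key.comp measurable_subtype_coe)

/-- The Lyapunov function reduces everything to uniform hitting from bounded ages. The constant `K`
that it produces is not controlled, so the hypothesis is required for every `K`. -/
theorem ae_exists_mem_bottom (h : ∀ K : ℝ, UniformlyHits G.step G.bottom {z | G.AgeLe K z}) :
    ∀ᵐ σ ∂G.runMeasure, ∃ n, σ n ∈ G.bottom := by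
  obtain ⟨K, -, L, hfin, hL⟩ := G.exists_lyapunov
  exact ae_exists_mem_of_tendsto_avoid G.step G.measurableSet_bottom (fun z =>
    tendsto_avoid_zero G.step (G.measurableSet_ageLe K) G.measurableSet_bottom hfin
      (fun z hz => hL z hz) (h K) z) G.initMeasure

end GSMP

namespace GSMP

set_option linter.unusedSectionVars false

variable {S Ev : Type*} [Fintype S] [Fintype Ev] [DecidableEq Ev] (G : GSMP S Ev)

/-! ### Gaps between the times at which clocks become integral -/

/-- No clock becomes integral strictly between the times `x` and `y`. -/
def Free (z : G.Config) (x y : ℝ) : Prop :=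
  ∀ c ∈ G.sched z.1.1, ∀ k : ℤ, k - z.1.2.1 c ≤ x ∨ y ≤ k - z.1.2.1 c

open Classical in
/-- the events whose deadline is at most `p` -/
noncomputable def urgent (z : G.Config) (p : ℝ) : Finset Ev :=
  (G.sched z.1.1).filter fun c => ∃ n : ℕ, G.upper c = n ∧ n - z.1.2.1 c ≤ p

variable {G} in
theorem mem_urgent {z : G.Config} {p : ℝ} {c : Ev} : c ∈ G.urgent z p ↔
    c ∈ G.sched z.1.1 ∧ ∃ n : ℕ, G.upper c = n ∧ n - z.1.2.1 c ≤ p := by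
  simp [urgent]

variable {G} in
theorem Free.add_natCast {z : G.Config} {x y : ℝ} (h : G.Free z x y) (j : ℕ) :
    G.Free z (x + j) (y + j) := by
  intro c hc k
  have := h c hc (k - j)
  push_cast at this
  exact this.imp (fun h => by linarith) (fun h => by linarith)

variable {G} in
theorem Free.le_deadline {z : G.Config} {x y : ℝ} (h : G.Free z x y) {c : Ev}
    (hc : c ∈ G.sched z.1.1) {n : ℕ} (hn : x < n - z.1.2.1 c) : y ≤ n - z.1.2.1 c := by
  have := h c hc n
  push_cast at this
  exact this.resolve_left (not_le.2 hn)

theorem val_next {z z' : G.Config} {E : Finset Ev} {t : ℝ} {s' : S}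
    (hz' : z'.1 = (s', G.nextVal z.1.1 z.1.2.1 E t s', t)) (c : Ev) :
    z'.1.2.1 c = 0 ∨ (c ∈ G.sched z.1.1 ∧ c ∉ E ∧ z'.1.2.1 c = z.1.2.1 c + t) := by
  have hv : z'.1.2.1 c = G.nextVal z.1.1 z.1.2.1 E t s' c := by rw [hz']
  by_cases h : c ∈ G.sched s' ∧ c ∈ G.sched z.1.1 ∧ c ∉ E
  · rw [G.nextVal_of_inherited h] at hv
    exact Or.inr ⟨h.2.1, h.2.2, hv⟩
  · rw [G.nextVal_of_not_inherited h] at hv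
    exact Or.inl hv

/-- A reset clock becomes integral exactly at integer times, so inside `[0, 1]` it does not disturb
a free interval; the other clocks only shift. -/
theorem free_next {z z' : G.Config} {E : Finset Ev} {t : ℝ} {s' : S}
    (hz' : z'.1 = (s', G.nextVal z.1.1 z.1.2.1 E t s', t)) {x y x' y' : ℝ} (h : G.Free z x y)
    (hx : x - t ≤ x') (hy : y' ≤ y - t) (hx0 : 0 ≤ x') (hy1 : y' ≤ 1) : G.Free z' x' y' := by
  intro c _ k
  rcases G.val_next hz' c with h0 | ⟨hc, -, hv⟩
  · rw [h0, sub_zero]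
    rcases le_or_gt k 0 with hk | hk
    · exact Or.inl (le_trans (by exact_mod_cast hk) hx0)
    · exact Or.inr (hy1.trans (by exact_mod_cast hk))
  · rw [hv]
    exact (h c hc k).imp (fun h => by linarith) (fun h => by linarith)

theorem one_le_upper {c : Ev} {n : ℕ} (h : G.upper c = n) : (1 : ℝ) ≤ n := by
  have : n ≠ 0 := by
    rintro rfl
    exact G.upper_ne_zero c h
  exact_mod_cast Nat.one_le_iff_ne_zero.2 this

/-- Deadlines of inherited events keep their absolute time, and a newly scheduled event has its
deadline at least one time unit ahead. Thus the number of urgent events serves as a termination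
measure. -/
theorem urgent_next_subset {z z' : G.Config} {E : Finset Ev} {t : ℝ} {s' : S}
    (hz' : z'.1 = (s', G.nextVal z.1.1 z.1.2.1 E t s', t)) {p : ℝ} (hp : p - t < 1) :
    G.urgent z' (p - t) ⊆ G.urgent z p \ E := by
  intro c hc
  obtain ⟨-, n, hn, hle⟩ := mem_urgent.1 hc
  rcases G.val_next hz' c with h0 | ⟨hcs, hcE, hv⟩
  · linarith [G.one_le_upper hn]
  · exact Finset.mem_sdiff.2 ⟨mem_urgent.2 ⟨hcs, n, hn, by linarith⟩, hcE⟩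

theorem card_urgent_next_lt {z z' : G.Config} {E : Finset Ev} {t : ℝ} {s' : S}
    (hz' : z'.1 = (s', G.nextVal z.1.1 z.1.2.1 E t s', t)) {p : ℝ} (hp : p - t < 1) {e : Ev}
    (heE : e ∈ E) (he : e ∈ G.urgent z p) : (G.urgent z' (p - t)).card < (G.urgent z p).card := by
  refine Finset.card_lt_card (Finset.ssubset_of_subset_of_ssubset (G.urgent_next_subset hz' hp) ?_)
  exact ⟨Finset.sdiff_subset, fun h => (Finset.mem_sdiff.1 (h he)).2 heE⟩

theorem var_urgent_next {z z' : G.Config} {E : Finset Ev} {t : ℝ} {s' : S}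
    (hz' : z'.1 = (s', G.nextVal z.1.1 z.1.2.1 E t s', t)) {p : ℝ} (hp : p - t < 1)
    (h : ∀ c ∈ G.urgent z p, ¬ (G.lower c : ℕ∞) < G.upper c) :
    ∀ c ∈ G.urgent z' (p - t), ¬ (G.lower c : ℕ∞) < G.upper c := fun c hc =>
  h c (Finset.mem_sdiff.1 (G.urgent_next_subset hz' hp hc)).1

/-- The two bounds of a variable delay differ by at least `1`, so an event whose deadline is at most
one unit away has already passed its lower bound and may occur at any moment. -/
theorem lower_le_of_urgent {z : G.Config} {p : ℝ} (hp : p ≤ 1) {e : Ev} (he : e ∈ G.urgent z p)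
    (hv : (G.lower e : ℕ∞) < G.upper e) : G.lower e ≤ z.1.2.1 e := by
  obtain ⟨-, n, hn, hle⟩ := mem_urgent.1 he
  rw [hn] at hv
  have h1 : G.lower e + 1 ≤ n := by exact_mod_cast hv
  have h2 : (G.lower e : ℝ) + 1 ≤ n := by exact_mod_cast h1
  linarith

/-- Some interval of length `1 / (|Ev| + 1)` in `[0, 1]` is free. -/
theorem exists_free (z : G.Config) : ∃ p : ℝ, 0 ≤ p ∧ p + (Fintype.card Ev + 1 : ℝ)⁻¹ ≤ 1 ∧
    G.Free z p (p + (Fintype.card Ev + 1 : ℝ)⁻¹) := by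
  set N := Fintype.card Ev with hN
  have hN0 : (0 : ℝ) < N + 1 := by positivity
  -- Pigeonhole: `[0, 1]` is cut into `N + 1` intervals, and each of the `N` clocks becomes integral
  -- in the interior of at most one of them.
  let f : Ev → ℤ := fun c => ⌊Int.fract (-z.1.2.1 c) * (N + 1)⌋
  obtain ⟨i, hi, hif⟩ : ∃ i ∈ Finset.range (N + 1), ∀ c, f c ≠ i := by
    by_contra! hcon
    have h1 : (Finset.range (N + 1)).image (fun i : ℕ => (i : ℤ)) ⊆ Finset.univ.image f := by
      intro k hk
      obtain ⟨i, hi, rfl⟩ := Finset.mem_image.1 hk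
      obtain ⟨c, hc⟩ := hcon i hi
      exact Finset.mem_image.2 ⟨c, Finset.mem_univ _, hc⟩
    have h2 := (Finset.card_le_card h1).trans Finset.card_image_le
    rw [Finset.card_image_of_injective _ Nat.cast_injective, Finset.card_range,
      Finset.card_univ] at h2
    omega
  have hiN : (i : ℝ) ≤ N := by
    have := Finset.mem_range.1 hi
    exact_mod_cast (by omega : i ≤ N)
  have hlen : (i : ℝ) / (N + 1) + (N + 1 : ℝ)⁻¹ = (i + 1) / (N + 1) := by ring
  refine ⟨i / (N + 1), by positivity, ?_, ?_⟩
  · rw [hlen, div_le_one hN0]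
    linarith
  · intro c _ k
    rw [hlen, div_eq_mul_inv, div_eq_mul_inv]
    by_contra! hcon
    obtain ⟨h1, h2⟩ := hcon
    rw [← div_eq_mul_inv] at h1 h2
    rw [div_lt_iff₀ hN0] at h1
    rw [lt_div_iff₀ hN0] at h2
    apply hif c
    have h01 : 0 < k - z.1.2.1 c := by
      by_contra! hneg
      have : (0 : ℝ) ≤ i := Nat.cast_nonneg _
      nlinarith
    have h02 : k - z.1.2.1 c < 1 := by
      by_contra! hneg
      nlinarith
    have hfr : Int.fract (-z.1.2.1 c) = k - z.1.2.1 c := by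
      rw [Int.fract_eq_iff]
      exact ⟨h01.le, h02, -k, by push_cast; ring⟩
    simp only [f]
    rw [hfr, Int.floor_eq_iff]
    push_cast
    exact ⟨h1.le, h2⟩

variable [MeasurableSpace S] [DiscreteMeasurableSpace S]

theorem exists_succ_ne_zero (s : S) (E : Finset Ev) : ∃ s', G.succ s E s' ≠ 0 :=
  (G.succ s E).support_nonempty

theorem firstFixedTime_le {s : S} {ν : Ev → ℝ} (h : (G.fixSched s).Nonempty) {f : Ev}
    (hf : f ∈ G.fixSched s) : G.firstFixedTime s ν h ≤ G.lower f - ν f :=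
  Finset.inf'_le (fun e => (G.lower e : ℝ) - ν e) hf

/-- If some variable-delay event has a deadline of at most `p`, then with probability bounded away
from zero an event with deadline at most `p` occurs before the time `p`. -/
theorem exists_le_step_urgent (K : ℝ) : ∃ ε : ENNReal, 0 < ε ∧ ∀ (z : G.Config) (p : ℝ),
    G.AgeLe K z → p ≤ 1 → (∃ e ∈ G.urgent z p, (G.lower e : ℕ∞) < G.upper e) → ∀ Y : Set G.Config,
    (∀ (E : Finset Ev) (t : ℝ) (s' : S), ∀ e ∈ E, e ∈ G.urgent z p → 0 ≤ t → t ≤ p →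
      ∀ z' : G.Config, z'.1 = (s', G.nextVal z.1.1 z.1.2.1 E t s', t) → z' ∈ Y) →
    ε ≤ G.step z Y := by
  obtain ⟨ε₁, hε₁, h₁⟩ := G.exists_le_step_of_window_rel (K + 1) (δ := 6⁻¹) (by norm_num)
  obtain ⟨ε₂, hε₂, h₂⟩ := G.exists_le_step_of_fixed_rel (K + 1) (δ := 6⁻¹) (by norm_num)
  refine ⟨min ε₁ ε₂, lt_min hε₁ hε₂, fun z p hage hp hurg Y hY => ?_⟩
  classical
  have hne : ((G.urgent z p).filter fun e => (G.lower e : ℕ∞) < G.upper e).Nonempty := by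
    obtain ⟨e, he, hv⟩ := hurg
    exact ⟨e, Finset.mem_filter.2 ⟨he, hv⟩⟩
  obtain ⟨e, hem, hmin⟩ := Finset.exists_min_image _
    (fun e => ((G.upper e).toNat : ℝ) - z.1.2.1 e) hne
  obtain ⟨he, hv⟩ := Finset.mem_filter.1 hem
  obtain ⟨hes, n, hn, hle⟩ := mem_urgent.1 he
  -- The shortest remaining time among the variable-delay events. It has no positive lower bound, so
  -- all windows below are proportional to it and the relative estimates are used.
  set ρ : ℝ := n - z.1.2.1 e with hρ
  have hρ0 : 0 < ρ := sub_pos.2 ((z.2.2.1 e hes).2 n hn)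
  have hρmin : ∀ c ∈ G.varSched z.1.1, ∀ m : ℕ, G.upper c = m → ρ ≤ m - z.1.2.1 c := by
    intro c hc m hm
    obtain ⟨hcs, hcv⟩ := mem_varSched.1 hc
    rcases le_or_gt ((m : ℝ) - z.1.2.1 c) p with h | h
    · have := hmin c (Finset.mem_filter.2 ⟨mem_urgent.2 ⟨hcs, m, hm, h⟩, hcv⟩)
      rwa [hn, hm, ENat.toNat_natCast, ENat.toNat_natCast] at this
    · linarith
  -- Either a fixed-delay event is due by `ρ / 2`, and all variable-delay events survive until then
  -- with bounded probability, or `e` can win between `ρ / 6` and `ρ / 3`.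
  by_cases hfix : ∃ hf : (G.fixSched z.1.1).Nonempty, G.firstFixedTime z.1.1 z.1.2.1 hf ≤ ρ / 2
  · obtain ⟨hf, hT⟩ := hfix
    obtain ⟨s', hs'⟩ := G.exists_succ_ne_zero z.1.1 (G.firstFixed z.1.1 z.1.2.1)
    obtain ⟨f, hfm⟩ := G.firstFixed_nonempty (ν := z.1.2.1) hf
    refine (min_le_right _ _).trans (h₂ z hf (fun c hc => ⟨?_, fun m hm => ?_⟩) s' hs' Y
      fun z' hz' => ?_)
    · linarith [hage c (mem_varSched.1 hc).1]
    · linarith [hρmin c hc m hm]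
    · refine hY _ _ s' f hfm ?_ (G.firstFixedTime_nonneg z hf) (by linarith) z' hz'
      obtain ⟨hfs, hfu⟩ := mem_fixSched.1 (G.firstFixed_subset _ _ hfm)
      have := G.firstFixedTime_eq hf hfm
      exact mem_urgent.2 ⟨hfs, _, hfu.symm, by linarith⟩
  · obtain ⟨s', hs'⟩ := G.exists_succ_ne_zero z.1.1 {e}
    refine (min_le_left _ _).trans (h₁ z e (mem_varSched.2 ⟨hes, hv⟩) (ρ / 6) (ρ / 3) (by linarith)
      (by linarith) (fun f hf => ?_) (fun c hc => ⟨?_, fun m hm => ?_⟩) ?_ (Or.inr ⟨n, hn, ?_⟩)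
      s' hs' Y fun t ht z' hz' => ?_)
    · have h3 := G.firstFixedTime_le (ν := z.1.2.1) ⟨f, hf⟩ hf
      have h4 : ρ / 2 < G.firstFixedTime z.1.1 z.1.2.1 ⟨f, hf⟩ := not_le.1 fun h => hfix ⟨_, h⟩
      linarith
    · linarith [hage c (mem_varSched.1 hc).1]
    · linarith [hρmin c hc m hm]
    · linarith [G.lower_le_of_urgent hp he hv]
    · linarith
    · exact hY {e} t s' e (Finset.mem_singleton_self e) he (by linarith [ht.1])
        (by linarith [ht.2]) z' hz'

/-- The interval between the times `p` and `p + δ` is free; if a variable-delay event has a deadline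
of at most `p`, then so is the one between `0` and `δ`. -/
def Prepared (δ : ℝ) (z : G.Config) (p : ℝ) : Prop :=
  0 ≤ p ∧ p + δ ≤ 1 ∧ G.Free z p (p + δ) ∧
    ((∃ e ∈ G.urgent z p, (G.lower e : ℕ∞) < G.upper e) → G.Free z 0 δ)

/-- A free interval exists by pigeonhole, but urgent variable-delay events may be due too soon to be
placed inside a free window. They are removed without any control on the clocks, before separation
begins; each such step lowers the number of urgent events, and the free interval keeps its absolute
time. -/
theorem uniformlyHits_ageLe {T : Set G.Config} (hT : MeasurableSet T)
    (h : ∀ δ > 0, ∀ K, UniformlyHits G.step T {z | G.AgeLe K z ∧ ∃ p, G.Prepared δ z p}) (K : ℝ) :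
    UniformlyHits G.step T {z | G.AgeLe K z} := by
  set δ : ℝ := (Fintype.card Ev + 1 : ℝ)⁻¹ with hδ
  have hδ0 : 0 < δ := by positivity
  have key : ∀ (a : ℕ) (K : ℝ), 0 ≤ K → UniformlyHits G.step T {z | G.AgeLe K z ∧ ∃ p, 0 ≤ p ∧
      p + δ ≤ 1 ∧ G.Free z p (p + δ) ∧ (G.urgent z p).card < a} := by
    intro a
    induction a with
    | zero => exact fun K _ => (uniformlyHits_self G.step T).mono fun z ⟨_, p, _, _, _, h⟩ =>
        absurd h (Nat.not_lt_zero _)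
    | succ a ih =>
      intro K hK
      obtain ⟨ε, hε, hstep⟩ := G.exists_le_step_urgent K
      have h1 := (ih (K + 1) (by linarith)).of_step hT hε (X := {z | G.AgeLe K z ∧ ∃ p, 0 ≤ p ∧
        p + δ ≤ 1 ∧ G.Free z p (p + δ) ∧ (G.urgent z p).card < a + 1 ∧
        ∃ e ∈ G.urgent z p, (G.lower e : ℕ∞) < G.upper e}) ?_
      · refine ((h δ hδ0 K).union h1).mono ?_
        rintro z ⟨hage, p, hp0, hp1, hfree, hcard⟩
        by_cases hu : ∃ e ∈ G.urgent z p, (G.lower e : ℕ∞) < G.upper e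
        · exact Or.inr ⟨hage, p, hp0, hp1, hfree, hcard, hu⟩
        -- Without an urgent variable-delay event the last clause of `Prepared` is vacuous.
        · exact Or.inl ⟨hage, p, hp0, hp1, hfree, fun hu' => absurd hu' hu⟩
      · rintro z ⟨hage, p, hp0, hp1, hfree, hcard, hu⟩
        refine hstep z p hage (by linarith) hu _ fun E t s' e heE he ht0 htp z' hz' => ?_
        refine ⟨fun c hc => ?_, p - t, by linarith, by linarith,
          G.free_next hz' hfree le_rfl (by linarith) (by linarith) (by linarith), ?_⟩
        · linarith [G.ageLe_next hK hage ht0 hz' c hc]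
        · have := G.card_urgent_next_lt hz' (by linarith) heE he
          omega
  refine (key (Fintype.card Ev + 1) (max K 0) (le_max_right _ _)).mono fun z hz => ?_
  obtain ⟨p, hp0, hp1, hfree⟩ := G.exists_free z
  exact ⟨fun c hc => (hz c hc).trans (le_max_left _ _), p, hp0, hp1, hfree,
    Nat.lt_succ_of_le (Finset.card_le_univ _)⟩

end GSMP

namespace GSMP

set_option linter.unusedSectionVars false

variable {S Ev : Type*} [Fintype S] [Fintype Ev] [DecidableEq Ev] (G : GSMP S Ev)
variable [MeasurableSpace S] [DiscreteMeasurableSpace S]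

/-! ### Steps that keep the clocks separated -/

/-- A step from `z` to `z'` that takes time `t`, in which either fixed-delay events occur or all
scheduled events that do not occur have clocks at distance at least `δ` to the integers. -/
def Out (δ : ℝ) (z z' : G.Config) (t : ℝ) : Prop :=
  ∃ E s', z'.1 = (s', G.nextVal z.1.1 z.1.2.1 E t s', t) ∧ G.succ z.1.1 E s' ≠ 0 ∧ 0 ≤ t ∧
    ((E.Nonempty ∧ E ⊆ G.fixSched z.1.1 ∧ ∀ h ∈ E, z.1.2.1 h + t = G.lower h) ∨
      ∀ c ∈ G.sched z.1.1, c ∉ E → ∀ k : ℤ, δ ≤ |z.1.2.1 c + t - k|)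

/-- Inside a free window of length `δ` the occurrence is placed at distance at least `δ / 6` from
both ends. The surviving clocks are then `δ / 6` away from the integers, and the final sixth of the
window remains free for the next step. -/
theorem exists_le_step_of_free_window (K : ℝ) {δ : ℝ} (hδ : 0 < δ) (hδ1 : δ ≤ 1) :
    ∃ ε : ENNReal, 0 < ε ∧ ∀ (z : G.Config) (b : ℝ), G.AgeLe K z → 0 ≤ b → b ≤ G.bound + 1 →
      G.Free z b (b + δ) → (∀ c ∈ G.sched z.1.1, ∀ n : ℕ, G.upper c = n → b < n - z.1.2.1 c) →
      ∀ e ∈ G.varSched z.1.1, G.lower e ≤ z.1.2.1 e + b → ∀ Y : Set G.Config,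
      (∀ t s' z', b + 4 * (δ / 6) ≤ t → t ≤ b + 5 * (δ / 6) →
        z'.1 = (s', G.nextVal z.1.1 z.1.2.1 {e} t s', t) → G.Out (δ / 6) z z' t → z' ∈ Y) →
      ε ≤ G.step z Y := by
  obtain ⟨ε, hε, h⟩ := G.exists_le_step_of_window (K + G.bound + 2) (δ := δ / 6) (by positivity)
  refine ⟨ε, hε, fun z b hage hb0 hb hfree hdl e he hl Y hY => ?_⟩
  obtain ⟨s', hs'⟩ := G.exists_succ_ne_zero z.1.1 {e}
  refine h z e he (b + 4 * (δ / 6)) (b + 5 * (δ / 6)) (by positivity) (by linarith)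
    (fun c hc => ?_) (fun c hc n hn => ?_) (by linarith) s' hs' Y fun t ht z' hz' => ?_
  · linarith [hage c (mem_varSched.1 hc).1]
  · linarith [hfree.le_deadline hc (hdl c hc n hn)]
  · refine hY t s' z' ht.1 ht.2 hz' ⟨{e}, s', hz', hs', by linarith [ht.1], Or.inr ?_⟩
    intro c hc _ k
    rcases hfree c hc k with h1 | h1
    · exact le_trans (by linarith [ht.1]) (le_abs_self _)
    · rw [abs_sub_comm]
      exact le_trans (by linarith [ht.2]) (le_abs_self _)

/-- No variable-delay deadline is at most `q`, hence none is before `q + δ` by freeness. Since the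
fixed-delay events are due by `q`, all variable-delay events survive until then with probability
bounded below. -/
theorem exists_le_step_of_free_fixed (K : ℝ) {δ : ℝ} (hδ : 0 < δ) :
    ∃ ε : ENNReal, 0 < ε ∧ ∀ (z : G.Config) (q : ℝ), G.AgeLe K z →
      G.Free z q (q + δ) → (∀ c ∈ G.urgent z q, ¬ (G.lower c : ℕ∞) < G.upper c) →
      ∀ hf : (G.fixSched z.1.1).Nonempty, G.firstFixedTime z.1.1 z.1.2.1 hf ≤ q →
      q - G.firstFixedTime z.1.1 z.1.2.1 hf + δ ≤ 1 → ∀ Y : Set G.Config,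
      (∀ s' z', z'.1 = (s', G.nextVal z.1.1 z.1.2.1 (G.firstFixed z.1.1 z.1.2.1)
          (G.firstFixedTime z.1.1 z.1.2.1 hf) s', G.firstFixedTime z.1.1 z.1.2.1 hf) →
        G.Out (δ / 6) z z' (G.firstFixedTime z.1.1 z.1.2.1 hf) →
        G.Prepared (δ / 6) z' (q - G.firstFixedTime z.1.1 z.1.2.1 hf) → z' ∈ Y) →
      ε ≤ G.step z Y := by
  obtain ⟨ε, hε, h⟩ := G.exists_le_step_of_fixed (K + G.bound) hδ
  refine ⟨ε, hε, fun z q hage hfree hurg hf hT hq Y hY => ?_⟩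
  obtain ⟨s', hs'⟩ := G.exists_succ_ne_zero z.1.1 (G.firstFixed z.1.1 z.1.2.1)
  obtain ⟨f, hfm⟩ := G.firstFixed_nonempty (ν := z.1.2.1) hf
  have hTf := G.firstFixedTime_eq hf hfm
  have hT0 := G.firstFixedTime_nonneg z hf
  have hlB : (G.lower f : ℝ) ≤ G.bound := by exact_mod_cast G.lower_le_bound f
  have hf0 := (z.2.2.1 f (mem_fixSched.1 (G.firstFixed_subset _ _ hfm)).1).1
  refine h z hf (fun c hc => ?_) (fun c hc n hn => ?_) s' hs' Y fun z' hz' =>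
    hY s' z' hz' ⟨_, s', hz', hs', hT0, Or.inl ⟨⟨f, hfm⟩, G.firstFixed_subset _ _, fun g hg => ?_⟩⟩
      ⟨by linarith, by linarith, G.free_next hz' hfree le_rfl (by linarith) (by linarith)
        (by linarith), fun ⟨c, hc, hcv⟩ => absurd hcv
          (G.var_urgent_next hz' (by linarith) hurg c hc)⟩
  · linarith [hage c (mem_varSched.1 hc).1]
  · obtain ⟨hcs, hcv⟩ := mem_varSched.1 hc
    have h1 : q < n - z.1.2.1 c := by
      by_contra! hcon
      exact hurg c (mem_urgent.2 ⟨hcs, n, hn, hcon⟩) hcv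
    linarith [hfree.le_deadline hcs h1]
  · exact G.add_firstFixedTime_of_mem hf hg

/-- If no deadline is at most `p`, then at some time `p + k` a variable-delay event may occur, or
within the time unit that follows a fixed-delay event occurs before all deadlines of
variable-delay events. -/
theorem exists_ready (z : G.Config) {p : ℝ} (hp : 0 ≤ p)
    (h : ∀ c ∈ G.sched z.1.1, ∀ n : ℕ, G.upper c = n → p < n - z.1.2.1 c) :
    ∃ k : ℕ, k ≤ G.bound ∧
      (∀ c ∈ G.sched z.1.1, ∀ n : ℕ, G.upper c = n → p + k < n - z.1.2.1 c) ∧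
      ((∃ e ∈ G.varSched z.1.1, G.lower e ≤ z.1.2.1 e + (p + k)) ∨
        ((∀ c ∈ G.urgent z (p + k + 1), ¬ (G.lower c : ℕ∞) < G.upper c) ∧
          ∃ hf : (G.fixSched z.1.1).Nonempty,
            G.firstFixedTime z.1.1 z.1.2.1 hf ≤ p + k + 1)) := by
  classical
  by_cases hfin : ((G.sched z.1.1).filter fun c => ∃ n : ℕ, G.upper c = n).Nonempty
  · obtain ⟨d, hdm, hmin⟩ := Finset.exists_min_image _
      (fun e => ((G.upper e).toNat : ℝ) - z.1.2.1 e) hfin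
    obtain ⟨hd, n, hn⟩ := Finset.mem_filter.1 hdm
    have hdmin : ∀ c ∈ G.sched z.1.1, ∀ m : ℕ, G.upper c = m →
        n - z.1.2.1 d ≤ m - z.1.2.1 c := by
      intro c hc m hm
      have := hmin c (Finset.mem_filter.2 ⟨hc, m, hm⟩)
      rwa [hn, hm, ENat.toNat_natCast, ENat.toNat_natCast] at this
    have hpos : 0 < n - z.1.2.1 d - p := sub_pos.2 (h d hd n hn)
    -- The earliest deadline lies in `(p + k, p + k + 1]`.
    obtain ⟨k, hk⟩ : ∃ k : ℕ, ⌈n - z.1.2.1 d - p⌉₊ = k + 1 :=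
      Nat.exists_eq_succ_of_ne_zero (Nat.ceil_pos.2 hpos).ne'
    have hk1 : n - z.1.2.1 d - p ≤ k + 1 := by
      have := Nat.le_ceil (n - z.1.2.1 d - p)
      rw [hk] at this
      exact_mod_cast this
    have hk2 : k < n - z.1.2.1 d - p := Nat.lt_ceil.1 (by omega)
    have hd0 := (z.2.2.1 d hd).1
    have hkB : k ≤ G.bound := by
      have h1 := G.upper_le_bound hn
      have h2 : (k : ℝ) ≤ n := by linarith
      exact (by exact_mod_cast h2 : k ≤ n).trans h1
    refine ⟨k, hkB, fun c hc m hm => by linarith [hdmin c hc m hm], ?_⟩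
    by_cases hr : ∃ e ∈ G.varSched z.1.1, G.lower e ≤ z.1.2.1 e + (p + k)
    · exact Or.inl hr
    -- A variable-delay event with deadline at most `p + k + 1` would have passed its lower bound by
    -- `p + k`, hence be ready.
    · have hnv : ∀ c ∈ G.urgent z (p + k + 1), ¬ (G.lower c : ℕ∞) < G.upper c := by
        intro c hc hcv
        obtain ⟨hcs, m, hm, hle⟩ := mem_urgent.1 hc
        refine hr ⟨c, mem_varSched.2 ⟨hcs, hcv⟩, ?_⟩
        rw [hm] at hcv
        have h1 : G.lower c + 1 ≤ m := by exact_mod_cast hcv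
        have h2 : (G.lower c : ℝ) + 1 ≤ m := by exact_mod_cast h1
        linarith
      have hdl : (G.lower d : ℕ∞) = G.upper d := (G.lower_le_upper d).eq_of_not_lt
        (hnv d (mem_urgent.2 ⟨hd, n, hn, by linarith⟩))
      have hdf := mem_fixSched.2 ⟨hd, hdl⟩
      refine Or.inr ⟨hnv, ⟨d, hdf⟩, (G.firstFixedTime_le _ hdf).trans ?_⟩
      rw [hn] at hdl
      rw [show G.lower d = n by exact_mod_cast hdl]
      linarith
  · have hinf : ∀ c ∈ G.sched z.1.1, ∀ n : ℕ, G.upper c ≠ n := fun c hc n hn =>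
      hfin ⟨c, Finset.mem_filter.2 ⟨hc, n, hn⟩⟩
    obtain ⟨e, he⟩ := G.sched_nonempty z.1.1
    refine ⟨G.lower e, G.lower_le_bound e, fun c hc n hn => absurd hn (hinf c hc n),
      Or.inl ⟨e, mem_varSched.2 ⟨he, (G.lower_le_upper e).lt_of_ne fun hl => ?_⟩, ?_⟩⟩
    · exact hinf e he _ hl.symm
    · linarith [(z.2.2.1 e he).1]

theorem nonneg_of_ageLe {z : G.Config} {K : ℝ} (h : G.AgeLe K z) : 0 ≤ K := by
  obtain ⟨e, he⟩ := G.sched_nonempty z.1.1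
  exact (z.2.2.1 e he).1.trans (h e he)

/-- The engine of the separation phases: a step of type `Out` that restores `Prepared` with a sixth
of the margin. The free interval either keeps its absolute time while an urgent event is consumed,
or is replaced by one that starts at least one time unit later. Since the number of urgent events is
bounded, boundedly many such steps advance time by one unit. -/
theorem exists_le_step_prepared (K : ℝ) {δ : ℝ} (hδ : 0 < δ) :
    ∃ ε : ENNReal, 0 < ε ∧ ∀ (z : G.Config) (p : ℝ), G.AgeLe K z → G.Prepared δ z p →
      ε ≤ G.step z {z' | G.AgeLe (K + G.bound + 3) z' ∧ ∃ t p', G.Out (δ / 6) z z' t ∧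
        G.Prepared (δ / 6) z' p' ∧
        ((t + p' = p ∧ (G.urgent z' p').card < (G.urgent z p).card) ∨ p + 1 ≤ t + p')} := by
  rcases le_or_gt δ 1 with hδ1 | hδ1
  swap
  · exact ⟨1, one_pos, fun z p _ hp => by linarith [hp.1, hp.2.1]⟩
  obtain ⟨ε₁, hε₁, h₁⟩ := G.exists_le_step_of_free_window K hδ hδ1
  obtain ⟨ε₂, hε₂, h₂⟩ := G.exists_le_step_of_free_fixed K hδ
  refine ⟨min ε₁ ε₂, lt_min hε₁ hε₂, fun z p hage ⟨hp0, hp1, hfree, hurg⟩ => ?_⟩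
  have hK := G.nonneg_of_ageLe hage
  have hB0 : (0 : ℝ) ≤ G.bound := Nat.cast_nonneg _
  -- An urgent variable-delay event is made to occur in the free window at time `0`, which
  -- `Prepared` provides for exactly this case.
  by_cases hu : ∃ e ∈ G.urgent z p, (G.lower e : ℕ∞) < G.upper e
  · have hfree0 := hurg hu
    obtain ⟨e, he, hv⟩ := hu
    obtain ⟨hes, n, hn, hle⟩ := mem_urgent.1 he
    have hpos : ∀ c ∈ G.sched z.1.1, ∀ n : ℕ, G.upper c = n → 0 < n - z.1.2.1 c :=
      fun c hc n hn => sub_pos.2 ((z.2.2.1 c hc).2 n hn)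
    have hpδ : δ ≤ p := (hfree0.le_deadline hes (hpos e hes n hn)).trans hle
    refine (min_le_left _ _).trans (h₁ z 0 hage le_rfl (by linarith) (by rwa [zero_add]) hpos e
      (mem_varSched.2 ⟨hes, hv⟩) (by linarith [G.lower_le_of_urgent (by linarith) he hv]) _ ?_)
    intro t s' z' ht1 ht2 hz' hout
    have ht0 : 0 ≤ t := by linarith
    refine ⟨fun c hc => by linarith [G.ageLe_next hK hage ht0 hz' c hc], t, p - t, hout,
      ⟨by linarith, by linarith, G.free_next hz' hfree le_rfl (by linarith) (by linarith)
        (by linarith), fun _ => G.free_next hz' hfree0 (by linarith) (by linarith) le_rfl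
        (by linarith)⟩, Or.inl ⟨by ring, ?_⟩⟩
    exact G.card_urgent_next_lt hz' (by linarith) (Finset.mem_singleton_self e) he
  have hu' : ∀ c ∈ G.urgent z p, ¬ (G.lower c : ℕ∞) < G.upper c := fun c hc hcv => hu ⟨c, hc, hcv⟩
  by_cases hx : (G.urgent z p).Nonempty
  · obtain ⟨f, hf⟩ := hx
    obtain ⟨hfs, n, hn, hle⟩ := mem_urgent.1 hf
    have hfu : (G.lower f : ℕ∞) = G.upper f := (G.lower_le_upper f).eq_of_not_lt (hu' f hf)
    have hff := mem_fixSched.2 ⟨hfs, hfu⟩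
    have hT := G.firstFixedTime_le (ν := z.1.2.1) ⟨f, hff⟩ hff
    have hT0 := G.firstFixedTime_nonneg z ⟨f, hff⟩
    rw [hn] at hfu
    rw [show G.lower f = n by exact_mod_cast hfu] at hT
    refine (min_le_right _ _).trans (h₂ z p hage hfree hu' ⟨f, hff⟩ (by linarith) (by linarith) _ ?_)
    intro s' z' hz' hout hprep
    refine ⟨fun c hc => by linarith [G.ageLe_next hK hage hT0 hz' c hc], _, _, hout, hprep,
      Or.inl ⟨by ring, ?_⟩⟩
    obtain ⟨g, hg⟩ := G.firstFixed_nonempty (ν := z.1.2.1) ⟨f, hff⟩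
    obtain ⟨hgs, hgu⟩ := mem_fixSched.1 (G.firstFixed_subset _ _ hg)
    have hgT := G.firstFixedTime_eq ⟨f, hff⟩ hg
    exact G.card_urgent_next_lt hz' (by linarith) hg
      (mem_urgent.2 ⟨hgs, _, hgu.symm, by linarith⟩)
  -- With nothing urgent, time passes to an integer translate of the free interval: translates by
  -- integers are free again.
  · have hdl : ∀ c ∈ G.sched z.1.1, ∀ n : ℕ, G.upper c = n → p < n - z.1.2.1 c := by
      intro c hc n hn
      by_contra! hcon
      exact hx ⟨c, mem_urgent.2 ⟨hc, n, hn, hcon⟩⟩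
    obtain ⟨k, hkB, hk, hready⟩ := G.exists_ready z hp0 hdl
    have hkB' : (k : ℝ) ≤ G.bound := by exact_mod_cast hkB
    have hk0 : (0 : ℝ) ≤ k := Nat.cast_nonneg _
    have hfk := hfree.add_natCast k
    rw [show p + δ + k = p + k + δ by ring] at hfk
    have hfk1 := hfree.add_natCast (k + 1)
    rw [show p + δ + ((k + 1 : ℕ) : ℝ) = p + k + 1 + δ by push_cast; ring,
      show p + ((k + 1 : ℕ) : ℝ) = p + k + 1 by push_cast; ring] at hfk1
    rcases hready with ⟨e, he, hle⟩ | ⟨hnv, hf, hT⟩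
    · refine (min_le_left _ _).trans (h₁ z (p + k) hage (by linarith) (by linarith) hfk hk e he hle
        _ ?_)
      intro t s' z' ht1 ht2 hz' hout
      have ht0 : 0 ≤ t := by linarith
      refine ⟨fun c hc => by linarith [G.ageLe_next hK hage ht0 hz' c hc], t, p + k + 1 - t, hout,
        ⟨by linarith, by linarith, G.free_next hz' hfk1 le_rfl (by linarith) (by linarith)
          (by linarith), fun _ => ?_⟩, Or.inr (by linarith)⟩
      exact G.free_next hz' hfk (by linarith) (by linarith) le_rfl (by linarith)
    · obtain ⟨g, hg⟩ := G.firstFixed_nonempty (ν := z.1.2.1) hf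
      obtain ⟨hgs, hgu⟩ := mem_fixSched.1 (G.firstFixed_subset _ _ hg)
      have hgT := G.firstFixedTime_eq hf hg
      have hT0 := G.firstFixedTime_nonneg z hf
      have hTδ : p + k + δ ≤ G.firstFixedTime z.1.1 z.1.2.1 hf := by
        rw [hgT]
        exact hfk.le_deadline hgs (hk g hgs _ hgu.symm)
      refine (min_le_right _ _).trans (h₂ z (p + k + 1) hage hfk1 hnv hf hT (by linarith) _ ?_)
      intro s' z' hz' hout hprep
      refine ⟨fun c hc => by linarith [G.ageLe_next hK hage hT0 hz' c hc], _, _, hout, hprep,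
        Or.inr (by linarith)⟩

end GSMP

namespace GSMP

theorem Good.add_of_eq {δ x y t : ℝ} {n : ℕ} (h : Good δ x y) (hy : y + t = n) :
    Good δ (x + t) 0 := by
  intro k
  have := h (k - n)
  push_cast at this
  rwa [show x - y = k - n ↔ x + t - 0 = k by constructor <;> intro <;> linarith,
    show x - y - (k - n) = x + t - 0 - k by linarith] at this

set_option linter.unusedSectionVars false

variable {S Ev : Type*} [Fintype S] [Fintype Ev] [DecidableEq Ev] (G : GSMP S Ev)
variable [MeasurableSpace S] [DiscreteMeasurableSpace S]

/-! ### Separating the clocks with a single ticking event -/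

/-- The fixed-delay event `h` can schedule the event `c`, which may have a variable delay. -/
def Spawns (h c : Ev) : Prop :=
  ∃ (s : S) (E : Finset Ev) (s' : S), E ⊆ G.fixSched s ∧ h ∈ E ∧ G.succ s E s' ≠ 0 ∧
    c ∈ G.sched s' ∧ (c ∉ G.sched s ∨ c ∈ E)

/-- A symmetric relation between events with scheduling times that is inherited by the fixed-delay
events that schedule them. -/
structure Hereditary (Rel : Ev → ℝ → Ev → ℝ → Prop) : Prop where
  symm : ∀ {c σ d σ'}, Rel c σ d σ' → Rel d σ' c σ
  spawns : ∀ {c σ h d σ'}, G.Spawns h d → Rel c σ d σ' → Rel c σ h (σ' - G.lower h)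

/-- At time `τ`, related events have clocks whose differences are `δ`-good. -/
def Separates (Rel : Ev → ℝ → Ev → ℝ → Prop) (δ : ℝ) (z : G.Config) (τ : ℝ) : Prop :=
  ∀ c ∈ G.sched z.1.1, ∀ d ∈ G.sched z.1.1, z.1.2.1 c ≤ G.bound → z.1.2.1 d ≤ G.bound →
    Rel c (τ - z.1.2.1 c) d (τ - z.1.2.1 d) → Good δ (z.1.2.1 c) (z.1.2.1 d)

-- If fixed-delay events occur, each of them has an integral clock, so a newly scheduled event has
-- the same differences modulo integers as the event `g` that schedules it. The relation passes to
-- `g`, whose scheduling time is earlier by `lower g`, and goodness of the pair with `g` is known.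
-- If a variable-delay event occurs, the surviving clocks are far from integers by the choice of the
-- step.
variable {G} in
theorem Separates.next {Rel : Ev → ℝ → Ev → ℝ → Prop} (hRel : G.Hereditary Rel) {δ τ t : ℝ}
    {z z' : G.Config} (h : G.Separates Rel δ z τ) (hδ : δ ≤ 1) (hout : G.Out δ z z' t) :
    G.Separates Rel δ z' (τ + t) := by
  obtain ⟨E, s', hz', hs', ht, hE⟩ := hout
  have hsch : z'.1.1 = s' := by rw [hz']
  have hcases : ∀ c ∈ G.sched z'.1.1, (z'.1.2.1 c = 0 ∧ (c ∉ G.sched z.1.1 ∨ c ∈ E)) ∨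
      (c ∈ G.sched z.1.1 ∧ c ∉ E ∧ z'.1.2.1 c = z.1.2.1 c + t) := by
    intro c hc
    have hv : z'.1.2.1 c = G.nextVal z.1.1 z.1.2.1 E t s' c := by rw [hz']
    by_cases hi : c ∈ G.sched s' ∧ c ∈ G.sched z.1.1 ∧ c ∉ E
    · rw [G.nextVal_of_inherited hi] at hv
      exact Or.inr ⟨hi.2.1, hi.2.2, hv⟩
    · rw [G.nextVal_of_not_inherited hi] at hv
      refine Or.inl ⟨hv, ?_⟩
      rw [hsch] at hc
      tauto
  -- The essential case, an inherited clock against a newly scheduled one; the other pairs are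
  -- unchanged or trivially good.
  have hmix : ∀ c ∈ G.sched z.1.1, c ∉ E → z.1.2.1 c + t ≤ G.bound → ∀ d ∈ G.sched z'.1.1,
      (d ∉ G.sched z.1.1 ∨ d ∈ E) → Rel c (τ - z.1.2.1 c) d (τ + t) →
      Good δ (z.1.2.1 c + t) 0 := by
    intro c hc hcE hcb d hd hdn hr
    rcases hE with ⟨⟨g, hg⟩, hEs, hEt⟩ | hE
    · have hg1 := hRel.spawns ⟨z.1.1, E, s', hEs, hg, hs', hsch ▸ hd, hdn⟩ hr
      have hgs := (mem_fixSched.1 (hEs hg)).1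
      have hgB : (G.lower g : ℝ) ≤ G.bound := by exact_mod_cast G.lower_le_bound g
      have hgt := hEt g hg
      rw [← hgt, show τ + t - (z.1.2.1 g + t) = τ - z.1.2.1 g by ring] at hg1
      exact (h c hc g hgs (by linarith) (by linarith) hg1).add_of_eq hgt
    · intro k
      rw [sub_zero]
      exact Or.inr (hE c hc hcE k)
  intro c hc d hd hcb hdb hr
  rcases hcases c hc with ⟨hc0, hcn⟩ | ⟨hcs, hcE, hcv⟩ <;>
  rcases hcases d hd with ⟨hd0, hdn⟩ | ⟨hds, hdE, hdv⟩
  · rw [hc0, hd0]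
    exact good_self hδ 0
  · rw [hc0, hdv, sub_zero, add_sub_add_right_eq_sub] at hr
    rw [hdv] at hdb
    rw [hc0, hdv]
    exact (hmix d hds hdE hdb c hc hcn (hRel.symm hr)).symm
  · rw [hcv, hd0, sub_zero, add_sub_add_right_eq_sub] at hr
    rw [hcv] at hcb
    rw [hcv, hd0]
    exact hmix c hcs hcE hcb d hd hdn hr
  · rw [hcv, hdv, add_sub_add_right_eq_sub, add_sub_add_right_eq_sub] at hr
    rw [hcv, hdv]
    rw [hcv] at hcb
    rw [hdv] at hdb
    exact (h c hcs d hds (by linarith) (by linarith) hr).add_right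

variable {G} in
theorem Separates.mono {Rel : Ev → ℝ → Ev → ℝ → Prop} {δ δ' τ : ℝ} {z : G.Config}
    (h : G.Separates Rel δ z τ) (hδ : δ' ≤ δ) : G.Separates Rel δ' z τ :=
  fun c hc d hd hcb hdb hr => (h c hc d hd hcb hdb hr).mono hδ

/-- the configurations at a time `τ` in which related clocks are separated and the free interval
`(p, p + δ)` starts at time at least `θ` -/
def stage (Rel : Ev → ℝ → Ev → ℝ → Prop) (δ K θ : ℝ) : Set G.Config :=
  {z | G.AgeLe K z ∧ ∃ τ p, θ ≤ τ + p ∧ G.Prepared δ z p ∧ G.Separates Rel δ z τ}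

/-- Induction on the number of urgent events: every step either lowers it or moves the free interval
on by at least one time unit. -/
theorem uniformlyHits_stage_of_succ {T : Set G.Config} (hT : MeasurableSet T)
    {Rel : Ev → ℝ → Ev → ℝ → Prop} (hRel : G.Hereditary Rel) {θ : ℝ}
    (h : ∀ δ > 0, ∀ K, UniformlyHits G.step T (G.stage Rel δ K (θ + 1))) :
    ∀ δ > 0, ∀ K, UniformlyHits G.step T (G.stage Rel δ K θ) := by
  have key : ∀ a : ℕ, ∀ δ > 0, ∀ K, UniformlyHits G.step T {z | G.AgeLe K z ∧ ∃ τ p, θ ≤ τ + p ∧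
      G.Prepared δ z p ∧ G.Separates Rel δ z τ ∧ (G.urgent z p).card < a} := by
    intro a
    induction a with
    | zero => exact fun δ _ K => (uniformlyHits_self G.step T).mono fun
        z ⟨_, τ, p, _, _, _, h⟩ => absurd h (Nat.not_lt_zero _)
    | succ a ih =>
      intro δ hδ K
      obtain ⟨ε, hε, hstep⟩ := G.exists_le_step_prepared K hδ
      refine ((ih (δ / 6) (by positivity) (K + G.bound + 3)).union
        (h (δ / 6) (by positivity) (K + G.bound + 3))).of_step hT hε ?_
      rintro z ⟨hage, τ, p, hθ, hprep, hsep, hcard⟩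
      refine (hstep z p hage hprep).trans (measure_mono ?_)
      have hδ1 : δ ≤ 1 := by linarith [hprep.1, hprep.2.1]
      rintro z' ⟨hage', t, p', hout, hprep', hor⟩
      have hsep' := (hsep.mono (show δ / 6 ≤ δ by linarith)).next hRel (by linarith) hout
      rcases hor with ⟨htp, hc⟩ | htp
      · exact Or.inl ⟨hage', τ + t, p', by linarith, hprep', hsep', by omega⟩
      · exact Or.inr ⟨hage', τ + t, p', by linarith, hprep', hsep'⟩
  intro δ hδ K
  refine (key (Fintype.card Ev + 1) δ hδ K).mono ?_
  rintro z ⟨hage, τ, p, hθ, hprep, hsep⟩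
  exact ⟨hage, τ, p, hθ, hprep, hsep, Nat.lt_succ_of_le (Finset.card_le_univ _)⟩

theorem uniformlyHits_stage_zero {T : Set G.Config} (hT : MeasurableSet T)
    {Rel : Ev → ℝ → Ev → ℝ → Prop} (hRel : G.Hereditary Rel) (N : ℕ)
    (h : ∀ δ > 0, ∀ K, UniformlyHits G.step T (G.stage Rel δ K N)) :
    ∀ δ > 0, ∀ K, UniformlyHits G.step T (G.stage Rel δ K 0) := by
  induction N with
  | zero => simpa using h
  | succ N ih =>
    refine ih (G.uniformlyHits_stage_of_succ hT hRel ?_)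
    simpa using h

/-- Good differences between events say nothing about the distance of a clock to the integers. One
more step of type `Out` provides the comparison with the zero clock that `Sep` demands. -/
theorem uniformlyHits_of_good {δ : ℝ} (hδ : 0 < δ) (K : ℝ) :
    UniformlyHits G.step G.bottom {z | G.AgeLe K z ∧ (∃ p, G.Prepared δ z p) ∧
      ∀ c ∈ G.sched z.1.1, ∀ d ∈ G.sched z.1.1, z.1.2.1 c ≤ G.bound → z.1.2.1 d ≤ G.bound →
        Good δ (z.1.2.1 c) (z.1.2.1 d)} := by
  obtain ⟨ε, hε, hstep⟩ := G.exists_le_step_prepared K hδ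
  refine (G.uniformlyHits_sep (δ := δ / 6) (by positivity) (K + G.bound + 3)).of_step
    G.measurableSet_bottom hε ?_
  rintro z ⟨hage, ⟨p, hprep⟩, hgood⟩
  have hδ1 : δ ≤ 1 := by linarith [hprep.1, hprep.2.1]
  refine (hstep z p hage hprep).trans (measure_mono ?_)
  rintro z' ⟨hage', t, p', ⟨E, s', hz', hs', ht, hE⟩, -⟩
  refine ⟨G.sep_next (by linarith) (fun c hc d hd hcb hdb => (hgood c hc d hd hcb hdb).mono
    (by linarith)) ht hz' fun c hc hcE hcb => ?_, hage'⟩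
  rcases hE with ⟨⟨g, hg⟩, hEs, hEt⟩ | hE
  · have hgB : (G.lower g : ℝ) ≤ G.bound := by exact_mod_cast G.lower_le_bound g
    have hgt := hEt g hg
    exact ((hgood c hc g (mem_fixSched.1 (hEs hg)).1 (by linarith) (by linarith)).add_of_eq
      hgt).mono (by linarith)
  · intro k
    rw [sub_zero]
    exact Or.inr (hE c hc hcE k)

/-- `c` can be scheduled through a chain of fixed-delay events that starts with `h`. -/
def Ancestor : Ev → Ev → Prop := Relation.TransGen G.Spawns

/-- `Spawns` leaves the type of the scheduled event open, but every event that spawns another has a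
fixed delay; on a cycle this applies to all of them. -/
theorem ticking_of_ancestor {h : Ev} (hh : G.Ancestor h h) : G.Ticking h := by
  have hfix : ∀ {a b}, G.Spawns a b → (G.lower a : ℕ∞) = G.upper a :=
    fun ⟨_, _, _, hE, ha, _⟩ => (mem_fixSched.1 (hE ha)).2
  have key : ∀ {a b}, G.Ancestor a b → (G.lower b : ℕ∞) = G.upper b →
      Relation.TransGen G.Schedules a b := by
    intro a b hab
    induction hab with
    | single hs => exact fun hb => Relation.TransGen.single ⟨hb, hs⟩
    | tail _ hs ih => exact fun hb => (ih (hfix hs)).tail ⟨hb, hs⟩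
  obtain ⟨b, hb, -⟩ := Relation.TransGen.head'_iff.1 hh
  exact key hh (hfix hb)

/-- the number of ancestors of an event -/
noncomputable def level (c : Ev) : ℕ := {h | G.Ancestor h c}.ncard

theorem level_le (c : Ev) : G.level c ≤ Fintype.card Ev := by
  rw [← Nat.card_eq_fintype_card, ← Set.ncard_univ]
  exact Set.ncard_le_ncard (subset_univ _)

/-- Every ancestor of `h` is an ancestor of `d`, and `h` itself is an ancestor of `d` only. -/
theorem level_lt {h d : Ev} (hs : G.Spawns h d) (hh : ¬ G.Ancestor h h) :
    G.level h < G.level d := by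
  refine Set.ncard_lt_ncard ⟨fun a ha => Relation.TransGen.tail ha hs, fun hsub => hh ?_⟩
  exact hsub (Relation.TransGen.single hs)

/-- Going back to the scheduling event costs at most `G.bound` in time and at least one level. Hence
a chain of fixed-delay events without ticking members that ends late enough cannot go back to the
start. -/
theorem bound_mul_level_lt {h d : Ev} (hs : G.Spawns h d) (hh : ¬ G.Ancestor h h) {σ : ℝ}
    (hσ : (G.bound * G.level d : ℝ) < σ) : (G.bound * G.level h : ℝ) < σ - G.lower h := by
  have h1 : (G.level h : ℝ) + 1 ≤ G.level d := by exact_mod_cast G.level_lt hs hh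
  have h2 : (G.lower h : ℝ) ≤ G.bound := by exact_mod_cast G.lower_le_bound h
  have h3 := mul_le_mul_of_nonneg_left h1 (Nat.cast_nonneg (α := ℝ) G.bound)
  linarith

/-- `c` can be scheduled through a chain that starts with a ticking event. -/
def Touched (c : Ev) : Prop := ∃ x, G.Ancestor x x ∧ G.Ancestor x c

/-- `c` is not touched and was scheduled after enough time. -/
def Fresh (c : Ev) (σ : ℝ) : Prop := ¬ G.Touched c ∧ (G.bound * G.level c : ℝ) < σ

/-- `c` is not touched, or ticking, or was scheduled after enough time. -/
def Settled (c : Ev) (σ : ℝ) : Prop :=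
  (G.Touched c → G.Ancestor c c) ∨ (G.bound * G.level c : ℝ) < σ

/-- If `d` does not descend from a ticking event, then neither does the event `h` that schedules it,
and `h` is not ticking, so its level is smaller. -/
theorem hereditary_fresh : G.Hereditary fun c σ d σ' => G.Fresh c σ ∨ G.Fresh d σ' where
  symm := Or.symm
  spawns := by
    rintro c σ h d σ' hs (hc | ⟨hd, hσ⟩)
    · exact Or.inl hc
    · refine Or.inr ⟨fun ⟨x, hx, hxh⟩ => hd ⟨x, hx, hxh.tail hs⟩,
        G.bound_mul_level_lt hs (fun hh => hd ⟨h, hh, .single hs⟩) hσ⟩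

/-- The event `h` that schedules a settled event `d` is settled. If `h` descends from a ticking
event `x`, then so does `d`. When this forces `d` to be ticking, single-ticking gives `x = d`, so
`h` lies on a cycle and is ticking itself. -/
theorem hereditary_settled (hG : G.SingleTicking) :
    G.Hereditary fun c σ d σ' => G.Settled c σ ∧ G.Settled d σ' where
  symm := And.symm
  spawns := by
    rintro c σ h d σ' hs ⟨hc, hd⟩
    refine ⟨hc, ?_⟩
    by_cases hh : G.Ancestor h h
    · exact Or.inl fun _ => hh
    · rcases hd with hd | hd
      · refine Or.inl fun ⟨x, hx, hxh⟩ => ?_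
        have hdd := hd ⟨x, hx, hxh.tail hs⟩
        obtain rfl := hG x d (G.ticking_of_ancestor hx) (G.ticking_of_ancestor hdd)
        exact hxh.head hs
      · exact Or.inr (G.bound_mul_level_lt hs hh hd)

/-- In the threshold, one multiple of `G.bound` covers the age of the clock and the others its
level. Of the summand `2`, one unit covers `p ≤ 1` and the other makes the inequality strict. -/
theorem bound_mul_level_lt_of_late {c : Ev} {τ p a : ℝ}
    (hτ : ((G.bound * (Fintype.card Ev + 1) + 2 : ℕ) : ℝ) ≤ τ + p) (hp : p ≤ 1)
    (ha : a ≤ G.bound) : (G.bound * G.level c : ℝ) < τ - a := by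
  have h1 : (G.level c : ℝ) ≤ Fintype.card Ev := by exact_mod_cast G.level_le c
  have h2 := mul_le_mul_of_nonneg_left h1 (Nat.cast_nonneg (α := ℝ) G.bound)
  push_cast at hτ
  linarith

/-- At the end of this phase all active clocks belong to events scheduled late. These are settled,
so all pairs of active clocks are good. -/
theorem uniformlyHits_settled (hG : G.SingleTicking) : ∀ δ > 0, ∀ K,
    UniformlyHits G.step G.bottom
      (G.stage (fun c σ d σ' => G.Settled c σ ∧ G.Settled d σ') δ K 0) := by
  refine G.uniformlyHits_stage_zero G.measurableSet_bottom (G.hereditary_settled hG)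
    (G.bound * (Fintype.card Ev + 1) + 2) fun δ hδ K => (G.uniformlyHits_of_good hδ K).mono ?_
  rintro z ⟨hage, τ, p, hτ, hprep, hsep⟩
  have hp : p ≤ 1 := by linarith [hprep.2.1]
  exact ⟨hage, ⟨p, hprep⟩, fun c hc d hd hcb hdb => hsep c hc d hd hcb hdb
    ⟨Or.inr (G.bound_mul_level_lt_of_late hτ hp hcb),
      Or.inr (G.bound_mul_level_lt_of_late hτ hp hdb)⟩⟩

/-- At the end of this phase every active pair with an untouched member is good. Resetting the
reference time to `0` starts the second phase: no event counts as late any more, so a settled event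
is untouched or ticking. -/
theorem uniformlyHits_fresh (hG : G.SingleTicking) : ∀ δ > 0, ∀ K,
    UniformlyHits G.step G.bottom
      (G.stage (fun c σ d σ' => G.Fresh c σ ∨ G.Fresh d σ') δ K 0) := by
  refine G.uniformlyHits_stage_zero G.measurableSet_bottom G.hereditary_fresh
    (G.bound * (Fintype.card Ev + 1) + 2) fun δ hδ K => (G.uniformlyHits_settled hG δ hδ K).mono ?_
  rintro z ⟨hage, τ, p, hτ, hprep, hsep⟩
  have hp : p ≤ 1 := by linarith [hprep.2.1]
  refine ⟨hage, 0, p, by linarith [hprep.1], hprep, fun c hc d hd hcb hdb ⟨hcs, hds⟩ => ?_⟩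
  have hold : ∀ e ∈ G.sched z.1.1, G.Settled e (0 - z.1.2.1 e) → G.Touched e → G.Ancestor e e := by
    rintro e he (h | h)
    · exact h
    · have h1 := (z.2.2.1 e he).1
      have h2 : (0 : ℝ) ≤ G.bound * G.level e := by positivity
      linarith
  by_cases hct : G.Touched c
  · by_cases hdt : G.Touched d
    -- Both events are ticking, so they coincide and their difference is zero. No other pair of
    -- settled events lacks an untouched member.
    · obtain rfl := hG c d (G.ticking_of_ancestor (hold c hc hcs hct))
        (G.ticking_of_ancestor (hold d hd hds hdt))
      exact good_self (by linarith [hprep.1, hprep.2.1]) _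
    · exact hsep c hc d hd hcb hdb (Or.inr ⟨hdt, G.bound_mul_level_lt_of_late hτ hp hdb⟩)
  · exact hsep c hc d hd hcb hdb (Or.inl ⟨hct, G.bound_mul_level_lt_of_late hτ hp hcb⟩)

/-- At reference time `0` all scheduling times are at most `0`, so no event is fresh and the first
phase starts with nothing to verify. -/
theorem uniformlyHits_bottom (hG : G.SingleTicking) (K : ℝ) :
    UniformlyHits G.step G.bottom {z | G.AgeLe K z} := by
  refine G.uniformlyHits_ageLe G.measurableSet_bottom (fun δ hδ K =>
    (G.uniformlyHits_fresh hG δ hδ K).mono ?_) K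
  rintro z ⟨hage, p, hprep⟩
  refine ⟨hage, 0, p, by linarith [hprep.1], hprep, fun c hc d hd _ _ hr => ?_⟩
  have hold : ∀ e ∈ G.sched z.1.1, ¬ G.Fresh e (0 - z.1.2.1 e) := by
    rintro e he ⟨-, h⟩
    have h1 := (z.2.2.1 e he).1
    have h2 : (0 : ℝ) ≤ G.bound * G.level e := by positivity
    linarith
  exact (hr.elim (hold c hc) (hold d hd)).elim

end GSMP

theorem mainTheorem3 {S Ev : Type*} [Fintype S] [Fintype Ev] [DecidableEq Ev]
    [MeasurableSpace S] [DiscreteMeasurableSpace S] (G : GSMP S Ev) (hG : G.SingleTicking) :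
    ∀ᵐ σ ∂G.runMeasure, ∃ (n : ℕ) (C : Set G.Region), G.IsBSCC C ∧ G.regionOf (σ n) ∈ C :=
  G.ae_exists_mem_bottom (G.uniformlyHits_bottom hG)
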